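/- Let $N\in\mathbb N$, $N\ge 1$. Let $2^*=\frac{2N}{N-2}$ if $N\ge3$ and consider real-valued functions on $\mathbb R^N$. Assume: (H1) $V\in L^\infty(\mathbb R^N)$; (H2) $V$ is $1$-periodic in all coordinates; (H3) $f\in C^1(\mathbb R)$, $f(0)=f'(0)=0$; if $N\ge 3$, then $f'(s)/|s|^{2^*-2}\to0$ as $|s|\to\infty$; if $N\in\{1,2\}$, then there is $p>2$ with $f'(s)/|s|^{p-2}\to0$ as $|s|\to\infty$. Let $(\cdot,\cdot)_2$ and $|\cdot|_2$ be the scalar product and norm of $L^2(\mathbb R^N)$, $F(s)=\int_0^s f$, $$\Phi(u)=\frac12\int_{\mathbb R^N}\bigl(|\nabla u|^2+Vu^2\bigr)-\int_{\mathbb R^N}F(u),\qquad u\in H^1(\mathbb R^N),$$ and $\Sigma_\beta=\{u\in H^1(\mathbb R^N): |u|_2^2=\beta\}$ for $\beta>0$. A critical point of $\Phi|_{\Sigma_\beta}$ with Lagrange multiplier $\lambda\in\mathbb R$ is a $u\in\Sigma_\beta$ with $\Phi'(u)=\lambda\,(u,\cdot)_2$. For such $(u,\lambda)$ put $$b_{u,\lambda}(v,w)=\int_{\mathbb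 R^N}\bigl(\nabla v\cdot\nabla w+(V-\lambda)vw-f'(u)vw\bigr),\qquad v,w\in H^1(\mathbb R^N),$$ and $T_u=\{v\in H^1(\mathbb R^N): (v,u)_2=0\}$. * The Morse index $m(u)\in\{0,1,2,\dots\}\cup\{\infty\}$ of $u$ with respect to $\Phi|_{\Sigma_\beta}$ is the supremum of the dimensions of the subspaces of $T_u$ on which $b_{u,\lambda}$ is negative definite. * $u$ is nondegenerate if the bounded operator on $T_u$ that represents $b_{u,\lambda}|_{T_u\times T_u}$ in the $H^1$ scalar product is an isomorphism of $T_u$. * $u$ is fully nondegenerate if for every $g\in H^{-1}(\mathbb R^N)=H^1(\mathbb R^N)^*$ there is a unique weak solution $z_g\in H^1(\mathbb R^N)$ of $-\Delta z_g+(V-\lambda)z_g-f'(u)z_g=g$, i.e. $b_{u,\lambda}(z_g,w)=g(w)$ for all $w\in H^1(\mathbb R^N)$, and if the solution $z_u$ for $g=(u,\cdot)_2$ satisfies $(u,z_u)_2\ne0$. For $a=(a^1,\dots,a^n)\in(\mathbb Z^N)^n$ let $d(a)=\min_{i\ne j}|a^i-a^j|$, and let $\mathcal T_bu(x)=u(x-b)$.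 **Theorem.** Let $\alpha>0$, let $n\ge2$ be an integer, and let $\bar u$ be a fully nondegenerate critical point of $\Phi|_{\Sigma_{\alpha/n}}$ with Lagrange multiplier $\bar\lambda$ and finite Morse index $m(\bar u)$. Then there is $\varepsilon_0>0$ such that for every $\varepsilon\in(0,\varepsilon_0]$ there is $R_\varepsilon>0$ with the following property. For every $a\in(\mathbb Z^N)^n$ with $d(a)\ge R_\varepsilon$ there is a unique pair $(u_a,\lambda_a)\in H^1(\mathbb R^N)\times\mathbb R$ such that $u_a$ is a critical point of $\Phi|_{\Sigma_\alpha}$ with Lagrange multiplier $\lambda_a$ and $$\Bigl\|u_a-\sum_{i=1}^n\mathcal T_{a^i}\bar u\Bigr\|_{H^1(\mathbb R^N)}\le\varepsilon,\qquad|\lambda_a-\bar\lambda|\le\varepsilon.$$ Moreover, $u_a$ is a nondegenerate critical point of $\Phi|_{\Sigma_\alpha}$, and its Morse index with respect to $\Phi|_{\Sigma_\alpha}$ is $$m(u_a)=\begin{cases}n\,(m(\bar u)+1)-1&\text{if }(\bar u,z_{\bar u})_2<0,\\ n\,m(\bar u)&\text{if }(\bar u,z_{\bar u})_2>0.\end{cases}$$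 If in addition (H4) $f(s)/|s|$ is nondecreasing in $s\in\mathbb R\setminus\{0\}$ and $f(s)s>0$ for all $s\ne0$, then $m(u_a)>0$. -/

import Mathlib

open MeasureTheory Filter Topology
open scoped ContDiff ENNReal

noncomputable section

/-- Euclidean space `ℝ^N`. -/
abbrev RN (N : ℕ) : Type := EuclideanSpace ℝ (Fin N)

/-- `G` is the weak gradient of `u` on `ℝ^N`: for every real test function `φ ∈ C_c^∞(ℝ^N)` and
every direction `y`, `∫ u ∂_y φ = - ∫ (G · y) φ`. -/
def IsWeakGradient {N : ℕ} (u : RN N → ℝ) (G : RN N → RN N) : Prop :=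
  ∀ φ : RN N → ℝ, ContDiff ℝ ∞ φ → HasCompactSupport φ → ∀ y : RN N,
    ∫ x, u x * fderiv ℝ φ x y = -∫ x, inner ℝ (G x) y * φ x

theorem IsWeakGradient.congr {N : ℕ} {u u' : RN N → ℝ} {G G' : RN N → RN N}
    (h : IsWeakGradient u G) (hu : u' =ᵐ[volume] u) (hG : G' =ᵐ[volume] G) :
    IsWeakGradient u' G' := by
  intro φ hφ hc y
  have h1 : ∫ x, u' x * fderiv ℝ φ x y = ∫ x, u x * fderiv ℝ φ x y :=
    integral_congr_ae (by filter_upwards [hu] with x hx; rw [hx])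
  have h2 : ∫ x, inner ℝ (G' x) y * φ x = ∫ x, inner ℝ (G x) y * φ x :=
    integral_congr_ae (by filter_upwards [hG] with x hx; rw [hx])
  rw [h1, h2]
  exact h φ hφ hc y

theorem IsWeakGradient.zero (N : ℕ) :
    IsWeakGradient (fun _ : RN N => (0 : ℝ)) (fun _ => 0) := by
  intro φ _ _ y
  simp

theorem IsWeakGradient.smul {N : ℕ} {u : RN N → ℝ} {G : RN N → RN N}
    (h : IsWeakGradient u G) (c : ℝ) :
    IsWeakGradient (fun x => c * u x) (fun x => c • G x) := by
  intro φ hφ hc y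
  simp only [mul_assoc, real_inner_smul_left, integral_const_mul]
  rw [h φ hφ hc y, mul_neg]

theorem IsWeakGradient.add {N : ℕ} {u v : RN N → ℝ} {G H : RN N → RN N}
    (h : IsWeakGradient u G) (h' : IsWeakGradient v H)
    (hu : MemLp u 2 volume) (hv : MemLp v 2 volume)
    (hG : MemLp G 2 volume) (hH : MemLp H 2 volume) :
    IsWeakGradient (fun x => u x + v x) (fun x => G x + H x) := by
  intro φ hφ hc y
  have hφ2 : MemLp φ 2 volume := hφ.continuous.memLp_of_hasCompactSupport hc
  have hd : MemLp (fun x => fderiv ℝ φ x y) 2 volume := by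
    refine Continuous.memLp_of_hasCompactSupport ?_ (hc.fderiv_apply (𝕜 := ℝ) y)
    exact (hφ.continuous_fderiv (by simp)).clm_apply continuous_const
  have e1 : Integrable (fun x => u x * fderiv ℝ φ x y) volume := hu.integrable_mul hd
  have e2 : Integrable (fun x => v x * fderiv ℝ φ x y) volume := hv.integrable_mul hd
  have e3 : Integrable (fun x => inner ℝ (G x) y * φ x) volume :=
    (hG.inner_const y).integrable_mul hφ2
  have e4 : Integrable (fun x => inner ℝ (H x) y * φ x) volume :=
    (hH.inner_const y).integrable_mul hφ2
  simp only [add_mul, inner_add_left]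
  rw [integral_add e1 e2, integral_add e3 e4, h φ hφ hc y, h' φ hφ hc y]
  ring

theorem IsWeakGradient.translate {N : ℕ} {u : RN N → ℝ} {G : RN N → RN N}
    (h : IsWeakGradient u G) (b : RN N) :
    IsWeakGradient (fun x => u (x - b)) (fun x => G (x - b)) := by
  intro φ hφ hc y
  have hφ' : ContDiff ℝ ∞ (fun x => φ (x + b)) := hφ.comp (contDiff_id.add contDiff_const)
  have hc' : HasCompactSupport (fun x => φ (x + b)) :=
    hc.comp_homeomorph (Homeomorph.addRight b)
  have key := h _ hφ' hc' y
  simp only [fderiv_comp_add_right] at key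
  rw [← integral_add_right_eq_self (μ := volume) (fun x => u (x - b) * fderiv ℝ φ x y) b,
    ← integral_add_right_eq_self (μ := volume) (fun x => inner ℝ (G (x - b)) y * φ x) b]
  simpa only [add_sub_cancel_right] using key

/-- The Sobolev space `H^1(ℝ^N)` of real functions: pairs `(u, ∇u)` of an `L²` function and an `L²`
vector field which is its weak gradient, inside the Hilbert space `L²(ℝ^N) × L²(ℝ^N; ℝ^N)`. The
induced norm is the standard one, `‖u‖² = ∫ |u|² + ∫ |∇u|²`. -/
def H1 (N : ℕ) : Submodule ℝ
    (WithLp 2 (Lp ℝ 2 (volume : Measure (RN N)) × Lp (RN N) 2 (volume : Measure (RN N)))) where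
  carrier := {p | IsWeakGradient p.fst p.snd}
  zero_mem' := (IsWeakGradient.zero N).congr (Lp.coeFn_zero _ _ _) (Lp.coeFn_zero _ _ _)
  add_mem' := fun {p q} hp hq =>
    (IsWeakGradient.add hp hq (Lp.memLp _) (Lp.memLp _) (Lp.memLp _) (Lp.memLp _)).congr
      (Lp.coeFn_add p.fst q.fst) (Lp.coeFn_add p.snd q.snd)
  smul_mem' := fun c p hp =>
    (IsWeakGradient.smul hp c).congr (Lp.coeFn_smul c p.fst) (Lp.coeFn_smul c p.snd)

/-- The inclusion of `H^1(ℝ^N)` into `L²(ℝ^N)`. -/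
def toL2 (N : ℕ) : H1 N →L[ℝ] Lp ℝ 2 (volume : Measure (RN N)) :=
  (WithLp.fstL 2 ℝ _ _).comp (H1 N).subtypeL

/-- The weak gradient as a map from `H^1(ℝ^N)` to `L²(ℝ^N; ℝ^N)`. -/
def grad (N : ℕ) : H1 N →L[ℝ] Lp (RN N) 2 (volume : Measure (RN N)) :=
  (WithLp.sndL 2 ℝ _ _).comp (H1 N).subtypeL

/-- The `L²` scalar product `(u, v)_2` of two elements of `H^1(ℝ^N)`. -/
def l2inner {N : ℕ} (u v : H1 N) : ℝ := inner ℝ (toL2 N u) (toL2 N v)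

/-- The functional `(u, ·)_2 ∈ H^{-1}(ℝ^N)`: the embedding of `H^1` into its dual. -/
def l2functional {N : ℕ} (u : H1 N) : StrongDual ℝ (H1 N) :=
  (innerSL ℝ (toL2 N u)).comp (toL2 N)

/-- The translate `x ↦ u (x - b)` of `u ∈ H^1(ℝ^N)`, with weak gradient `x ↦ ∇u (x - b)`. -/
def shift {N : ℕ} (b : RN N) (u : H1 N) : H1 N :=
  ⟨WithLp.toLp 2
    (Lp.compMeasurePreserving (fun x => x - b) (measurePreserving_sub_right volume b) (toL2 N u),
     Lp.compMeasurePreserving (fun x => x - b) (measurePreserving_sub_right volume b) (grad N u)),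
    (IsWeakGradient.translate u.2 b).congr
      (Lp.coeFn_compMeasurePreserving _ (measurePreserving_sub_right volume b))
      (Lp.coeFn_compMeasurePreserving _ (measurePreserving_sub_right volume b))⟩

/-- A lattice point of `ℤ^N` as a vector of `ℝ^N`. -/
def latticePoint {N : ℕ} (k : Fin N → ℤ) : RN N := WithLp.toLp 2 (fun i => (k i : ℝ))

/-- `d(a) = min_{i ≠ j} |a^i - a^j|` for `a ∈ (ℤ^N)^n` (used for `n ≥ 2` only). -/
def minDist {N n : ℕ} (a : Fin n → Fin N → ℤ) : ℝ :=
  ⨅ p : {p : Fin n × Fin n // p.1 ≠ p.2}, ‖latticePoint (a p.1.1) - latticePoint (a p.1.2)‖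

/-- The sum of translates `∑ i, 𝒯_{a^i} u`. -/
def bumpSum {N n : ℕ} (a : Fin n → Fin N → ℤ) (u : H1 N) : H1 N :=
  ∑ i, shift (latticePoint (a i)) u

/-- `V ∈ L^∞(ℝ^N)` is `1`-periodic in all coordinates. -/
structure IsPeriodicPotential {N : ℕ} (V : RN N → ℝ) : Prop where
  memLp : MemLp V ∞ volume
  periodic : ∀ i : Fin N, ∀ᵐ x, V (x + EuclideanSpace.single i 1) = V x

/-- `f ∈ C^1(ℝ)`, `f(0) = f'(0) = 0` and Sobolev-subcritical growth of `f'` as `|s| → ∞`; the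
critical exponent is `2* = 2N/(N-2)` for `N ≥ 3`. -/
structure IsSubcriticalNonlinearity (N : ℕ) (f : ℝ → ℝ) : Prop where
  contDiff : ContDiff ℝ 1 f
  zero : f 0 = 0
  deriv_zero : deriv f 0 = 0
  growth_of_three_le : 3 ≤ N →
    Tendsto (fun s : ℝ => deriv f s / |s| ^ (2 * (N : ℝ) / ((N : ℝ) - 2) - 2))
      (cocompact ℝ) (𝓝 0)
  growth_of_le_two : N ≤ 2 → ∃ p : ℝ, 2 < p ∧
    Tendsto (fun s : ℝ => deriv f s / |s| ^ (p - 2)) (cocompact ℝ) (𝓝 0)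

/-- `f(s)/|s|` is nondecreasing (on `s ≠ 0`, where it is defined) and `f(s) s > 0` for `s ≠ 0`. -/
structure IsMonotoneNonlinearity (f : ℝ → ℝ) : Prop where
  monotoneOn : MonotoneOn (fun s => f s / |s|) {0}ᶜ
  mul_pos : ∀ s : ℝ, s ≠ 0 → 0 < f s * s

/-- `Φ(u) = ½ ∫ (|∇u|² + V u²) - ∫ F(u)`, with `F(s) = ∫_0^s f`. -/
def Phi {N : ℕ} (V : RN N → ℝ) (f : ℝ → ℝ) (u : H1 N) : ℝ :=
  (1 / 2) * (∫ x, (‖grad N u x‖ ^ 2 + V x * toL2 N u x ^ 2))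
    - ∫ x, ∫ t in (0 : ℝ)..(toL2 N u x), f t

/-- The sphere `Σ_α = {u ∈ H^1(ℝ^N) : |u|_2² = α}`. -/
def Sigma2 (N : ℕ) (α : ℝ) : Set (H1 N) := {u | ‖toL2 N u‖ ^ 2 = α}

/-- `u` is a critical point of `Φ` restricted to `Σ_α`, with Lagrange multiplier `l`:
`u ∈ Σ_α`, and the derivative of `Φ` at `u` is `l (u, ·)_2`. -/
structure IsConstrainedCritical {N : ℕ} (V : RN N → ℝ) (f : ℝ → ℝ) (α : ℝ) (u : H1 N)
    (l : ℝ) : Prop where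
  mem_sphere : u ∈ Sigma2 N α
  hasFDerivAt : HasFDerivAt (Phi V f) (l • l2functional u) u

/-- The bilinear form `(v, w) ↦ ∫ (∇v · ∇w + (V - l) v w - f'(u) v w)` on `H^1(ℝ^N)`. -/
def hessianForm {N : ℕ} (V : RN N → ℝ) (f : ℝ → ℝ) (u : H1 N) (l : ℝ) (v w : H1 N) : ℝ :=
  ∫ x, (inner ℝ (grad N v x) (grad N w x) + (V x - l) * toL2 N v x * toL2 N w x
    - deriv f (toL2 N u x) * toL2 N v x * toL2 N w x)

/-- `z ∈ H^1(ℝ^N)` is a weak solution of `-Δz + (V - l) z - f'(u) z = g`, `g ∈ H^{-1}(ℝ^N)`. -/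
def IsLinearizedSolution {N : ℕ} (V : RN N → ℝ) (f : ℝ → ℝ) (u : H1 N) (l : ℝ)
    (g : StrongDual ℝ (H1 N)) (z : H1 N) : Prop :=
  ∀ w : H1 N, hessianForm V f u l z w = g w

/-- Full nondegeneracy of a constrained critical point `u` with Lagrange multiplier `l`: the
linearized equation is uniquely solvable for every right-hand side in `H^{-1}(ℝ^N)`, and the
solution `z_u` for the right-hand side `u` satisfies `(u, z_u)_2 ≠ 0`. -/
structure IsFullyNondegenerate {N : ℕ} (V : RN N → ℝ) (f : ℝ → ℝ) (u : H1 N) (l : ℝ) :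
    Prop where
  existsUnique : ∀ g : StrongDual ℝ (H1 N), ∃! z : H1 N, IsLinearizedSolution V f u l g z
  l2inner_ne_zero : ∀ z : H1 N, IsLinearizedSolution V f u l (l2functional u) z →
    l2inner u z ≠ 0

/-- The tangent space `T_u Σ_α = {v ∈ H^1(ℝ^N) : (v, u)_2 = 0}`. -/
def tangentSpace {N : ℕ} (u : H1 N) : Submodule ℝ (H1 N) :=
  LinearMap.ker (l2functional u : H1 N →ₗ[ℝ] ℝ)

/-- The Morse index of `u` as a critical point of `Φ|_{Σ_α}` with Lagrange multiplier `l`: the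
supremum of the dimensions of subspaces of `T_u Σ_α` on which the Hessian is negative definite. -/
def morseIndex {N : ℕ} (V : RN N → ℝ) (f : ℝ → ℝ) (u : H1 N) (l : ℝ) : ℕ∞ :=
  ⨆ Z : {Z : Submodule ℝ (H1 N) //
      Z ≤ tangentSpace u ∧ ∀ v ∈ Z, v ≠ 0 → hessianForm V f u l v v < 0},
    Cardinal.toENat (Module.rank ℝ Z.1)

/-- Nondegeneracy of `u` as a critical point of `Φ|_{Σ_α}` with Lagrange multiplier `l`: the
operator on `T_u Σ_α` which represents the Hessian in the `H^1` scalar product is an isomorphism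
of `T_u Σ_α`. (This does not depend on which of the equivalent scalar products is used.) -/
def IsNondegenerate {N : ℕ} (V : RN N → ℝ) (f : ℝ → ℝ) (u : H1 N) (l : ℝ) : Prop :=
  ∃ A : tangentSpace u ≃L[ℝ] tangentSpace u,
    ∀ v w : tangentSpace u, inner ℝ (A v) w = hessianForm V f u l v w

/-- `(w, μ)` is a normalized multibump solution for `(u, l)` and `a`, up to `ε`: `w` is a critical
point of `Φ|_{Σ_α}` with multiplier `μ`, `‖w - ∑ i, 𝒯_{a^i} u‖_{H^1} ≤ ε` and `|μ - l| ≤ ε`. -/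
structure IsMultibump {N n : ℕ} (V : RN N → ℝ) (f : ℝ → ℝ) (α : ℝ) (u : H1 N) (l : ℝ)
    (a : Fin n → Fin N → ℤ) (ε : ℝ) (w : H1 N) (μ : ℝ) : Prop where
  critical : IsConstrainedCritical V f α w μ
  norm_sub_le : ‖w - bumpSum a u‖ ≤ ε
  abs_sub_le : |μ - l| ≤ ε

end

/-! ### Morse indices of symmetric forms, with and without a linear constraint. -/

noncomputable section AbstractForms

variable {H : Type*} [NormedAddCommGroup H] [InnerProductSpace ℝ H]

/-! In the `H¹` scalar product the problem reads `B₀ u - μ J u - N u = 0`, `⟪J u, u⟫ = α`. Here `B₀`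
(`energyOp`) and `J` (`massOp`) commute with lattice translations `T_b`, and `N` (`nem`) is local
with derivative `K u` (`nemDeriv`). Equation and constraint form one zero problem on `H × ℝ`, whose
derivative is the bordered operator `(v, ν) ↦ (A v - ν J u, ⟪J u, v⟫)`, `A = B₀ - μ J - K u`. It is
invertible once `A` is invertible and the solution of `A z = J u` has `⟪J u, z⟫ ≠ 0`; at `ubar` this
is full nondegeneracy. At a sum of `n` distant translates both conditions persist with uniform
constants: `z` is close to the sum of the translates of `zbar`, and the pairing is close to `n
(ubar, zbar)_2`. The quantitative inverse function theorem `exists_unique_zero` then gives the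
unique solution.

The hard point is the operator `B - ∑ i, K_i`, where `B = B₀ - lbar J` and the `K_i` are the
conjugates of `K = K ubar` by the translations (`exists_splitting`). If `B` were negative somewhere,
far translates of that vector would add negative directions to `B - K`, because `K T_b → 0`
strongly. So finite index forces `B ≥ 0`, and invertibility of `B - K` makes `B` coercive. Let `k`
be the index of `B - K` on all of `H¹`. A symmetric `S` of rank at most `k` makes `B - K + S`
coercive. For `C = K - S` the interactions `C T_b B⁻¹ C` tend to zero in norm, which bounds `B - t ∑
i, C_i` below uniformly in `t ∈ [0, 1]`; following the segment, it is coercive at `t = 1`. Hence `B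
- ∑ i, K_i` is coercive on a subspace of codimension at most `n k`, while translates of a negative
space of `B - K` span `n k` negative directions. The index is therefore exactly `n k`, and this and
the invertibility are stable.

Norm decay of `K T_b B⁻¹ K` is obtained by localization: `ubar` is approximated by compactly
supported functions, and a cutoff argument shows that solutions of `B y = K g` carry energy `O(R⁻²)`
outside a ball of radius `R` (`inner_cutoff_le`, `norm_nemDeriv_translate_le`).

The constraint lowers the free index by one if the pairing is negative and leaves it unchanged if it
is positive (`formIndex_top_of_neg`, `formIndex_top_of_pos`). So `k` is `m + 1` or `m`, and the sign
of the pairing passes to `u_a`, which gives both formulas. Under (H4), `⟪(B - K) ubar, ubar⟫ = ∫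
(f(ubar) ubar - f'(ubar) ubar²) ≤ 0` excludes `k = 0`. -/

/-- The quadratic form of `A` is negative definite on `Z`. -/
def NegOn (A : H →L[ℝ] H) (Z : Submodule ℝ H) : Prop :=
  ∀ v ∈ Z, v ≠ 0 → inner ℝ (A v) v < 0

/-- The Morse index of the quadratic form of `A` on the subspace `E`. -/
def formIndex (A : H →L[ℝ] H) (E : Submodule ℝ H) : ℕ∞ :=
  ⨆ Z : {Z : Submodule ℝ H // Z ≤ E ∧ NegOn A Z}, Cardinal.toENat (Module.rank ℝ Z.1)

theorem Submodule.exists_le_finrank_eq {Z : Submodule ℝ H} {k : ℕ}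
    (hk : (k : Cardinal) ≤ Module.rank ℝ Z) :
    ∃ W : Submodule ℝ H, W ≤ Z ∧ FiniteDimensional ℝ W ∧ Module.finrank ℝ W = k := by
  obtain ⟨f, hf⟩ := exists_linearIndependent_of_le_rank hk
  let W := Submodule.span ℝ (Set.range fun i => (f i : H))
  refine ⟨W, ?_, FiniteDimensional.span_of_finite ℝ (Set.finite_range _), ?_⟩
  · exact Submodule.span_le.2 (by rintro _ ⟨i, rfl⟩; exact (f i).2)
  · have : LinearIndependent ℝ fun i => (f i : H) := hf.map' Z.subtype (by simp)
    simpa using finrank_span_eq_card this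

/-- A natural number below a supremum in `ℕ∞` is reached by some admissible subspace, which can be
cut down to that exact dimension. Comparing indices through this criterion treats finite and
infinite ones alike. -/
theorem le_formIndex_iff {A : H →L[ℝ] H} {E : Submodule ℝ H} {k : ℕ} :
    (k : ℕ∞) ≤ formIndex A E ↔
      ∃ Z : Submodule ℝ H, Z ≤ E ∧ NegOn A Z ∧ FiniteDimensional ℝ Z ∧ Module.finrank ℝ Z = k := by
  constructor
  · intro h
    obtain ⟨Z, hZE, hZ, hk⟩ : ∃ Z : Submodule ℝ H, Z ≤ E ∧ NegOn A Z ∧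
        (k : ℕ∞) ≤ Cardinal.toENat (Module.rank ℝ Z) := by
      rcases Nat.eq_zero_or_pos k with rfl | hk
      · exact ⟨⊥, bot_le, fun v hv h0 => absurd ((Submodule.mem_bot ℝ).1 hv) h0, by simp⟩
      · by_contra! hcon
        have : formIndex A E ≤ ((k - 1 : ℕ) : ℕ∞) := by
          refine iSup_le fun Z => ?_
          have := hcon Z.1 Z.2.1 Z.2.2
          have e : (k : ℕ∞) = ((k - 1 : ℕ) : ℕ∞) + 1 := by
            norm_cast; omega
          rw [e] at this
          exact (ENat.lt_add_one_iff (by simp)).1 this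
        have h2 := h.trans this
        norm_cast at h2
        omega
    have hk' : (k : Cardinal) ≤ Module.rank ℝ Z := by
      simpa using hk
    obtain ⟨W, hWZ, hW, hWk⟩ := Submodule.exists_le_finrank_eq hk'
    exact ⟨W, hWZ.trans hZE, fun v hv => hZ v (hWZ hv), hW, hWk⟩
  · rintro ⟨Z, hZE, hZ, _, rfl⟩
    refine le_trans (le_of_eq ?_) (le_iSup _ (⟨Z, hZE, hZ⟩ : {Z // Z ≤ E ∧ NegOn A Z}))
    rw [← Module.finrank_eq_rank]; simp

theorem NegOn.mono {A : H →L[ℝ] H} {Z Z' : Submodule ℝ H} (h : NegOn A Z) (hZ : Z' ≤ Z) :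
    NegOn A Z' := fun v hv => h v (hZ hv)

theorem NegOn.sup_span {A : H →L[ℝ] H} (hA : ∀ v w, inner ℝ (A v) w = inner ℝ v (A w))
    {Z : Submodule ℝ H} (hZ : NegOn A Z) {v : H} (hv : inner ℝ (A v) v < 0)
    (hvZ : ∀ z ∈ Z, inner ℝ (A v) z = 0) : NegOn A (Z ⊔ ℝ ∙ v) := by
  intro x hx hx0
  obtain ⟨z, hz, y, hy, rfl⟩ := Submodule.mem_sup.1 hx
  obtain ⟨t, rfl⟩ := Submodule.mem_span_singleton.1 hy
  have h1 : inner ℝ (A z) v = 0 := by rw [hA, real_inner_comm]; exact hvZ z hz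
  have e : inner ℝ (A (z + t • v)) (z + t • v) =
      inner ℝ (A z) z + t ^ 2 * inner ℝ (A v) v := by
    simp only [map_add, map_smul, inner_add_left, inner_add_right, real_inner_smul_left,
      real_inner_smul_right, h1, hvZ z hz]
    ring
  rw [e]
  by_cases ht : t = 0
  · subst ht
    have : z ≠ 0 := by simpa using hx0
    simpa using hZ z hz this
  · have h2 : inner ℝ (A z) z ≤ 0 := by
      by_cases h0 : z = 0
      · simp [h0]
      · exact (hZ z hz h0).le
    have : 0 < t ^ 2 := by positivity
    nlinarith

theorem finrank_sup_span {Z : Submodule ℝ H} [FiniteDimensional ℝ Z] {v : H} (hv : v ∉ Z) :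
    FiniteDimensional ℝ (Z ⊔ ℝ ∙ v : Submodule ℝ H) ∧
      Module.finrank ℝ (Z ⊔ ℝ ∙ v : Submodule ℝ H) = Module.finrank ℝ Z + 1 := by
  have hv0 : v ≠ 0 := fun h => hv (h ▸ Z.zero_mem)
  refine ⟨inferInstance, ?_⟩
  have hd : Z ⊓ ℝ ∙ v = ⊥ := by
    rw [Submodule.eq_bot_iff]
    rintro x ⟨hx, hx'⟩
    obtain ⟨t, rfl⟩ := Submodule.mem_span_singleton.1 hx'
    by_contra h
    have ht : t ≠ 0 := fun h' => h (by simp [h'])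
    exact hv ((Z.smul_mem_iff ht).1 hx)
  have := Submodule.finrank_sup_add_finrank_inf_eq Z (ℝ ∙ v)
  rw [hd, finrank_bot, finrank_span_singleton hv0] at this
  omega

/-- Otherwise `v` would enlarge `Z` to a negative subspace of dimension `k + 1`, by
`NegOn.sup_span`. -/
theorem NegOn.inner_self_nonneg_of_maximal {A : H →L[ℝ] H}
    (hA : ∀ v w, inner ℝ (A v) w = inner ℝ v (A w)) {k : ℕ} {E : Submodule ℝ H}
    (hk : formIndex A E ≤ k) {Z : Submodule ℝ H} (hZE : Z ≤ E) [FiniteDimensional ℝ Z]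
    (hZ : NegOn A Z)
    (hZk : Module.finrank ℝ Z = k) {v : H} (hvE : v ∈ E) (hv : ∀ z ∈ Z, inner ℝ (A v) z = 0) :
    0 ≤ inner ℝ (A v) v := by
  by_contra! hlt
  have hvZ : v ∉ Z := fun h => by rw [hv v h] at hlt; exact lt_irrefl _ hlt
  obtain ⟨h1, h2⟩ := finrank_sup_span hvZ
  have h3 : ((k + 1 : ℕ) : ℕ∞) ≤ formIndex A E :=
    le_formIndex_iff.2 ⟨Z ⊔ ℝ ∙ v, sup_le hZE (by simpa using hvE), hZ.sup_span hA hlt hv, h1,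
      by rw [h2, hZk]⟩
  have := h3.trans hk
  norm_cast at this
  omega

/-- A nonzero vector of `Z` orthogonal to `Y` would have both signs, so the orthogonal projection to
`Y` is injective on `Z`. This is the upper bound for indices. -/
theorem finrank_le_of_negOn_of_nonneg {A : H →L[ℝ] H} {Z Y : Submodule ℝ H}
    [FiniteDimensional ℝ Y] (hZ : NegOn A Z) [FiniteDimensional ℝ Z]
    (hY : ∀ v, (∀ y ∈ Y, inner ℝ y v = 0) → 0 ≤ inner ℝ (A v) v) :
    Module.finrank ℝ Z ≤ Module.finrank ℝ Y := by
  let P : Z →ₗ[ℝ] Y := (Y.orthogonalProjectionOnto : H →ₗ[ℝ] Y) ∘ₗ Z.subtype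
  have hP : Function.Injective P := by
    rw [← LinearMap.ker_eq_bot, Submodule.eq_bot_iff]
    rintro ⟨v, hv⟩ h
    have h1 : Y.orthogonalProjectionOnto v = 0 := h
    have h2 : v ∈ Yᗮ := by
      rwa [Submodule.orthogonalProjectionOnto_eq_zero_iff] at h1
    by_contra h0
    have h0' : v ≠ 0 := fun h => h0 (by simp [h])
    exact absurd (hY v (fun y hy => h2 y hy)) (not_le.2 (hZ v hv h0'))
  exact LinearMap.finrank_le_finrank_of_injective hP

/-- Restricting to the kernel of `⟪g, ·⟫`, `A z = g`, `⟪g, z⟫ < 0`, lowers the index by one. -/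
theorem formIndex_top_of_neg {A : H →L[ℝ] H} (hA : ∀ v w, inner ℝ (A v) w = inner ℝ v (A w))
    {z : H} {E : Submodule ℝ H} (hE : ∀ v, v ∈ E ↔ inner ℝ (A z) v = 0)
    (hz : inner ℝ (A z) z < 0) : formIndex A ⊤ = formIndex A E + 1 := by
  refine ENat.eq_of_forall_natCast_le_iff fun k => ?_
  rcases k with _ | k
  · simp
  have e : ((k + 1 : ℕ) : ℕ∞) ≤ formIndex A E + 1 ↔ (k : ℕ∞) ≤ formIndex A E := by
    push_cast
    exact ENat.add_le_add_iff_right (by simp)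
  rw [e, le_formIndex_iff, le_formIndex_iff]
  constructor
  · rintro ⟨Z, -, hZ, hfd, hk⟩
    -- `E` cuts `Z` in the kernel of one functional, so at most one dimension is lost. Conversely
    -- `z` is negative and `A`-orthogonal to `E`, so it adds a dimension to any negative subspace of
    -- `E`.
    let φ : Z →ₗ[ℝ] ℝ := (innerSL ℝ (A z) : H →ₗ[ℝ] ℝ) ∘ₗ Z.subtype
    have h1 := LinearMap.finrank_range_add_finrank_ker φ
    have h2 : Module.finrank ℝ (LinearMap.range φ) ≤ 1 :=
      (Submodule.finrank_le _).trans (by simp)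
    have h3 : k ≤ Module.finrank ℝ (LinearMap.ker φ) := by omega
    have h4 : (Z ⊓ E) = (LinearMap.ker φ).map Z.subtype := by
      ext v
      simp only [Submodule.mem_inf, hE, Submodule.mem_map, LinearMap.mem_ker]
      constructor
      · rintro ⟨h, h'⟩
        exact ⟨⟨v, h⟩, h', rfl⟩
      · rintro ⟨w, h, rfl⟩
        exact ⟨w.2, h⟩
    have h5 : Module.finrank ℝ (Z ⊓ E : Submodule ℝ H) = Module.finrank ℝ (LinearMap.ker φ) := by
      rw [h4]
      exact (Submodule.equivMapOfInjective Z.subtype Z.subtype_injective _).finrank_eq.symm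
    obtain ⟨W, hWZ, hW, hWk⟩ := Submodule.exists_le_finrank_eq (Z := Z ⊓ E) (k := k)
      (by rw [← Module.finrank_eq_rank]; exact_mod_cast h5 ▸ h3)
    exact ⟨W, hWZ.trans inf_le_right, hZ.mono (hWZ.trans inf_le_left), hW, hWk⟩
  · rintro ⟨Z, hZE, hZ, hfd, hk⟩
    have hzZ : z ∉ Z := fun h => by
      have := (hE z).1 (hZE h)
      rw [this] at hz; exact lt_irrefl _ hz
    obtain ⟨h1, h2⟩ := finrank_sup_span hzZ
    exact ⟨Z ⊔ ℝ ∙ z, le_top, hZ.sup_span hA hz fun y hy => (hE y).1 (hZE hy), h1, by rw [h2, hk]⟩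

/-- The `A`-orthogonal projection onto `E` along `z` subtracts `⟪A z, v⟫² / ⟪A z, z⟫ ≥ 0` from the
form. It carries a negative subspace injectively to a negative subspace of `E`, so the constraint
costs nothing. -/
theorem formIndex_top_of_pos {A : H →L[ℝ] H} (hA : ∀ v w, inner ℝ (A v) w = inner ℝ v (A w))
    {z : H} {E : Submodule ℝ H} (hE : ∀ v, v ∈ E ↔ inner ℝ (A z) v = 0)
    (hz : 0 < inner ℝ (A z) z) : formIndex A ⊤ = formIndex A E := by
  refine ENat.eq_of_forall_natCast_le_iff fun k => ?_
  rw [le_formIndex_iff, le_formIndex_iff]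
  constructor
  · rintro ⟨Z, -, hZ, hfd, hk⟩
    set σ := inner ℝ (A z) z with hσ
    let π : H →ₗ[ℝ] H := LinearMap.id - (LinearMap.toSpanSingleton ℝ H z) ∘ₗ
      (σ⁻¹ • (innerSL ℝ (A z) : H →ₗ[ℝ] ℝ))
    have hπ : ∀ v, π v = v - (σ⁻¹ * inner ℝ (A z) v) • z := fun v => by
      simp [π]
    have hE' : ∀ v, π v ∈ E := fun v => by
      rw [hE, hπ, inner_sub_right, real_inner_smul_right, ← hσ]
      field_simp
      ring
    have hq : ∀ v, inner ℝ (A (π v)) (π v) ≤ inner ℝ (A v) v := fun v => by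
      have h1 : inner ℝ (A v) z = inner ℝ (A z) v := by rw [hA, real_inner_comm]
      have : inner ℝ (A (π v)) (π v) = inner ℝ (A v) v - σ⁻¹ * inner ℝ (A z) v ^ 2 := by
        rw [hπ]
        simp only [map_sub, map_smul, inner_sub_left, inner_sub_right, real_inner_smul_left,
          real_inner_smul_right, h1, ← hσ]
        field_simp
        ring
      rw [this]
      have : 0 ≤ σ⁻¹ * inner ℝ (A z) v ^ 2 := by positivity
      linarith
    have hinj : Function.Injective (π ∘ₗ Z.subtype) := by
      rw [← LinearMap.ker_eq_bot, Submodule.eq_bot_iff]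
      rintro ⟨v, hv⟩ h
      by_contra h0
      have h0' : v ≠ 0 := fun h => h0 (by simp [h])
      have h1 := hq v
      have h2 : π v = 0 := h
      rw [h2, map_zero, inner_zero_left] at h1
      exact absurd (hZ v hv h0') (not_lt.2 h1)
    refine ⟨Z.map π, ?_, ?_, inferInstance, ?_⟩
    · rintro _ ⟨v, -, rfl⟩
      exact hE' v
    · rintro _ ⟨v, hv, rfl⟩ h0
      have : v ≠ 0 := fun h => h0 (by simp [h])
      exact (hq v).trans_lt (hZ v hv this)
    · rw [← hk, ← LinearMap.finrank_range_of_inj hinj, LinearMap.range_comp, Submodule.range_subtype]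
  · rintro ⟨Z, -, h⟩
    exact ⟨Z, le_top, h⟩

end AbstractForms

/-! ### Bounded-below and coercive symmetric operators and their perturbations. -/

noncomputable section AbstractOperators

variable {H : Type*} [NormedAddCommGroup H] [InnerProductSpace ℝ H]

theorem abs_inner_apply_le (A : H →L[ℝ] H) (v w : H) : |inner ℝ (A v) w| ≤ ‖A‖ * ‖v‖ * ‖w‖ :=
  (abs_real_inner_le_norm _ _).trans (by gcongr; exact A.le_opNorm v)

/-- A symmetric operator which is bounded below is invertible. -/
theorem exists_continuousLinearEquiv_of_bounded_below [CompleteSpace H] {A : H →L[ℝ] H}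
    (hA : ∀ v w, inner ℝ (A v) w = inner ℝ v (A w)) {c : ℝ} (hc : 0 < c)
    (hb : ∀ v, c * ‖v‖ ≤ ‖A v‖) : ∃ E : H ≃L[ℝ] H, (E : H →L[ℝ] H) = A := by
  have hanti : AntilipschitzWith (Real.toNNReal c⁻¹) A := by
    refine A.antilipschitz_of_bound fun v => ?_
    rw [Real.coe_toNNReal _ (by positivity), inv_mul_eq_div, le_div_iff₀ hc, mul_comm]
    exact hb v
  have hker : A.ker = ⊥ := LinearMap.ker_eq_bot.2 hanti.injective
  have hclosed : IsClosed (A.range : Set H) := hanti.isClosed_range A.uniformContinuous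
  have hrange : A.range = ⊤ := by
    have : CompleteSpace A.range := hclosed.completeSpace_coe
    rw [← A.range.orthogonal_orthogonal, Submodule.eq_top_iff']
    -- By symmetry a vector orthogonal to the range lies in the kernel, which is trivial.
    intro v w hw
    have h0 : A w = 0 := by
      rw [← @inner_self_eq_zero ℝ, hA]
      exact (real_inner_comm _ _).trans (hw (A (A w)) ⟨A w, rfl⟩)
    have : w = 0 := hanti.injective (by rw [h0, map_zero])
    simp [this]
  exact ⟨ContinuousLinearEquiv.ofBijective A hker hrange, by ext; rfl⟩

/-- Test nonnegativity at `v - ‖A‖⁻¹ • A v`: the term quadratic in `A v` is at most half of the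
linear gain. This avoids the square root of `A`. -/
theorem norm_sq_le_of_inner_nonneg {A : H →L[ℝ] H}
    (hA : ∀ v w, inner ℝ (A v) w = inner ℝ v (A w)) (hpos : ∀ v, 0 ≤ inner ℝ (A v) v) (v : H) :
    ‖A v‖ ^ 2 ≤ ‖A‖ * inner ℝ (A v) v := by
  rcases eq_or_ne ‖A‖ 0 with h0 | h0
  · have : A = 0 := norm_eq_zero.1 h0
    simp [this]
  have hn : 0 < ‖A‖ := lt_of_le_of_ne (norm_nonneg _) (Ne.symm h0)
  have h1 : inner ℝ (A (A v)) (A v) ≤ ‖A‖ * ‖A v‖ ^ 2 := by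
    have := (le_abs_self _).trans (abs_inner_apply_le A (A v) (A v))
    nlinarith
  have h2 := hpos (v - ‖A‖⁻¹ • A v)
  have e : inner ℝ (A (v - ‖A‖⁻¹ • A v)) (v - ‖A‖⁻¹ • A v) =
      inner ℝ (A v) v - 2 * ‖A‖⁻¹ * ‖A v‖ ^ 2 + ‖A‖⁻¹ ^ 2 * inner ℝ (A (A v)) (A v) := by
    have h3 : inner ℝ (A (A v)) v = ‖A v‖ ^ 2 := by
      rw [hA, real_inner_self_eq_norm_sq]
    simp only [map_sub, map_smul, inner_sub_left, inner_sub_right, real_inner_smul_left,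
      real_inner_smul_right, h3, real_inner_self_eq_norm_sq]
    ring
  rw [e] at h2
  have h3 : ‖A‖⁻¹ ^ 2 * inner ℝ (A (A v)) (A v) ≤ ‖A‖⁻¹ * ‖A v‖ ^ 2 := by
    calc _ ≤ ‖A‖⁻¹ ^ 2 * (‖A‖ * ‖A v‖ ^ 2) := by gcongr
      _ = _ := by field_simp
  have h4 : ‖A‖⁻¹ * ‖A v‖ ^ 2 ≤ inner ℝ (A v) v := by linarith
  rwa [inv_mul_le_iff₀ hn] at h4

theorem coercive_of_nonneg_of_bounded_below {A : H →L[ℝ] H}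
    (hA : ∀ v w, inner ℝ (A v) w = inner ℝ v (A w)) (hpos : ∀ v, 0 ≤ inner ℝ (A v) v)
    {c : ℝ} (hc : 0 < c) (hb : ∀ v, c * ‖v‖ ≤ ‖A v‖) {M : ℝ} (hM : ‖A‖ ≤ M) (hM0 : 0 < M) (v : H) :
    c ^ 2 / M * ‖v‖ ^ 2 ≤ inner ℝ (A v) v := by
  have h1 := norm_sq_le_of_inner_nonneg hA hpos v
  have h2 : c ^ 2 * ‖v‖ ^ 2 ≤ ‖A v‖ ^ 2 := by
    rw [← mul_pow]; gcongr; exact hb v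
  have h3 : ‖A‖ * inner ℝ (A v) v ≤ M * inner ℝ (A v) v := by
    gcongr; exact hpos v
  rw [div_mul_eq_mul_div, div_le_iff₀ hM0]
  linarith

theorem bounded_below_of_coercive {A : H →L[ℝ] H} {c : ℝ}
    (h : ∀ v, c * ‖v‖ ^ 2 ≤ inner ℝ (A v) v) (v : H) : c * ‖v‖ ≤ ‖A v‖ := by
  rcases eq_or_ne v 0 with rfl | hv
  · simp
  have hv : 0 < ‖v‖ := norm_pos_iff.2 hv
  have := (h v).trans (real_inner_le_norm _ _)
  nlinarith

/-- A symmetric operator which is bounded below becomes coercive after adding a finite-rank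
operator whose rank is its index. -/
theorem exists_finiteRank_coercive [CompleteSpace H] {A : H →L[ℝ] H}
    (hA : ∀ v w, inner ℝ (A v) w = inner ℝ v (A w)) {c : ℝ} (hc : 0 < c)
    (hb : ∀ v, c * ‖v‖ ≤ ‖A v‖) {Z : Submodule ℝ H} [FiniteDimensional ℝ Z] (hZ : NegOn A Z)
    (hmax : ∀ v, (∀ z ∈ Z, inner ℝ (A v) z = 0) → 0 ≤ inner ℝ (A v) v) :
    ∃ (S : H →L[ℝ] H) (Y : Submodule ℝ H), (∀ v w, inner ℝ (S v) w = inner ℝ v (S w)) ∧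
      FiniteDimensional ℝ Y ∧ Module.finrank ℝ Y ≤ Module.finrank ℝ Z ∧ (∀ v, S v ∈ Y) ∧
      ∃ c' : ℝ, 0 < c' ∧ ∀ v, c' * ‖v‖ ^ 2 ≤ inner ℝ ((A + S) v) v := by
  -- The compression of `A` to `Z` is injective because the form is definite there. Its inverse
  -- defines the `A`-orthogonal projection `P` onto `Z`.
  let AZ : Z →ₗ[ℝ] Z := (Z.orthogonalProjectionOnto : H →ₗ[ℝ] Z) ∘ₗ (A : H →ₗ[ℝ] H) ∘ₗ Z.subtype
  have hAZ : ∀ x y : Z, inner ℝ (AZ x : H) (y : H) = inner ℝ (A x) (y : H) := fun x y => by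
    simp only [AZ, LinearMap.comp_apply, ContinuousLinearMap.coe_coe, Submodule.subtype_apply]
    rw [← Submodule.coe_inner, Submodule.inner_orthogonalProjectionOnto_eq_of_mem_right]
  have hinj : Function.Injective AZ := by
    rw [← LinearMap.ker_eq_bot, Submodule.eq_bot_iff]
    intro x hx
    by_contra h0
    have h1 := hZ x x.2 (by simpa using h0)
    rw [← hAZ, LinearMap.mem_ker.1 hx] at h1
    simp at h1
  let EZ : Z ≃ₗ[ℝ] Z := LinearEquiv.ofInjectiveEndo AZ hinj
  let P : H →L[ℝ] H := Z.subtypeL ∘L (LinearMap.toContinuousLinearMap EZ.symm.toLinearMap) ∘L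
    Z.orthogonalProjectionOnto ∘L A
  have hPZ : ∀ v, P v ∈ Z := fun v => by simp [P]
  have hP : ∀ v, ∀ z ∈ Z, inner ℝ (A (P v)) z = inner ℝ (A v) z := by
    intro v z hz
    have h1 := hAZ (EZ.symm (Z.orthogonalProjectionOnto (A v))) ⟨z, hz⟩
    have h2 : AZ (EZ.symm (Z.orthogonalProjectionOnto (A v))) =
        Z.orthogonalProjectionOnto (A v) := EZ.apply_symm_apply _
    rw [h2] at h1
    have h3 : inner ℝ ((Z.orthogonalProjectionOnto (A v) : Z) : H) z = inner ℝ (A v) z := by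
      have := Submodule.inner_orthogonalProjectionOnto_eq_of_mem_right (K := Z) ⟨z, hz⟩ (A v)
      rw [Submodule.coe_inner] at this
      exact this
    rw [← h3]
    exact h1.symm
  have hPP : ∀ v w, inner ℝ (A (P v)) w = inner ℝ (A (P v)) (P w) := fun v w => by
    rw [hA, real_inner_comm, ← hP w _ (hPZ v), real_inner_comm, ← hA]
  have hPsym : ∀ v w, inner ℝ (A (P v)) w = inner ℝ v (A (P w)) := fun v w => by
    rw [hPP, hA, real_inner_comm, ← hPP, real_inner_comm]
  have hPid : ∀ v, P (P v) = P v := fun v => by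
    by_contra h
    have h0 : P (P v) - P v ≠ 0 := sub_ne_zero.2 h
    have hm : P (P v) - P v ∈ Z := Z.sub_mem (hPZ _) (hPZ _)
    have h1 := hZ _ hm h0
    have h2 : inner ℝ (A (P (P v) - P v)) (P (P v) - P v) = 0 := by
      rw [map_sub, inner_sub_left, hP _ _ hm]; simp
    linarith
  -- With this choice `A + S = A (1 - 2 P)`: the form changes sign on `Z` and is unchanged on the
  -- `A`-orthogonal complement, where `hmax` makes it nonnegative. Since `1 - 2 P` is an involution,
  -- the lower bound for `A` survives up to a constant.
  let S : H →L[ℝ] H := (-2 : ℝ) • (A ∘L P)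
  have hS : ∀ v, S v = (-2 : ℝ) • A (P v) := fun v => rfl
  have hSsym : ∀ v w, inner ℝ (S v) w = inner ℝ v (S w) := fun v w => by
    simp only [hS, real_inner_smul_left, real_inner_smul_right, hPsym]
  have hASsym : ∀ v w, inner ℝ ((A + S) v) w = inner ℝ v ((A + S) w) := fun v w => by
    simp only [add_apply, inner_add_left, inner_add_right, hA, hSsym]
  have hAS : ∀ v, (A + S) v = A (v - (2 : ℝ) • P v) := fun v => by
    rw [add_apply, hS, map_sub, map_smul, neg_smul, sub_eq_add_neg]
  have hpos : ∀ v, 0 ≤ inner ℝ ((A + S) v) v := fun v => by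
    have h1 : 0 ≤ inner ℝ (A (v - P v)) (v - P v) :=
      hmax _ fun z hz => by rw [map_sub, inner_sub_left, hP v z hz, sub_self]
    have h2 : inner ℝ (A (P v)) (P v) ≤ 0 := by
      by_cases h0 : P v = 0
      · simp [h0]
      · exact (hZ _ (hPZ v) h0).le
    have h3 : inner ℝ (A v) (P v) = inner ℝ (A (P v)) (P v) := (hP v _ (hPZ v)).symm
    have h4 : inner ℝ (A (P v)) v = inner ℝ (A (P v)) (P v) := hPP v v
    have e : inner ℝ ((A + S) v) v =
        inner ℝ (A (v - P v)) (v - P v) - inner ℝ (A (P v)) (P v) := by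
      rw [hAS]
      simp only [map_sub, map_smul, inner_sub_left, inner_sub_right, real_inner_smul_left, h3, h4]
      ring
    rw [e]; linarith
  have hinv : ∀ v, v = (v - (2 : ℝ) • P v) - (2 : ℝ) • P (v - (2 : ℝ) • P v) := fun v => by
    simp only [map_sub, map_smul, hPid]
    module
  have hbelow : ∀ v, c / (1 + 2 * ‖P‖) * ‖v‖ ≤ ‖(A + S) v‖ := fun v => by
    rw [hAS]
    refine le_trans ?_ (hb _)
    set w := v - (2 : ℝ) • P v
    have h1 : ‖v‖ ≤ (1 + 2 * ‖P‖) * ‖w‖ := by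
      rw [hinv v]
      refine (norm_sub_le _ _).trans ?_
      rw [norm_smul, Real.norm_ofNat]
      have := P.le_opNorm w
      linarith
    have : 0 < 1 + 2 * ‖P‖ := by positivity
    rw [div_mul_eq_mul_div, div_le_iff₀ this]
    nlinarith
  refine ⟨S, Z.map (A : H →ₗ[ℝ] H), hSsym, inferInstance, Submodule.finrank_map_le _ _,
    fun v => ?_, (c / (1 + 2 * ‖P‖)) ^ 2 / (‖A + S‖ + 1), by positivity, fun v => ?_⟩
  · exact Submodule.smul_mem _ _ (Submodule.mem_map_of_mem (hPZ v))
  · exact coercive_of_nonneg_of_bounded_below hASsym hpos (by positivity) hbelow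
      (by linarith) (by positivity) v

/-- If `B` is coercive and the segment from `B` to `B - D` consists of operators which are
uniformly bounded below, then `B - D` is coercive. -/
theorem coercive_sub_of_segment {B D : H →L[ℝ] H}
    (hB : ∀ v w, inner ℝ (B v) w = inner ℝ v (B w)) (hD : ∀ v w, inner ℝ (D v) w = inner ℝ v (D w))
    (hBpos : ∀ v, 0 ≤ inner ℝ (B v) v) {c : ℝ} (hc : 0 < c)
    (hb : ∀ t ∈ Set.Icc (0 : ℝ) 1, ∀ v, c * ‖v‖ ≤ ‖(B - t • D) v‖) {M : ℝ} (hM0 : 0 < M)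
    (hM : ‖B‖ + ‖D‖ ≤ M) (v : H) : c ^ 2 / M * ‖v‖ ^ 2 ≤ inner ℝ ((B - D) v) v := by
  have hsym : ∀ t : ℝ, ∀ v w, inner ℝ ((B - t • D) v) w = inner ℝ v ((B - t • D) w) := by
    intro t v w
    simp only [sub_apply, smul_apply, inner_sub_left,
      inner_sub_right, real_inner_smul_left, real_inner_smul_right, hB, hD]
  have hnorm : ∀ t ∈ Set.Icc (0 : ℝ) 1, ‖B - t • D‖ ≤ M := fun t ht => by
    refine (norm_sub_le _ _).trans (le_trans ?_ hM)
    rw [norm_smul, Real.norm_of_nonneg ht.1]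
    have := mul_le_of_le_one_left (norm_nonneg D) ht.2
    linarith
  -- Nonnegativity at `s` improves to coercivity with a constant independent of `s`, so it survives
  -- a parameter step of fixed length; finitely many steps lead from `0` to `1`.
  have hstep : ∀ s ∈ Set.Icc (0 : ℝ) 1, (∀ v, 0 ≤ inner ℝ ((B - s • D) v) v) →
      ∀ t, |t - s| * ‖D‖ ≤ c ^ 2 / M → ∀ v, 0 ≤ inner ℝ ((B - t • D) v) v := by
    intro s hs hpos t ht v
    have h1 := coercive_of_nonneg_of_bounded_below (hsym s) hpos hc (hb s hs) (hnorm s hs) hM0 v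
    have e : inner ℝ ((B - t • D) v) v =
        inner ℝ ((B - s • D) v) v - (t - s) * inner ℝ (D v) v := by
      simp only [sub_apply, smul_apply, inner_sub_left,
        real_inner_smul_left]
      ring
    have h2 : (t - s) * inner ℝ (D v) v ≤ |t - s| * ‖D‖ * ‖v‖ ^ 2 := by
      refine (le_abs_self _).trans ?_
      rw [abs_mul, mul_assoc]
      gcongr
      refine (abs_inner_apply_le D v v).trans (le_of_eq (by ring))
    have h3 : |t - s| * ‖D‖ * ‖v‖ ^ 2 ≤ c ^ 2 / M * ‖v‖ ^ 2 := by gcongr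
    linarith
  obtain ⟨K, hK⟩ := exists_nat_gt (‖D‖ / (c ^ 2 / M))
  have hKpos : (0 : ℝ) < K := lt_of_le_of_lt (by positivity) hK
  have hall : ∀ j : ℕ, j ≤ K → ∀ v, 0 ≤ inner ℝ ((B - ((j : ℝ) / K) • D) v) v := by
    intro j
    induction j with
    | zero => intro _ v; simpa using hBpos v
    | succ j ih =>
      intro hj
      have hj' : (j : ℝ) ≤ K := by exact_mod_cast (Nat.le_succ j).trans hj
      refine hstep ((j : ℝ) / K) ⟨by positivity, (div_le_one hKpos).2 hj'⟩
        (ih ((Nat.le_succ j).trans hj)) _ ?_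
      have : ((j + 1 : ℕ) : ℝ) / K - (j : ℝ) / K = 1 / K := by push_cast; ring
      rw [this, abs_of_pos (by positivity), one_div_mul_eq_div, div_le_iff₀ hKpos, mul_comm]
      exact ((div_lt_iff₀ (by positivity)).1 hK).le
  have hone : ∀ v, 0 ≤ inner ℝ ((B - (1 : ℝ) • D) v) v := by
    have := hall K le_rfl
    rwa [div_self hKpos.ne'] at this
  simpa using coercive_of_nonneg_of_bounded_below (hsym 1) hone hc (hb 1 ⟨by simp, le_rfl⟩)
    (hnorm 1 ⟨by simp, le_rfl⟩) hM0 v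

/-- Almost decoupled perturbations `C i` of an invertible operator `B`: if every `B - t C i` is
bounded below and the operators `C i B⁻¹ C j` are small, then `B - t ∑ C i` is bounded below. -/
theorem bounded_below_sub_sum {ι : Type*} [Fintype ι] {B Binv : H →L[ℝ] H}
    (hBinv : ∀ v, Binv (B v) = v) (hBinv' : ∀ v, B (Binv v) = v)
    {C : ι → H →L[ℝ] H} {c M δ : ℝ} (hc : 0 < c)
    {t : ℝ} (ht : t ∈ Set.Icc (0 : ℝ) 1)
    (hb : ∀ i v, c * ‖v‖ ≤ ‖(B - t • C i) v‖)
    (hM : ∀ i, ‖C i‖ ≤ M) (hCC : ∀ i j, i ≠ j → ‖C i ∘L Binv ∘L C j‖ ≤ δ)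
    (hδ : Fintype.card ι * (Fintype.card ι * δ) / c ≤ 1 / 2) (hM0 : 0 ≤ M) (hδ0 : 0 ≤ δ) (v : H) :
    ‖v‖ ≤ 2 * (‖Binv‖ + Fintype.card ι * (M * ‖Binv‖) / c) * ‖(B - t • ∑ i, C i) v‖ := by
  classical
  set r := (B - t • ∑ i, C i) v with hr
  set β := ‖Binv‖
  set n : ℝ := (Fintype.card ι : ℝ) with hn
  let y : ι → H := fun i => Binv (C i v)
  have hv : v = t • ∑ i, y i + Binv r := by
    simp only [hr, y, sub_apply, smul_apply,
      sum_apply, map_sub, map_smul, map_sum, hBinv]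
    abel
  -- Substituting the expansion `hv` of `v` into `C i v`, the diagonal term moves to the left. What
  -- remains is the residual and the small products `C i B⁻¹ C j` with `j ≠ i`.
  have hy : ∀ i, (B - t • C i) (y i) =
      C i (Binv r) + t • ∑ j ∈ Finset.univ.erase i, C i (Binv (C j v)) := by
    intro i
    have h1 : C i v = t • ∑ j, C i (y j) + C i (Binv r) := by
      conv_lhs => rw [hv]
      simp only [map_add, map_smul, map_sum]
    have h2 : ∑ j, C i (y j) = C i (y i) + ∑ j ∈ Finset.univ.erase i, C i (y j) :=
      (Finset.add_sum_erase _ _ (Finset.mem_univ i)).symm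
    simp only [sub_apply, smul_apply]
    have h3 : B (y i) = C i v := hBinv' _
    rw [h3, h1, h2, smul_add]
    abel
  have hyb : ∀ i, c * ‖y i‖ ≤ M * β * ‖r‖ + n * δ * ‖v‖ := by
    intro i
    refine (hb i (y i)).trans ?_
    rw [hy i]
    refine (norm_add_le _ _).trans (add_le_add ?_ ?_)
    · refine ((C i).le_opNorm _).trans ?_
      rw [mul_assoc]
      exact mul_le_mul (hM i) (Binv.le_opNorm r) (norm_nonneg _) hM0
    · rw [norm_smul, Real.norm_of_nonneg ht.1]
      refine (mul_le_of_le_one_left (norm_nonneg _) ht.2).trans ?_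
      refine (norm_sum_le _ _).trans ?_
      refine (Finset.sum_le_sum (g := fun _ => δ * ‖v‖) fun j hj => ?_).trans ?_
      · have hij : i ≠ j := fun h => by simp [h] at hj
        exact ((C i ∘L Binv ∘L C j).le_opNorm v).trans
          (mul_le_mul_of_nonneg_right (hCC i j hij) (norm_nonneg _))
      · rw [Finset.sum_const, nsmul_eq_mul, mul_assoc]
        have : ((Finset.univ.erase i).card : ℝ) ≤ n := by
          rw [hn]; exact_mod_cast Finset.card_le_univ _
        gcongr
  have hyb' : ∀ i, ‖y i‖ ≤ (M * β * ‖r‖ + n * δ * ‖v‖) / c := fun i => by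
    rw [le_div_iff₀ hc, mul_comm]; exact hyb i
  have h1 : ‖v‖ ≤ n * ((M * β * ‖r‖ + n * δ * ‖v‖) / c) + β * ‖r‖ := by
    calc ‖v‖ = ‖t • ∑ i, y i + Binv r‖ := by rw [← hv]
      _ ≤ ‖t • ∑ i, y i‖ + ‖Binv r‖ := norm_add_le _ _
      _ ≤ _ := by
        refine add_le_add ?_ (Binv.le_opNorm r)
        rw [norm_smul, Real.norm_of_nonneg ht.1]
        refine (mul_le_of_le_one_left (norm_nonneg _) ht.2).trans ?_
        refine (norm_sum_le _ _).trans ?_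
        refine (Finset.sum_le_sum fun i _ => hyb' i).trans ?_
        rw [Finset.sum_const, nsmul_eq_mul, hn, Finset.card_univ]
  have h2 : n * ((M * β * ‖r‖ + n * δ * ‖v‖) / c) =
      n * (M * β) / c * ‖r‖ + n * (n * δ) / c * ‖v‖ := by ring
  have h3 : n * (n * δ) / c * ‖v‖ ≤ 1 / 2 * ‖v‖ := by gcongr
  rw [h2] at h1
  linarith

/-- Negative definiteness of the limit of Gram matrices. -/
theorem eventually_neg_of_tendsto {ι α : Type*} [Fintype ι] {l : Filter α}
    {G : α → ι → ι → ℝ} {G₀ : ι → ι → ℝ} (hG : ∀ p p', Tendsto (fun a => G a p p') l (𝓝 (G₀ p p')))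
    (hneg : ∀ x : ι → ℝ, x ≠ 0 → ∑ p, ∑ p', x p * x p' * G₀ p p' < 0) :
    ∃ c : ℝ, 0 < c ∧ ∀ᶠ a in l, ∀ x : ι → ℝ,
      ∑ p, ∑ p', x p * x p' * G a p p' ≤ -c * ‖x‖ ^ 2 := by
  obtain ⟨c, hc, hcx⟩ : ∃ c : ℝ, 0 < c ∧ ∀ x : ι → ℝ,
      ∑ p, ∑ p', x p * x p' * G₀ p p' ≤ -c * ‖x‖ ^ 2 := by
    rcases isEmpty_or_nonempty ι with hι | hι
    · exact ⟨1, one_pos, fun x => by simp [Subsingleton.elim x 0]⟩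
    -- The maximum of the limit form on the compact unit sphere is negative; by homogeneity it
    -- provides the gap `c`, half of which survives for nearby matrices.
    let Q : (ι → ℝ) → ℝ := fun x => ∑ p, ∑ p', x p * x p' * G₀ p p'
    have hQ : Continuous Q := by fun_prop
    obtain ⟨x₀, hx₀, hmax⟩ := (isCompact_sphere (0 : ι → ℝ) 1).exists_isMaxOn
      (NormedSpace.sphere_nonempty.2 zero_le_one) hQ.continuousOn
    have hx₀' : x₀ ≠ 0 := fun h => by simp [h] at hx₀
    refine ⟨-Q x₀, by have := hneg x₀ hx₀'; simp only [Q]; linarith, fun x => ?_⟩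
    rcases eq_or_ne x 0 with rfl | hx
    · simp
    have hxn : ‖x‖ ≠ 0 := norm_ne_zero_iff.2 hx
    have h1 : Q (‖x‖⁻¹ • x) ≤ Q x₀ := hmax (by simp [norm_smul, hxn])
    have h2 : Q (‖x‖⁻¹ • x) = ‖x‖⁻¹ ^ 2 * Q x := by
      simp only [Q, Finset.mul_sum, Pi.smul_apply, smul_eq_mul]
      refine Finset.sum_congr rfl fun p _ => Finset.sum_congr rfl fun p' _ => by ring
    rw [h2, inv_pow, inv_mul_le_iff₀ (by positivity)] at h1
    simp only [neg_neg]
    linarith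
  refine ⟨c / 2, by positivity, ?_⟩
  have hsum : Tendsto (fun a => ∑ p, ∑ p', |G a p p' - G₀ p p'|) l (𝓝 0) := by
    have : Tendsto (fun a => ∑ p, ∑ p', |G a p p' - G₀ p p'|) l
        (𝓝 (∑ p : ι, ∑ p' : ι, |G₀ p p' - G₀ p p'|)) :=
      tendsto_finsetSum _ fun p _ => tendsto_finsetSum _ fun p' _ =>
        ((hG p p').sub_const _).abs
    simpa using this
  filter_upwards [hsum.eventually (gt_mem_nhds (show (0 : ℝ) < c / 2 by positivity))] with a ha x
  have h1 : ∑ p, ∑ p', x p * x p' * G a p p' = ∑ p, ∑ p', x p * x p' * G₀ p p' +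
      ∑ p, ∑ p', x p * x p' * (G a p p' - G₀ p p') := by
    simp only [← Finset.sum_add_distrib]
    refine Finset.sum_congr rfl fun p _ => Finset.sum_congr rfl fun p' _ => by ring
  have h2 : ∑ p, ∑ p', x p * x p' * (G a p p' - G₀ p p') ≤
      ‖x‖ ^ 2 * ∑ p, ∑ p', |G a p p' - G₀ p p'| := by
    simp only [Finset.mul_sum]
    refine Finset.sum_le_sum fun p _ => Finset.sum_le_sum fun p' _ => ?_
    refine (le_abs_self _).trans ?_
    rw [abs_mul, abs_mul, sq]
    gcongr
    · exact norm_le_pi_norm x p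
    · exact norm_le_pi_norm x p'
  have h3 : ‖x‖ ^ 2 * ∑ p, ∑ p', |G a p p' - G₀ p p'| ≤ ‖x‖ ^ 2 * (c / 2) := by gcongr
  have := hcx x
  rw [h1]
  linarith

end AbstractOperators

/-! ### Mixing isometric actions, Gram matrices and finite-rank operators. -/

noncomputable section AbstractMultibump

/-- An isometric representation of an abelian group on a Hilbert space which is mixing along a
filter `l` of the group. -/
structure ShiftAction (Γ H : Type*) [AddCommGroup Γ] [NormedAddCommGroup H]
    [InnerProductSpace ℝ H] (l : Filter Γ) where
  toIso : Γ → H →ₗᵢ[ℝ] H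
  map_zero : ∀ v, toIso 0 v = v
  map_add : ∀ b b' v, toIso (b + b') v = toIso b (toIso b' v)
  tendsto_neg : Tendsto (fun b : Γ => -b) l l
  mixing : ∀ x y, Tendsto (fun b => inner ℝ (toIso b x) y) l (𝓝 0)

variable {H : Type*} [NormedAddCommGroup H] [InnerProductSpace ℝ H]
variable {Γ : Type*} [AddCommGroup Γ] {l : Filter Γ}

namespace ShiftAction

variable (T : ShiftAction Γ H l)

/-- The isometry `toIso b` as a continuous linear map. -/
def op (b : Γ) : H →L[ℝ] H := (T.toIso b).toContinuousLinearMap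

theorem op_zero (v : H) : T.op 0 v = v := T.map_zero v

theorem op_add (b b' : Γ) (v : H) : T.op (b + b') v = T.op b (T.op b' v) := T.map_add b b' v

theorem norm_op (b : Γ) (v : H) : ‖T.op b v‖ = ‖v‖ := (T.toIso b).norm_map v

theorem op_neg_op (b : Γ) (v : H) : T.op (-b) (T.op b v) = v := by
  rw [← T.op_add, neg_add_cancel, T.op_zero]

theorem op_op_neg (b : Γ) (v : H) : T.op b (T.op (-b) v) = v := by
  rw [← T.op_add, add_neg_cancel, T.op_zero]

theorem inner_op_op (b : Γ) (v w : H) : inner ℝ (T.op b v) (T.op b w) = inner ℝ v w :=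
  (T.toIso b).inner_map_map v w

theorem inner_op_left (b : Γ) (v w : H) : inner ℝ (T.op b v) w = inner ℝ v (T.op (-b) w) := by
  rw [← T.inner_op_op b v, T.op_op_neg]

theorem mixing_op (v w : H) : Tendsto (fun b => inner ℝ (T.op b v) w) l (𝓝 0) := T.mixing v w

/-- Conjugation of an operator by the action. -/
def conj (b : Γ) (A : H →L[ℝ] H) : H →L[ℝ] H := T.op b ∘L A ∘L T.op (-b)

theorem conj_apply (b : Γ) (A : H →L[ℝ] H) (v : H) :
    T.conj b A v = T.op b (A (T.op (-b) v)) := rfl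

theorem conj_symm {A : H →L[ℝ] H} (hA : ∀ v w, inner ℝ (A v) w = inner ℝ v (A w)) (b : Γ) (v w : H) :
    inner ℝ (T.conj b A v) w = inner ℝ v (T.conj b A w) := by
  rw [conj_apply, conj_apply, T.inner_op_left, hA, T.inner_op_left, neg_neg]

theorem norm_op_comp_le (b : Γ) (A : H →L[ℝ] H) : ‖T.op b ∘L A‖ ≤ ‖A‖ :=
  ContinuousLinearMap.opNorm_le_bound _ (norm_nonneg _) fun v => by
    rw [ContinuousLinearMap.comp_apply, T.norm_op]; exact A.le_opNorm v

theorem norm_comp_op_le (b : Γ) (A : H →L[ℝ] H) : ‖A ∘L T.op b‖ ≤ ‖A‖ :=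
  ContinuousLinearMap.opNorm_le_bound _ (norm_nonneg _) fun v => by
    rw [ContinuousLinearMap.comp_apply, ← T.norm_op b v]; exact A.le_opNorm _

theorem norm_conj_le (b : Γ) (A : H →L[ℝ] H) : ‖T.conj b A‖ ≤ ‖A‖ :=
  (T.norm_op_comp_le b _).trans (T.norm_comp_op_le (-b) A)

end ShiftAction

theorem inner_apply_sum_smul {ι : Type*} [Fintype ι] (A : H →L[ℝ] H) (e : ι → H) (x : ι → ℝ) :
    inner ℝ (A (∑ p, x p • e p)) (∑ p, x p • e p) =
      ∑ p, ∑ p', x p * x p' * inner ℝ (A (e p)) (e p') := by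
  simp only [map_sum, map_smul, sum_inner, inner_sum, real_inner_smul_left,
    real_inner_smul_right]
  rw [Finset.sum_comm]
  refine Finset.sum_congr rfl fun p _ => Finset.sum_congr rfl fun p' _ => by ring

/-- The Gram bound forces linear independence, and the sup norm of the coefficients controls the
norm of the vector. An explicit constant is kept so that negativity survives small perturbations of
`A`. -/
theorem negOn_span_of_gram {ι : Type*} [Fintype ι] {A : H →L[ℝ] H} {e : ι → H} {c M : ℝ}
    (hc : 0 < c)
    (hG : ∀ x : ι → ℝ, ∑ p, ∑ p', x p * x p' * inner ℝ (A (e p)) (e p') ≤ -c * ‖x‖ ^ 2)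
    (hM : ∀ p, ‖e p‖ ≤ M) (hM0 : 0 < M) :
    ∃ W : Submodule ℝ H, FiniteDimensional ℝ W ∧ Module.finrank ℝ W = Fintype.card ι ∧
      ∀ w ∈ W, inner ℝ (A w) w ≤ -(c / (Fintype.card ι * M + 1) ^ 2) * ‖w‖ ^ 2 := by
  have hq : ∀ x : ι → ℝ, inner ℝ (A (∑ p, x p • e p)) (∑ p, x p • e p) ≤ -c * ‖x‖ ^ 2 := by
    intro x
    exact (inner_apply_sum_smul A e x).le.trans (hG x)
  have hli : LinearIndependent ℝ e := by
    rw [Fintype.linearIndependent_iff]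
    intro x hx p
    have h1 := hq x
    rw [hx, inner_zero_right] at h1
    have h2 : ‖x‖ = 0 := by
      have : 0 ≤ ‖x‖ ^ 2 := by positivity
      have : ‖x‖ ^ 2 = 0 := by nlinarith
      exact pow_eq_zero_iff (two_ne_zero) |>.1 this
    rw [norm_eq_zero.1 h2]; rfl
  refine ⟨Submodule.span ℝ (Set.range e), FiniteDimensional.span_of_finite ℝ (Set.finite_range _),
    finrank_span_eq_card hli, fun w hw => ?_⟩
  obtain ⟨x, rfl⟩ := (Submodule.mem_span_range_iff_exists_fun ℝ).1 hw
  refine (hq x).trans ?_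
  have h1 : ‖∑ p, x p • e p‖ ≤ (Fintype.card ι * M + 1) * ‖x‖ := by
    refine (norm_sum_le _ _).trans ?_
    refine (Finset.sum_le_sum (g := fun _ => ‖x‖ * M) fun p _ => ?_).trans ?_
    · rw [norm_smul]
      exact mul_le_mul (norm_le_pi_norm x p) (hM p) (norm_nonneg _) (norm_nonneg _)
    · rw [Finset.sum_const, nsmul_eq_mul, Finset.card_univ]
      nlinarith [norm_nonneg x]
  have h2 : c / (Fintype.card ι * M + 1) ^ 2 * ‖∑ p, x p • e p‖ ^ 2 ≤ c * ‖x‖ ^ 2 := by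
    rw [div_mul_eq_mul_div, div_le_iff₀ (by positivity)]
    have : ‖∑ p, x p • e p‖ ^ 2 ≤ ((Fintype.card ι * M + 1) * ‖x‖) ^ 2 := by gcongr
    nlinarith
  linarith

theorem gram_neg_of_linearIndependent {ι : Type*} [Fintype ι] {A : H →L[ℝ] H} {e : ι → H}
    (hli : LinearIndependent ℝ e) {Z : Submodule ℝ H} (hZ : NegOn A Z) (he : ∀ p, e p ∈ Z)
    {x : ι → ℝ} (hx : x ≠ 0) : ∑ p, ∑ p', x p * x p' * inner ℝ (A (e p)) (e p') < 0 := by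
  have h0 : ∑ p, x p • e p ≠ 0 := fun h =>
    hx (funext (Fintype.linearIndependent_iff.1 hli x h))
  exact (inner_apply_sum_smul A e x).symm.trans_lt
    (hZ _ (Z.sum_mem fun p _ => Z.smul_mem (x p) (he p)) h0)

theorem exists_basis_family {Z : Submodule ℝ H} [FiniteDimensional ℝ Z] {k : ℕ}
    (hk : Module.finrank ℝ Z = k) : ∃ e : Fin k → H, LinearIndependent ℝ e ∧ ∀ p, e p ∈ Z := by
  let b := Module.finBasisOfFinrankEq ℝ Z hk
  exact ⟨fun i => b i, b.linearIndependent.map' Z.subtype (by simp), fun p => (b p).2⟩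

theorem formIndex_eq_of_negOn_of_coercive {A : H →L[ℝ] H} {W Y : Submodule ℝ H}
    [FiniteDimensional ℝ W] [FiniteDimensional ℝ Y] {k : ℕ} (hW : Module.finrank ℝ W = k)
    (hWneg : NegOn A W) (hYk : Module.finrank ℝ Y ≤ k)
    (hY : ∀ v, (∀ y ∈ Y, inner ℝ y v = 0) → 0 ≤ inner ℝ (A v) v) : formIndex A ⊤ = k := by
  refine le_antisymm ?_ (le_formIndex_iff.2 ⟨W, le_top, hWneg, inferInstance, hW⟩)
  by_contra! h
  obtain ⟨Z, -, hZ, hfd, hZk⟩ := le_formIndex_iff.1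
    (show ((k + 1 : ℕ) : ℕ∞) ≤ formIndex A ⊤ by
      push_cast; exact (ENat.add_one_le_iff (by simp)).2 h)
  have := finrank_le_of_negOn_of_nonneg hZ hY
  omega

/-- Comparing dimensions, the projection onto `Y` is bijective on `W`, so every `v` is `w + p` with
`w ∈ W` and `p` orthogonal to `Y`. Pairing `A v` with `p - w` cancels the mixed terms by symmetry
and leaves at least `c (‖p‖² + ‖w‖²)`. -/
theorem bounded_below_of_splitting {A : H →L[ℝ] H}
    (hA : ∀ v w, inner ℝ (A v) w = inner ℝ v (A w)) {W Y : Submodule ℝ H}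
    [FiniteDimensional ℝ W] [FiniteDimensional ℝ Y]
    (hYW : Module.finrank ℝ Y ≤ Module.finrank ℝ W) {c : ℝ} (hc : 0 < c)
    (hW : ∀ w ∈ W, inner ℝ (A w) w ≤ -c * ‖w‖ ^ 2)
    (hY : ∀ v, (∀ y ∈ Y, inner ℝ y v = 0) → c * ‖v‖ ^ 2 ≤ inner ℝ (A v) v) (v : H) :
    c / 2 * ‖v‖ ≤ ‖A v‖ := by
  let P : W →ₗ[ℝ] Y := (Y.orthogonalProjectionOnto : H →ₗ[ℝ] Y) ∘ₗ W.subtype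
  have hP : Function.Injective P := by
    rw [← LinearMap.ker_eq_bot, Submodule.eq_bot_iff]
    rintro ⟨w, hw⟩ h
    have h1 : Y.orthogonalProjectionOnto w = 0 := h
    rw [Submodule.orthogonalProjectionOnto_eq_zero_iff] at h1
    have h2 := hY w (fun y hy => h1 y hy)
    have h3 := hW w hw
    have h4 : ‖w‖ ^ 2 = 0 := by nlinarith [sq_nonneg ‖w‖]
    simpa using h4
  have hcard : Module.finrank ℝ W = Module.finrank ℝ Y :=
    le_antisymm (LinearMap.finrank_le_finrank_of_injective hP) hYW
  have hsurj : Function.Surjective P :=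
    (LinearMap.injective_iff_surjective_of_finrank_eq_finrank hcard).1 hP
  obtain ⟨⟨w, hw⟩, hwv⟩ := hsurj (Y.orthogonalProjectionOnto v)
  have hwv' : Y.orthogonalProjectionOnto w = Y.orthogonalProjectionOnto v := hwv
  set p := v - w with hp
  have hpY : p ∈ Yᗮ := by
    rw [← Submodule.orthogonalProjectionOnto_eq_zero_iff, hp, map_sub, hwv', sub_self]
  have hv : v = w + p := by rw [hp]; abel
  have h1 := hW w hw
  have h2 := hY p (fun y hy => hpY y hy)
  have h3 : inner ℝ (A v) (p - w) = inner ℝ (A p) p - inner ℝ (A w) w := by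
    have : inner ℝ (A p) w = inner ℝ (A w) p := by rw [hA, real_inner_comm]
    rw [hv]
    simp only [map_add, inner_add_left, inner_sub_right, this]
    ring
  have h4 : c * (‖p‖ ^ 2 + ‖w‖ ^ 2) ≤ ‖A v‖ * ‖p - w‖ := by
    have := real_inner_le_norm (A v) (p - w)
    rw [h3] at this
    linarith
  have h5 : ‖p - w‖ ≤ ‖p‖ + ‖w‖ := norm_sub_le _ _
  have h6 : ‖v‖ ≤ ‖p‖ + ‖w‖ := by rw [hv, add_comm ‖p‖]; exact norm_add_le _ _
  have h7 : c / 2 * (‖p‖ + ‖w‖) ^ 2 ≤ ‖A v‖ * (‖p‖ + ‖w‖) := by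
    have e1 : ‖A v‖ * ‖p - w‖ ≤ ‖A v‖ * (‖p‖ + ‖w‖) := by gcongr
    have e2 : (‖p‖ + ‖w‖) ^ 2 ≤ 2 * (‖p‖ ^ 2 + ‖w‖ ^ 2) := by nlinarith [sq_nonneg (‖p‖ - ‖w‖)]
    nlinarith
  have h8 : 0 ≤ ‖p‖ + ‖w‖ := by positivity
  rcases h8.eq_or_lt with h9 | h9
  · have : ‖v‖ = 0 := le_antisymm (by rw [h9]; exact h6) (norm_nonneg _)
    rw [this]; simp
  · have : c / 2 * (‖p‖ + ‖w‖) ≤ ‖A v‖ := by nlinarith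
    refine le_trans ?_ this
    gcongr

/-- Strong convergence is uniform on bounded sets of a finite-dimensional space; expanding `S` in an
orthonormal basis of `Y` reduces the operator norm to finitely many vectors. -/
theorem tendsto_norm_comp_finiteRank {α : Type*} {m : Filter α} {Q : α → H →L[ℝ] H}
    (hQ : ∀ v, Tendsto (fun b => Q b v) m (𝓝 0)) {S : H →L[ℝ] H}
    (hS : ∀ v w, inner ℝ (S v) w = inner ℝ v (S w)) {Y : Submodule ℝ H} [FiniteDimensional ℝ Y]
    (hSY : ∀ v, S v ∈ Y) (R : H →L[ℝ] H) : Tendsto (fun b => ‖Q b ∘L R ∘L S‖) m (𝓝 0) := by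
  let e := stdOrthonormalBasis ℝ Y
  have hrep : ∀ v, S v = ∑ j, inner ℝ (S (e j)) v • (e j : H) := by
    intro v
    have h1 := e.sum_repr' ⟨S v, hSY v⟩
    have h2 := congrArg (Subtype.val) h1
    simp only [Submodule.coe_sum, Submodule.coe_smul, Submodule.coe_inner] at h2
    rw [← h2]
    refine Finset.sum_congr rfl fun j _ => ?_
    rw [hS]
  refine squeeze_zero (fun _ => norm_nonneg _)
    (g := fun b => ∑ j, ‖S (e j)‖ * ‖Q b (R (e j))‖) (fun b => ?_) ?_
  · refine ContinuousLinearMap.opNorm_le_bound _ (by positivity) fun v => ?_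
    simp only [ContinuousLinearMap.comp_apply]
    rw [hrep v, Finset.sum_mul]
    simp only [map_sum, map_smul]
    refine (norm_sum_le _ _).trans (Finset.sum_le_sum fun j _ => ?_)
    rw [norm_smul, mul_right_comm]
    gcongr
    exact norm_inner_le_norm _ _
  · have : Tendsto (fun b => ∑ j, ‖S (e j)‖ * ‖Q b (R (e j))‖) m
        (𝓝 (∑ j : Fin (Module.finrank ℝ Y), ‖S (e j)‖ * ‖(0 : H)‖)) :=
      tendsto_finsetSum _ fun j _ => ((hQ _).norm).const_mul _
    simpa using this

/-- Mixing says that `T_b v` tends weakly to zero, and a finite-rank operator turns weak into strong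
convergence. -/
theorem tendsto_finiteRank_shift (T : ShiftAction Γ H l) {S : H →L[ℝ] H}
    (hS : ∀ v w, inner ℝ (S v) w = inner ℝ v (S w)) {Y : Submodule ℝ H} [FiniteDimensional ℝ Y]
    (hSY : ∀ v, S v ∈ Y) (v : H) : Tendsto (fun b => S (T.op b v)) l (𝓝 0) := by
  let e := stdOrthonormalBasis ℝ Y
  have hrep : ∀ v, S v = ∑ j, inner ℝ v (S (e j)) • (e j : H) := by
    intro v
    have h1 := e.sum_repr' ⟨S v, hSY v⟩
    have h2 := congrArg (Subtype.val) h1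
    simp only [Submodule.coe_sum, Submodule.coe_smul, Submodule.coe_inner] at h2
    rw [← h2]
    refine Finset.sum_congr rfl fun j _ => ?_
    rw [real_inner_comm, hS]
  have : Tendsto (fun b => ∑ j, inner ℝ (T.op b v) (S (e j)) • (e j : H)) l
      (𝓝 (∑ j : Fin (Module.finrank ℝ Y), (0 : ℝ) • (e j : H))) :=
    tendsto_finsetSum _ fun j _ => (T.mixing v (S (e j))).smul_const _
  simp only [zero_smul, Finset.sum_const_zero] at this
  exact this.congr fun b => (hrep _).symm

theorem finrank_iSup_map_le {ι : Type*} [Fintype ι] (Y : Submodule ℝ H) [FiniteDimensional ℝ Y]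
    (f : ι → H →ₗ[ℝ] H) :
    Module.finrank ℝ (⨆ i, Y.map (f i) : Submodule ℝ H) ≤ Fintype.card ι * Module.finrank ℝ Y := by
  classical
  let g : (ι → Y) →ₗ[ℝ] H := ∑ i, f i ∘ₗ Y.subtype ∘ₗ LinearMap.proj i
  have hg : (⨆ i, Y.map (f i) : Submodule ℝ H) ≤ LinearMap.range g := by
    refine iSup_le fun i => ?_
    rintro _ ⟨y, hy, rfl⟩
    refine ⟨Pi.single i ⟨y, hy⟩, ?_⟩
    simp only [g, LinearMap.sum_apply, LinearMap.comp_apply, LinearMap.proj_apply,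
      Submodule.subtype_apply]
    rw [Finset.sum_eq_single i]
    · simp
    · intro j _ hj
      simp [Pi.single_eq_of_ne hj]
    · simp
  refine (Submodule.finrank_mono hg).trans ((LinearMap.finrank_range_le g).trans ?_)
  simp [Module.finrank_pi_fintype]

end AbstractMultibump

/-! ### The linearized operator at well separated translates. -/

noncomputable section AbstractLinearized

variable {H : Type*} [NormedAddCommGroup H] [InnerProductSpace ℝ H]
variable {Γ : Type*} [AddCommGroup Γ] {l : Filter Γ}

/-- If `B - K` has finite index and `K` decays along the action, then `B` is nonnegative. -/
theorem nonneg_of_formIndex_lt_top [l.NeBot] (T : ShiftAction Γ H l) {B K : H →L[ℝ] H}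
    (hB : ∀ v w, inner ℝ (B v) w = inner ℝ v (B w)) (hK : ∀ v w, inner ℝ (K v) w = inner ℝ v (K w))
    (hBT : ∀ b v, B (T.op b v) = T.op b (B v))
    (hKT : ∀ v, Tendsto (fun b => K (T.op b v)) l (𝓝 0)) {k : ℕ} (hk : formIndex (B - K) ⊤ = k)
    (v : H) : 0 ≤ inner ℝ (B v) v := by
  -- A vector on which `B` is negative, translated far away, keeps its negative value under `B - K`
  -- and becomes nearly orthogonal, for that form, to a negative space of dimension `k`. The index
  -- would be at least `k + 1`.
  by_contra! hlt
  obtain ⟨Z, -, hZ, hfd, hZk⟩ := le_formIndex_iff.1 hk.ge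
  obtain ⟨e, hli, he⟩ := exists_basis_family hZk
  let L := B - K
  have hL : ∀ v w, inner ℝ (L v) w = inner ℝ v (L w) := fun v w => by
    simp only [L, sub_apply, inner_sub_left, inner_sub_right, hB, hK]
  have hd : ∀ w, Tendsto (fun b => inner ℝ (L (T.op b v)) w) l (𝓝 0) := fun w => by
    have h1 := (T.mixing_op (B v) w).sub ((hKT v).inner (tendsto_const_nhds (x := w)))
    simp only [inner_zero_left, sub_zero] at h1
    refine h1.congr fun b => ?_
    simp only [L, sub_apply, inner_sub_left, hBT]
  have hd' : Tendsto (fun b => inner ℝ (L (T.op b v)) (T.op b v)) l (𝓝 (inner ℝ (B v) v)) := by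
    have h1 : Tendsto (fun b => inner ℝ (K (T.op b v)) (T.op b v)) l (𝓝 0) := by
      refine squeeze_zero_norm (a := fun b => ‖K (T.op b v)‖ * ‖v‖) (fun b => ?_) ?_
      · rw [← T.norm_op b v]; exact norm_inner_le_norm _ _
      · simpa using (hKT v).norm.mul_const ‖v‖
    have h2 := (tendsto_const_nhds (x := inner ℝ (B v) v)).sub h1
    rw [sub_zero] at h2
    refine h2.congr fun b => ?_
    simp only [L, sub_apply, inner_sub_left, hBT, T.inner_op_op]
  let y : Γ → Option (Fin k) → H := fun b p => p.elim (T.op b v) e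
  let G₀ : Option (Fin k) → Option (Fin k) → ℝ := fun p p' =>
    p.elim (p'.elim (inner ℝ (B v) v) fun _ => 0) fun i => p'.elim 0 fun j => inner ℝ (L (e i)) (e j)
  have hG : ∀ p p', Tendsto (fun b => inner ℝ (L (y b p)) (y b p')) l (𝓝 (G₀ p p')) := by
    rintro (_ | i) (_ | j)
    · exact hd'
    · exact hd (e j)
    · refine (hd (e i)).congr fun b => ?_
      simp only [y, Option.elim]
      rw [hL, real_inner_comm]
    · exact tendsto_const_nhds
  have hneg : ∀ x : Option (Fin k) → ℝ, x ≠ 0 → ∑ p, ∑ p', x p * x p' * G₀ p p' < 0 := by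
    intro x hx
    simp only [Fintype.sum_option, G₀, Option.elim, mul_zero, Finset.sum_const_zero, add_zero,
      zero_add]
    by_cases h0 : (fun i => x (some i)) = 0
    · have h1 : x none ≠ 0 := fun h => hx (funext fun p => by
        cases p with
        | none => exact h
        | some i => exact congrFun h0 i)
      have h2 : ∀ i, x (some i) = 0 := fun i => congrFun h0 i
      simp only [h2, zero_mul, Finset.sum_const_zero, add_zero]
      have : 0 < x none * x none := mul_self_pos.2 h1
      nlinarith
    · have h1 := gram_neg_of_linearIndependent hli hZ he h0
      have : 0 ≤ x none * x none := mul_self_nonneg _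
      have h2 : x none * x none * inner ℝ (B v) v ≤ 0 := mul_nonpos_of_nonneg_of_nonpos this hlt.le
      simp only [L]
      linarith
  obtain ⟨c, hc, hev⟩ := eventually_neg_of_tendsto hG hneg
  obtain ⟨b, hb⟩ := hev.exists
  obtain ⟨W, hW, hWc, hWneg⟩ := negOn_span_of_gram (A := L) (e := y b)
    (M := ∑ p, ‖y b p‖ + 1) hc hb
    (fun p => by
      have := Finset.single_le_sum (f := fun p => ‖y b p‖) (fun _ _ => norm_nonneg _)
        (Finset.mem_univ p)
      linarith) (by positivity)
  have : ((k + 1 : ℕ) : ℕ∞) ≤ formIndex L ⊤ := by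
    refine le_formIndex_iff.2 ⟨W, le_top, fun w hw hw0 => ?_, hW, by simpa using hWc⟩
    refine (hWneg w hw).trans_lt ?_
    have : 0 < ‖w‖ := norm_pos_iff.2 hw0
    rw [neg_mul, neg_lt_zero]
    positivity
  rw [hk] at this
  norm_cast at this
  omega

/-- Apply the bound for `B - K` to `T_b v` and let `b` go to infinity: `B` commutes with the
translation and the contribution of `K` disappears. -/
theorem bounded_below_of_shift [l.NeBot] (T : ShiftAction Γ H l) {B K : H →L[ℝ] H}
    (hBT : ∀ b v, B (T.op b v) = T.op b (B v))
    (hKT : ∀ v, Tendsto (fun b => K (T.op b v)) l (𝓝 0)) {c : ℝ}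
    (hb : ∀ v, c * ‖v‖ ≤ ‖(B - K) v‖) (v : H) : c * ‖v‖ ≤ ‖B v‖ := by
  have h1 : Tendsto (fun b => ‖B v‖ + ‖K (T.op b v)‖) l (𝓝 (‖B v‖ + ‖(0 : H)‖)) :=
    ((hKT v).norm).const_add _
  rw [norm_zero, add_zero] at h1
  refine ge_of_tendsto' h1 fun b => ?_
  calc c * ‖v‖ = c * ‖T.op b v‖ := by rw [T.norm_op]
    _ ≤ ‖(B - K) (T.op b v)‖ := hb _
    _ ≤ ‖B (T.op b v)‖ + ‖K (T.op b v)‖ := norm_sub_le _ _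
    _ = _ := by rw [hBT, T.norm_op]

theorem norm_adjoint_eq [CompleteSpace H] {A A' : H →L[ℝ] H}
    (h : ∀ v w, inner ℝ (A v) w = inner ℝ v (A' w)) : ‖A‖ = ‖A'‖ := by
  have : A = ContinuousLinearMap.adjoint A' := (ContinuousLinearMap.eq_adjoint_iff A A').2 h
  rw [this]
  exact LinearIsometryEquiv.norm_map _ _

/-- The interaction operators `C T_b B⁻¹ C` of `C = K - S`, `S` of finite rank, tend to zero. -/
theorem tendsto_interaction [CompleteSpace H] (T : ShiftAction Γ H l) {Binv K S : H →L[ℝ] H}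
    (hBinv : ∀ v w, inner ℝ (Binv v) w = inner ℝ v (Binv w))
    (hK : ∀ v w, inner ℝ (K v) w = inner ℝ v (K w)) (hS : ∀ v w, inner ℝ (S v) w = inner ℝ v (S w))
    (hBT : ∀ b v, Binv (T.op b v) = T.op b (Binv v))
    (hKT : ∀ v, Tendsto (fun b => K (T.op b v)) l (𝓝 0))
    (hKK : Tendsto (fun b => ‖K ∘L T.op b ∘L Binv ∘L K‖) l (𝓝 0))
    {Y : Submodule ℝ H} [FiniteDimensional ℝ Y] (hSY : ∀ v, S v ∈ Y) :
    Tendsto (fun b => ‖(K - S) ∘L T.op b ∘L Binv ∘L (K - S)‖) l (𝓝 0) := by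
  have hST := tendsto_finiteRank_shift T hS hSY
  have hCT : ∀ v, Tendsto (fun b => ((K - S) ∘L T.op b) v) l (𝓝 0) := fun v => by
    simpa using (hKT v).sub (hST v)
  -- With the finite-rank factor on the right, strong convergence of `(K - S) T_b` suffices. With it
  -- on the left, the adjoint is `K T_{-b} B⁻¹ S`, again of that type.
  have h1 : Tendsto (fun b => ‖(K - S) ∘L T.op b ∘L Binv ∘L S‖) l (𝓝 0) :=
    tendsto_norm_comp_finiteRank hCT hS hSY Binv
  have h2 : Tendsto (fun b => ‖S ∘L T.op b ∘L Binv ∘L K‖) l (𝓝 0) := by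
    have h3 : Tendsto (fun b => ‖(K ∘L T.op (-b)) ∘L Binv ∘L S‖) l (𝓝 0) :=
      (tendsto_norm_comp_finiteRank (Q := fun b => K ∘L T.op b) hKT hS hSY Binv).comp
        T.tendsto_neg
    refine h3.congr fun b => (norm_adjoint_eq fun v w => ?_).symm
    simp only [ContinuousLinearMap.comp_apply]
    rw [hS, T.inner_op_left, hBinv, hK, hBT]
  refine squeeze_zero (fun _ => norm_nonneg _) (fun b => ?_)
    (by simpa using (hKK.add h2).add h1)
  have e : (K - S) ∘L T.op b ∘L Binv ∘L (K - S) =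
      K ∘L T.op b ∘L Binv ∘L K - S ∘L T.op b ∘L Binv ∘L K -
        (K - S) ∘L T.op b ∘L Binv ∘L S := by
    ext v
    simp only [ContinuousLinearMap.comp_apply, sub_apply, map_sub]
  rw [e]
  exact (norm_sub_le _ _).trans (add_le_add (norm_sub_le _ _) le_rfl)

variable {ι : Type*} [Fintype ι]

/-- Spectral splitting of the operator `B - ∑ T_{a i} K T_{-a i}` for well separated `a i`. -/
theorem exists_splitting [CompleteSpace H] [l.NeBot] (T : ShiftAction Γ H l) {B K : H →L[ℝ] H}
    (hB : ∀ v w, inner ℝ (B v) w = inner ℝ v (B w)) (hK : ∀ v w, inner ℝ (K v) w = inner ℝ v (K w))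
    (hBT : ∀ b v, B (T.op b v) = T.op b (B v))
    (hKT : ∀ v, Tendsto (fun b => K (T.op b v)) l (𝓝 0)) {k : ℕ} (hk : formIndex (B - K) ⊤ = k)
    {c₀ : ℝ} (hc₀ : 0 < c₀) (hb : ∀ v, c₀ * ‖v‖ ≤ ‖(B - K) v‖)
    (hdecay : ∀ Binv : H →L[ℝ] H, (∀ v, B (Binv v) = v) →
      ∀ c : ℝ, 0 < c → (∀ v, c * ‖v‖ ^ 2 ≤ inner ℝ (B v) v) →
        Tendsto (fun b => ‖K ∘L T.op b ∘L Binv ∘L K‖) l (𝓝 0))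
    {α : Type*} {m : Filter α} {a : α → ι → Γ}
    (ha : ∀ i j, i ≠ j → Tendsto (fun x => a x i - a x j) m l) :
    ∃ c : ℝ, 0 < c ∧ ∀ᶠ x in m,
      (∃ W : Submodule ℝ H, FiniteDimensional ℝ W ∧ Module.finrank ℝ W = Fintype.card ι * k ∧
        ∀ w ∈ W, inner ℝ ((B - ∑ i, T.conj (a x i) K) w) w ≤ -c * ‖w‖ ^ 2) ∧
      (∃ Y : Submodule ℝ H, FiniteDimensional ℝ Y ∧ Module.finrank ℝ Y ≤ Fintype.card ι * k ∧
        ∀ v, (∀ y ∈ Y, inner ℝ y v = 0) →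
          c * ‖v‖ ^ 2 ≤ inner ℝ ((B - ∑ i, T.conj (a x i) K) v) v) := by
  classical
  have hL : ∀ v w, inner ℝ ((B - K) v) w = inner ℝ v ((B - K) w) := fun v w => by
    simp only [sub_apply, inner_sub_left, inner_sub_right, hB, hK]
  -- `B` gets its sign from the finite index and its lower bound from `B - K`; together they make it
  -- invertible and coercive.
  have hBpos := nonneg_of_formIndex_lt_top T hB hK hBT hKT hk
  have hBbelow := bounded_below_of_shift T hBT hKT hb
  obtain ⟨E, hE⟩ := exists_continuousLinearEquiv_of_bounded_below hB hc₀ hBbelow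
  have hEB : ∀ v, E v = B v := fun v => by rw [← hE]; rfl
  set Binv : H →L[ℝ] H := (E.symm : H →L[ℝ] H) with hBinv_def
  have hBB : ∀ v, B (Binv v) = v := fun v => by rw [← hEB]; exact E.apply_symm_apply v
  have hBB' : ∀ v, Binv (B v) = v := fun v => by rw [← hEB]; exact E.symm_apply_apply v
  have hBinv : ∀ v w, inner ℝ (Binv v) w = inner ℝ v (Binv w) := fun v w => by
    conv_lhs => rw [← hBB w, ← hB, hBB]
  have hBinvT : ∀ b v, Binv (T.op b v) = T.op b (Binv v) := fun b v => by
    conv_lhs => rw [← hBB v, ← hBT, hBB']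
  set cB := c₀ ^ 2 / (‖B‖ + 1)
  have hcB : 0 < cB := by positivity
  have hBco : ∀ v, cB * ‖v‖ ^ 2 ≤ inner ℝ (B v) v :=
    coercive_of_nonneg_of_bounded_below hB hBpos hc₀ hBbelow (by linarith) (by positivity)
  have hKK := hdecay Binv hBB cB hcB hBco
  obtain ⟨Z, -, hZ, hZfd, hZk⟩ := le_formIndex_iff.1 hk.ge
  obtain ⟨S, Y, hS, hYfd, hYk, hSY, c₁, hc₁, hco⟩ := exists_finiteRank_coercive hL hc₀ hb hZ
    fun v hv => hZ.inner_self_nonneg_of_maximal hL hk.le le_top hZk (E := ⊤) trivial hv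
  set C := K - S with hC
  have hCsym : ∀ v w, inner ℝ (C v) w = inner ℝ v (C w) := fun v w => by
    simp only [hC, sub_apply, inner_sub_left, inner_sub_right, hK, hS]
  have hint := tendsto_interaction T hBinv hK hS hBinvT hKT hKK hSY
  set c₂ := min cB c₁
  have hc₂ : 0 < c₂ := lt_min hcB hc₁
  -- `B - t C` is a convex combination of the coercive operators `B` and `B - K + S`, so one
  -- constant serves all `t`.
  have hBC : ∀ t ∈ Set.Icc (0 : ℝ) 1, ∀ v, c₂ * ‖v‖ ^ 2 ≤ inner ℝ ((B - t • C) v) v := by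
    intro t ht v
    have e : inner ℝ ((B - t • C) v) v =
        (1 - t) * inner ℝ (B v) v + t * inner ℝ ((B - K + S) v) v := by
      simp only [hC, sub_apply, add_apply, smul_apply, inner_sub_left, inner_add_left,
        real_inner_smul_left]
      ring
    have h1 : c₂ * ‖v‖ ^ 2 ≤ inner ℝ (B v) v := le_trans (by gcongr; exact min_le_left _ _) (hBco v)
    have h2 : c₂ * ‖v‖ ^ 2 ≤ inner ℝ ((B - K + S) v) v :=
      le_trans (by gcongr; exact min_le_right _ _) (hco v)
    rw [e]
    nlinarith [ht.1, ht.2, mul_le_mul_of_nonneg_left h1 (sub_nonneg.2 ht.2),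
      mul_le_mul_of_nonneg_left h2 ht.1]
  have hconj : ∀ (b : Γ) (t : ℝ) v, inner ℝ ((B - t • T.conj b C) v) v =
      inner ℝ ((B - t • C) (T.op (-b) v)) (T.op (-b) v) := by
    intro b t v
    simp only [sub_apply, smul_apply, inner_sub_left, real_inner_smul_left, hBT, T.inner_op_op,
      T.conj_apply, T.inner_op_left]
  set n : ℝ := (Fintype.card ι : ℝ) with hn
  set D := 2 * (‖Binv‖ + n * (‖C‖ * ‖Binv‖) / c₂) + 1
  have hD : 0 < D := by positivity
  set M := ‖B‖ + n * ‖C‖ + 1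
  -- the limit of the Gram matrices
  obtain ⟨e, hli, he⟩ := exists_basis_family hZk
  have hgram : ∀ p p' : ι × Fin k, Tendsto (fun x => inner ℝ
      ((B - ∑ i, T.conj (a x i) K) (T.op (a x p.1) (e p.2))) (T.op (a x p'.1) (e p'.2))) m
      (𝓝 (if p.1 = p'.1 then inner ℝ ((B - K) (e p.2)) (e p'.2) else 0)) := by
    rintro ⟨i, p⟩ ⟨j, q⟩
    simp only
    have hBlim : Tendsto (fun x => inner ℝ (B (T.op (a x i) (e p))) (T.op (a x j) (e q))) m
        (𝓝 (if i = j then inner ℝ (B (e p)) (e q) else 0)) := by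
      by_cases hij : i = j
      · subst hij
        simp only [if_true, hBT, T.inner_op_op]
        exact tendsto_const_nhds
      · rw [if_neg hij]
        refine ((T.mixing_op (B (e p)) (e q)).comp (ha i j hij)).congr fun x => ?_
        simp only [Function.comp_apply]
        rw [hBT, ← T.inner_op_op (a x j), ← T.op_add, add_sub_cancel]
    -- Only `s = i = j` survives. If `s ≠ i`, then `K` meets a far translate of `e p`; if `s = i ≠
    -- j`, symmetry moves `K` onto a far translate of `e q`.
    have hKlim : ∀ s : ι, Tendsto (fun x => inner ℝ
        (T.conj (a x s) K (T.op (a x i) (e p))) (T.op (a x j) (e q))) m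
        (𝓝 (if s = i then (if i = j then inner ℝ (K (e p)) (e q) else 0) else 0)) := by
      intro s
      have e1 : ∀ x, inner ℝ (T.conj (a x s) K (T.op (a x i) (e p))) (T.op (a x j) (e q)) =
          inner ℝ (K (T.op (a x i - a x s) (e p))) (T.op (a x j - a x s) (e q)) := by
        intro x
        rw [T.conj_apply, T.inner_op_left, ← T.op_add, ← T.op_add, neg_add_eq_sub, neg_add_eq_sub]
      simp only [e1]
      have hsq : ∀ (f : α → H) (g : α → H) (r : ℝ), Tendsto f m (𝓝 0) → (∀ x, ‖g x‖ ≤ r) →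
          Tendsto (fun x => inner ℝ (f x) (g x)) m (𝓝 0) := by
        intro f g r hf hg
        refine squeeze_zero_norm (a := fun x => ‖f x‖ * r) (fun x => ?_) ?_
        · exact (norm_inner_le_norm _ _).trans (by gcongr; exact hg x)
        · simpa using hf.norm.mul_const r
      by_cases hsi : s = i
      · subst hsi
        rw [if_pos rfl]
        by_cases hij : s = j
        · subst hij
          simp only [sub_self, T.op_zero, if_true]
          exact tendsto_const_nhds
        · rw [if_neg hij]
          have h1 := hsq _ (fun x => T.op (a x s - a x s) (e p)) ‖e p‖
            ((hKT (e q)).comp (ha j s (Ne.symm hij))) fun x => (T.norm_op _ _).le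
          refine h1.congr fun x => ?_
          simp only [Function.comp_apply]
          rw [real_inner_comm, ← hK]
      · rw [if_neg hsi]
        exact hsq _ (fun x => T.op (a x j - a x s) (e q)) ‖e q‖
          ((hKT (e p)).comp (ha i s (Ne.symm hsi))) fun x => (T.norm_op _ _).le
    have h1 := hBlim.sub (tendsto_finsetSum Finset.univ fun s _ => hKlim s)
    have h2 : (if i = j then inner ℝ (B (e p)) (e q) else 0) - ∑ s : ι,
        (if s = i then (if i = j then inner ℝ (K (e p)) (e q) else 0) else 0) =
        if i = j then inner ℝ ((B - K) (e p)) (e q) else 0 := by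
      rw [Finset.sum_ite_eq' Finset.univ i]
      by_cases hij : i = j <;> simp [hij, inner_sub_left]
    rw [h2] at h1
    refine h1.congr fun x => ?_
    simp only [sub_apply, sum_apply, inner_sub_left, sum_inner]
  have hneg : ∀ x : ι × Fin k → ℝ, x ≠ 0 → ∑ p, ∑ p', x p * x p' *
      (if p.1 = p'.1 then inner ℝ ((B - K) (e p.2)) (e p'.2) else 0) < 0 := by
    intro x hx
    have e1 : ∑ p, ∑ p', x p * x p' *
        (if p.1 = p'.1 then inner ℝ ((B - K) (e p.2)) (e p'.2) else 0) =
        ∑ i, ∑ p, ∑ q, x (i, p) * x (i, q) * inner ℝ ((B - K) (e p)) (e q) := by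
      simp only [Fintype.sum_prod_type, mul_ite, mul_zero]
      refine Finset.sum_congr rfl fun i _ => Finset.sum_congr rfl fun p _ => ?_
      rw [Finset.sum_comm]
      refine Finset.sum_congr rfl fun q _ => ?_
      rw [Finset.sum_ite_eq Finset.univ i]
      simp
    rw [e1]
    obtain ⟨⟨i, p⟩, hip⟩ := Function.ne_iff.1 hx
    have hle : ∀ i, ∑ p, ∑ q, x (i, p) * x (i, q) * inner ℝ ((B - K) (e p)) (e q) ≤ 0 := by
      intro i
      by_cases h0 : (fun p => x (i, p)) = 0
      · have : ∀ p, x (i, p) = 0 := fun p => congrFun h0 p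
        simp [this]
      · exact (gram_neg_of_linearIndependent hli hZ he h0).le
    refine Finset.sum_neg' (fun i _ => hle i) ⟨i, Finset.mem_univ i, ?_⟩
    exact gram_neg_of_linearIndependent hli hZ he (x := fun p => x (i, p))
      fun h => hip (congrFun h p)
  obtain ⟨c₃, hc₃, hev₃⟩ := eventually_neg_of_tendsto hgram hneg
  -- separation
  have hsep : ∀ᶠ x in m, ∀ i j, i ≠ j →
      ‖C ∘L T.op (a x i - a x j) ∘L Binv ∘L C‖ ≤ c₂ / (2 * (n * n + 1)) := by
    rw [eventually_all]
    intro i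
    rw [eventually_all]
    intro j
    by_cases hij : i = j
    · simp [hij]
    · have := (hint.comp (ha i j hij)).eventually
        (ge_mem_nhds (show (0 : ℝ) < c₂ / (2 * (n * n + 1)) by positivity))
      filter_upwards [this] with x hx _
      exact hx
  set Me : ℝ := ∑ p, ‖e p‖ + 1
  set c₄ := c₃ / ((Fintype.card (ι × Fin k) : ℕ) * Me + 1) ^ 2
  have hMe : 0 < Me := by positivity
  have hc₄ : 0 < c₄ := by positivity
  set c₅ := (D⁻¹) ^ 2 / M
  have hc₅ : 0 < c₅ := by positivity
  refine ⟨min c₄ c₅, lt_min hc₄ hc₅, ?_⟩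
  filter_upwards [hev₃, hsep] with x hx₃ hx
  constructor
  · obtain ⟨W, hW, hWc, hWneg⟩ := negOn_span_of_gram hc₃ hx₃ (M := Me) (fun p => by
      rw [T.norm_op]
      have := Finset.single_le_sum (f := fun p => ‖e p‖) (fun _ _ => norm_nonneg _)
        (Finset.mem_univ p.2)
      simp only [Me]
      linarith) hMe
    refine ⟨W, hW, by simpa using hWc, fun w hw => (hWneg w hw).trans ?_⟩
    have : min c₄ c₅ * ‖w‖ ^ 2 ≤ c₄ * ‖w‖ ^ 2 := by gcongr; exact min_le_left _ _
    simp only [c₄] at this ⊢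
    linarith
  · let C' : ι → H →L[ℝ] H := fun i => T.conj (a x i) C
    have hC'sym : ∀ v w, inner ℝ ((∑ i, C' i) v) w = inner ℝ v ((∑ i, C' i) w) := fun v w => by
      simp only [sum_apply, sum_inner, inner_sum]
      exact Finset.sum_congr rfl fun i _ => T.conj_symm hCsym _ _ _
    have hCC : ∀ i j, i ≠ j → ‖C' i ∘L Binv ∘L C' j‖ ≤ c₂ / (2 * (n * n + 1)) := by
      intro i j hij
      have e1 : C' i ∘L Binv ∘L C' j = T.op (a x i) ∘L
          (C ∘L T.op (a x j - a x i) ∘L Binv ∘L C) ∘L T.op (-a x j) := by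
        ext v
        simp only [C', ContinuousLinearMap.comp_apply, T.conj_apply]
        rw [sub_eq_neg_add, T.op_add, hBinvT]
      rw [e1]
      exact ((T.norm_op_comp_le _ _).trans (T.norm_comp_op_le _ _)).trans (hx j i (Ne.symm hij))
    have hbelow : ∀ t ∈ Set.Icc (0 : ℝ) 1, ∀ v, D⁻¹ * ‖v‖ ≤ ‖(B - t • ∑ i, C' i) v‖ := by
      intro t ht v
      have h1 := bounded_below_sub_sum hBB' hBB (C := C') hc₂ ht
        (fun i => bounded_below_of_coercive fun v => by
          rw [hconj]
          refine le_trans (le_of_eq ?_) (hBC t ht _)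
          rw [T.norm_op])
        (fun i => T.norm_conj_le _ _) hCC (by
          rw [div_le_iff₀ hc₂, ← hn]
          -- The smallness required of the interactions was chosen to make this quantity at most `c₂
          -- / 2`; the `+ 1` keeps the denominator positive for every `n`.
          have : n * (n * (c₂ / (2 * (n * n + 1)))) = 1 / 2 * c₂ * (n * n / (n * n + 1)) := by
            field_simp
          rw [this]
          refine mul_le_of_le_one_right (by positivity) ?_
          rw [div_le_one (by positivity)]
          linarith) (norm_nonneg _) (by positivity) v
      rw [inv_mul_le_iff₀ hD]
      refine h1.trans ?_
      gcongr
      simp only [D]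
      linarith
    have hnorm : ‖B‖ + ‖∑ i, C' i‖ ≤ M := by
      have : ‖∑ i, C' i‖ ≤ n * ‖C‖ := by
        refine (norm_sum_le _ _).trans ?_
        refine (Finset.sum_le_sum fun i _ => T.norm_conj_le (a x i) C).trans ?_
        rw [Finset.sum_const, nsmul_eq_mul, hn, Finset.card_univ]
      simp only [M]
      linarith
    have hfin := coercive_sub_of_segment hB hC'sym hBpos (inv_pos.2 hD) hbelow
      (by positivity) hnorm
    refine ⟨⨆ i, Y.map (T.op (a x i) : H →ₗ[ℝ] H), inferInstance, ?_, fun v hv => ?_⟩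
    · exact (finrank_iSup_map_le Y _).trans (Nat.mul_le_mul_left _ (hYk.trans hZk.le))
    -- `S` is symmetric with range in `Y`, so it vanishes on `Yᗮ`. Orthogonally to all translates of
    -- `Y`, the operators built from `K` and from `C = K - S` agree.
    · have h0 : ∀ i, T.conj (a x i) S v = 0 := by
        intro i
        have h1 : ∀ y ∈ Y, inner ℝ y (T.op (-a x i) v) = 0 := fun y hy => by
          rw [← T.inner_op_left]
          exact hv _ (Submodule.mem_iSup_of_mem i (Submodule.mem_map_of_mem hy))
        have h2 : S (T.op (-a x i) v) = 0 := by
          rw [← @inner_self_eq_zero ℝ, hS, real_inner_comm]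
          exact h1 _ (hSY _)
        rw [T.conj_apply, h2, map_zero]
      have e1 : (B - ∑ i, T.conj (a x i) K) v = (B - ∑ i, C' i) v := by
        simp only [sub_apply, sum_apply]
        congr 1
        refine Finset.sum_congr rfl fun i _ => ?_
        have : T.conj (a x i) K v = C' i v + T.conj (a x i) S v := by
          simp only [C', hC, T.conj_apply, sub_apply, map_sub]
          abel
        rw [this, h0, add_zero]
      rw [e1]
      refine le_trans ?_ (hfin v)
      gcongr
      exact min_le_right _ _

end AbstractLinearized

/-! ### The bordered operator and a quantitative inverse function theorem. -/

noncomputable section AbstractNewton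

variable {H : Type*} [NormedAddCommGroup H] [InnerProductSpace ℝ H]

/-- The operator `(v, μ) ↦ (A v - μ g, ⟪g, v⟫)` on `H × ℝ`. -/
def borderedOp (A : H →L[ℝ] H) (g : H) : H × ℝ →L[ℝ] H × ℝ :=
  (A ∘L ContinuousLinearMap.fst ℝ H ℝ - (ContinuousLinearMap.snd ℝ H ℝ).smulRight g).prod
    ((innerSL ℝ g) ∘L ContinuousLinearMap.fst ℝ H ℝ)

theorem borderedOp_apply (A : H →L[ℝ] H) (g : H) (p : H × ℝ) :
    borderedOp A g p = (A p.1 - p.2 • g, inner ℝ g p.1) := rfl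

theorem norm_borderedOp_sub_le (A A' : H →L[ℝ] H) (g g' : H) :
    ‖borderedOp A g - borderedOp A' g'‖ ≤ ‖A - A'‖ + ‖g - g'‖ := by
  refine ContinuousLinearMap.opNorm_le_bound _ (by positivity) fun p => ?_
  have e : (borderedOp A g - borderedOp A' g') p =
      ((A - A') p.1 - p.2 • (g - g'), inner ℝ (g - g') p.1) := by
    simp only [sub_apply, borderedOp_apply, Prod.mk_sub_mk, inner_sub_left, smul_sub]
    congr 1
    abel
  have h1 : ‖p.1‖ ≤ ‖p‖ := norm_fst_le p
  have h2 : ‖p.2‖ ≤ ‖p‖ := norm_snd_le p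
  rw [e, Prod.norm_mk, max_le_iff]
  constructor
  · refine (norm_sub_le _ _).trans ?_
    rw [norm_smul, add_mul, mul_comm ‖p.2‖]
    have := (A - A').le_opNorm p.1
    have h3 : ‖A - A'‖ * ‖p.1‖ ≤ ‖A - A'‖ * ‖p‖ := by gcongr
    have h4 : ‖g - g'‖ * ‖p.2‖ ≤ ‖g - g'‖ * ‖p‖ := by gcongr
    linarith
  · refine (norm_inner_le_norm _ _).trans ?_
    have h3 : ‖g - g'‖ * ‖p.1‖ ≤ ‖g - g'‖ * ‖p‖ := by gcongr
    have : 0 ≤ ‖A - A'‖ * ‖p‖ := by positivity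
    rw [add_mul]
    linarith

/-- Subtracting `μ • z` from `v` removes `g` from the first component, so `w = v - μ • z` is
controlled by the bound for `A`; the second component then recovers `μ` because `⟪g, z⟫` stays away
from zero. The constant depends only on `c`, `σ`, `M`, hence is uniform over the configurations. -/
theorem borderedOp_bounded_below {A : H →L[ℝ] H} {g z : H} {c σ M : ℝ} (hc : 0 < c) (hσ : 0 < σ)
    (hb : ∀ v, c * ‖v‖ ≤ ‖A v‖) (hz : A z = g) (hgz : σ ≤ |inner ℝ g z|) (hg : ‖g‖ ≤ M)
    (hzM : ‖z‖ ≤ M) (p : H × ℝ) :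
    ‖p‖ ≤ (1 / c + (M + 1) * ((1 + M / c) / σ)) * ‖borderedOp A g p‖ := by
  obtain ⟨v, μ⟩ := p
  set r := ‖borderedOp A g (v, μ)‖ with hr
  have hM0 : 0 ≤ M := (norm_nonneg _).trans hg
  have h1 : ‖A v - μ • g‖ ≤ r := norm_fst_le (borderedOp A g (v, μ))
  have h2 : |inner ℝ g v| ≤ r := norm_snd_le (borderedOp A g (v, μ))
  have hr0 : 0 ≤ r := norm_nonneg _
  set w := v - μ • z with hw
  have hAw : A w = A v - μ • g := by rw [hw, map_sub, map_smul, hz]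
  have h3 : ‖w‖ ≤ r / c := by
    rw [le_div_iff₀ hc, mul_comm]
    exact (hb w).trans (by rw [hAw]; exact h1)
  have hv : v = w + μ • z := by rw [hw]; abel
  have h4 : inner ℝ g v = inner ℝ g w + μ * inner ℝ g z := by
    rw [hv, inner_add_right, real_inner_smul_right]
  have h5 : |μ| * σ ≤ (1 + M / c) * r := by
    have h6 : |μ| * |inner ℝ g z| ≤ |inner ℝ g v| + |inner ℝ g w| := by
      rw [← abs_mul]
      have : μ * inner ℝ g z = inner ℝ g v - inner ℝ g w := by rw [h4]; ring
      rw [this]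
      exact abs_sub _ _
    have h7 : |inner ℝ g w| ≤ M * (r / c) :=
      (abs_real_inner_le_norm _ _).trans (mul_le_mul hg h3 (norm_nonneg _) hM0)
    have h8 : |μ| * σ ≤ |μ| * |inner ℝ g z| := by gcongr
    have : (1 + M / c) * r = r + M * (r / c) := by ring
    linarith
  have h6 : |μ| ≤ (1 + M / c) / σ * r := by
    rw [div_mul_eq_mul_div, le_div_iff₀ hσ]; exact h5
  have h7 : ‖v‖ ≤ r / c + M * |μ| := by
    rw [hv]
    refine (norm_add_le _ _).trans (add_le_add h3 ?_)
    rw [norm_smul, mul_comm, Real.norm_eq_abs]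
    gcongr
  have h8 : 0 ≤ |μ| := abs_nonneg μ
  have h9 : (1 / c + (M + 1) * ((1 + M / c) / σ)) * r =
      r / c + (M + 1) * ((1 + M / c) / σ * r) := by ring
  have h10 : (M + 1) * |μ| ≤ (M + 1) * ((1 + M / c) / σ * r) := by gcongr
  have h11 : 0 ≤ r / c := by positivity
  have h12 : 0 ≤ M * |μ| := by positivity
  rw [h9, Prod.norm_mk, max_le_iff, Real.norm_eq_abs]
  constructor <;> linarith

theorem borderedOp_surjective {A : H →L[ℝ] H} {g z : H} (hA : Function.Surjective A)
    (hz : A z = g) (hgz : inner ℝ g z ≠ 0) : Function.Surjective (borderedOp A g) := by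
  rintro ⟨h, s⟩
  obtain ⟨w, hw⟩ := hA h
  refine ⟨(w + ((s - inner ℝ g w) / inner ℝ g z) • z, (s - inner ℝ g w) / inner ℝ g z), ?_⟩
  rw [borderedOp_apply]
  simp only [map_add, map_smul, hz, hw, add_sub_cancel_right, inner_add_right,
    real_inner_smul_right]
  rw [div_mul_cancel₀ _ hgz, add_sub_cancel]

/-- A quantitative inverse function theorem: if `G` is close to an invertible linear map `E` on
a ball, then it has a unique zero in every smaller ball provided it is small at the centre. -/
theorem exists_unique_zero {X : Type*} [NormedAddCommGroup X] [NormedSpace ℝ X] [CompleteSpace X]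
    {G : X → X} {G' : X → X →L[ℝ] X} {E : X →L[ℝ] X} {p₀ : X} {r D : ℝ} (hD : 0 < D)
    (hG : ∀ p ∈ Metric.closedBall p₀ r, HasFDerivAt G (G' p) p)
    (hE : ∀ p, ‖p‖ ≤ D * ‖E p‖) (hsurj : Function.Surjective E)
    (hclose : ∀ p ∈ Metric.closedBall p₀ r, ‖G' p - E‖ ≤ 1 / (2 * D)) {ε : ℝ} (hε : 0 < ε)
    (hεr : ε ≤ r) (h0 : ‖G p₀‖ ≤ ε / (2 * D)) :
    ∃ p ∈ Metric.closedBall p₀ ε, G p = 0 ∧ ∀ q ∈ Metric.closedBall p₀ r, G q = 0 → q = p := by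
  have hlin : ∀ p ∈ Metric.closedBall p₀ r, ∀ q ∈ Metric.closedBall p₀ r,
      ‖G p - G q - E (p - q)‖ ≤ 1 / (2 * D) * ‖p - q‖ := fun p hp q hq =>
    (convex_closedBall p₀ r).norm_image_sub_le_of_norm_hasFDerivWithin_le'
      (fun x hx => (hG x hx).hasFDerivWithinAt) hclose hq hp
  have happ : ApproximatesLinearOn G E (Metric.closedBall p₀ r) (Real.toNNReal (1 / (2 * D))) := by
    intro p hp q hq
    rw [Real.coe_toNNReal _ (by positivity)]
    exact hlin p hp q hq
  let R : E.NonlinearRightInverse :=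
    { toFun := Function.surjInv hsurj
      nnnorm := Real.toNNReal D
      bound' := fun y => by
        rw [Real.coe_toNNReal _ hD.le]
        have := hE (Function.surjInv hsurj y)
        rwa [Function.surjInv_eq hsurj] at this
      right_inv' := Function.surjInv_eq hsurj }
  -- The image covers the ball of radius `(1 / D - 1 / (2 D)) ε = ε / (2 D)` around `G p₀`, which
  -- contains zero by `h0`.
  have hs := happ.surjOn_closedBall_of_nonlinearRightInverse R hε.le
    (Metric.closedBall_subset_closedBall hεr)
  have hR : (R.nnnorm : ℝ) = D := Real.coe_toNNReal _ hD.le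
  obtain ⟨p, hp, hp0⟩ := hs (show (0 : X) ∈ _ by
    rw [Metric.mem_closedBall, dist_zero_left, hR, Real.coe_toNNReal _ (by positivity)]
    refine h0.trans (le_of_eq ?_)
    field_simp
    ring)
  refine ⟨p, hp, hp0, fun q hq hq0 => ?_⟩
  -- At two zeros the linearization error is `-E (q - p)`, so `‖q - p‖` is at most half of itself.
  -- Only membership in the large ball matters, hence uniqueness holds there for every `ε ≤ r`.
  have h1 := hlin q hq p (Metric.closedBall_subset_closedBall hεr hp)
  rw [hp0, hq0, sub_self, zero_sub, norm_neg] at h1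
  have h2 := hE (q - p)
  have h3 : D * ‖E (q - p)‖ ≤ D * (1 / (2 * D) * ‖q - p‖) := by gcongr
  have h4 : D * (1 / (2 * D) * ‖q - p‖) = ‖q - p‖ / 2 := by field_simp
  have h5 : ‖q - p‖ = 0 := by linarith [norm_nonneg (q - p)]
  exact sub_eq_zero.1 (norm_eq_zero.1 h5)

end AbstractNewton

/-! ### Solving the nonlinear problem near sums of translates. -/

noncomputable section AbstractNonlinear

variable {H : Type*} [NormedAddCommGroup H] [InnerProductSpace ℝ H]
variable {Γ : Type*} [AddCommGroup Γ] {l : Filter Γ} {ι : Type*} [Fintype ι]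

/-- The sum of translates `∑ i, T_{a i} v`. -/
def ShiftAction.bump (T : ShiftAction Γ H l) (a : ι → Γ) (v : H) : H := ∑ i, T.op (a i) v

theorem ShiftAction.norm_bump_le (T : ShiftAction Γ H l) (a : ι → Γ) (v : H) :
    ‖T.bump a v‖ ≤ Fintype.card ι * ‖v‖ := by
  refine (norm_sum_le _ _).trans ?_
  simp [T.norm_op]

theorem ShiftAction.apply_bump (T : ShiftAction Γ H l) (a : ι → Γ) {B : H →L[ℝ] H}
    (hB : ∀ b v, B (T.op b v) = T.op b (B v)) (v : H) : B (T.bump a v) = T.bump a (B v) := by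
  simp only [ShiftAction.bump, map_sum, hB]

theorem ShiftAction.tendsto_inner_bump (T : ShiftAction Γ H l) {α : Type*} {m : Filter α}
    {a : α → ι → Γ} (ha : ∀ i j, i ≠ j → Tendsto (fun x => a x i - a x j) m l) (v w : H) :
    Tendsto (fun x => inner ℝ (T.bump (a x) v) (T.bump (a x) w)) m
      (𝓝 (Fintype.card ι * inner ℝ v w)) := by
  classical
  have h1 : ∀ i j, Tendsto (fun x => inner ℝ (T.op (a x i) v) (T.op (a x j) w)) m
      (𝓝 (if i = j then inner ℝ v w else 0)) := by
    intro i j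
    by_cases hij : i = j
    · subst hij
      simp only [if_true, T.inner_op_op]
      exact tendsto_const_nhds
    · rw [if_neg hij]
      refine ((T.mixing_op v w).comp (ha i j hij)).congr fun x => ?_
      simp only [Function.comp_apply]
      rw [← T.inner_op_op (a x j), ← T.op_add, add_sub_cancel]
  have h2 := tendsto_finsetSum Finset.univ fun i _ => tendsto_finsetSum Finset.univ fun j _ => h1 i j
  have e : ∑ i : ι, ∑ j : ι, (if i = j then inner ℝ v w else (0 : ℝ)) =
      Fintype.card ι * inner ℝ v w := by
    simp
  rw [e] at h2
  refine h2.congr fun x => ?_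
  simp only [ShiftAction.bump, sum_inner, inner_sum]
  exact Finset.sum_comm

/-- The `i`-th conjugate of `K` acts as `K` on the `i`-th bump and sees the others as far
translates, on which it tends to zero. -/
theorem ShiftAction.tendsto_sum_conj_bump (T : ShiftAction Γ H l) {α : Type*} {m : Filter α}
    {a : α → ι → Γ} (ha : ∀ i j, i ≠ j → Tendsto (fun x => a x i - a x j) m l) {K : H →L[ℝ] H}
    (hKT : ∀ v, Tendsto (fun b => K (T.op b v)) l (𝓝 0)) (v : H) :
    Tendsto (fun x => (∑ i, T.conj (a x i) K) (T.bump (a x) v) - T.bump (a x) (K v)) m (𝓝 0) := by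
  classical
  have h1 : ∀ i j, Tendsto (fun x => T.conj (a x i) K (T.op (a x j) v) -
      (if i = j then T.op (a x i) (K v) else 0)) m (𝓝 0) := by
    intro i j
    by_cases hij : i = j
    · subst hij
      simp only [if_true, T.conj_apply, T.op_neg_op, sub_self]
      exact tendsto_const_nhds
    · simp only [if_neg hij, sub_zero]
      rw [tendsto_zero_iff_norm_tendsto_zero]
      have := ((hKT v).comp (ha j i (Ne.symm hij))).norm
      rw [norm_zero] at this
      refine this.congr fun x => ?_
      simp only [Function.comp_apply]
      rw [T.conj_apply, T.norm_op, ← T.op_add, neg_add_eq_sub]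
  have h2 := tendsto_finsetSum Finset.univ fun i _ => tendsto_finsetSum Finset.univ fun j _ => h1 i j
  simp only [Finset.sum_const_zero] at h2
  refine h2.congr fun x => ?_
  simp only [Finset.sum_sub_distrib, ShiftAction.bump, map_sum, sum_apply]
  congr 1
  · exact Finset.sum_comm
  · simp

/-- Existence, uniqueness, nondegeneracy and index of normalized multibump solutions of
`B₀ u - N u = μ J u`, `⟪J u, u⟫ = n β`, near the sums of translates of a solution `ubar`. -/
theorem exists_multibump [CompleteSpace H] [l.NeBot] [Nonempty ι] (T : ShiftAction Γ H l)
    {B₀ J : H →L[ℝ] H} {N : H → H} {K : H → H →L[ℝ] H}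
    (hB₀ : ∀ v w, inner ℝ (B₀ v) w = inner ℝ v (B₀ w))
    (hJ : ∀ v w, inner ℝ (J v) w = inner ℝ v (J w))
    (hK : ∀ u v w, inner ℝ (K u v) w = inner ℝ v (K u w))
    (hB₀T : ∀ b v, B₀ (T.op b v) = T.op b (B₀ v)) (hJT : ∀ b v, J (T.op b v) = T.op b (J v))
    (hN : ∀ u, HasFDerivAt N (K u) u)
    (hKuc : ∀ M δ : ℝ, 0 < δ → ∃ η > 0, ∀ u v, ‖u‖ ≤ M → ‖v‖ ≤ η → ‖K (u + v) - K u‖ ≤ δ)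
    {ubar zbar : H} {lbar β : ℝ} (hsol : B₀ ubar - lbar • J ubar - N ubar = 0)
    (hmass : inner ℝ (J ubar) ubar = β)
    (hKT : ∀ v, Tendsto (fun b => K ubar (T.op b v)) l (𝓝 0)) {k : ℕ}
    (hk : formIndex (B₀ - lbar • J - K ubar) ⊤ = k)
    {c₀ : ℝ} (hc₀ : 0 < c₀) (hb : ∀ v, c₀ * ‖v‖ ≤ ‖(B₀ - lbar • J - K ubar) v‖)
    (hz : (B₀ - lbar • J - K ubar) zbar = J ubar) (hσ : inner ℝ (J ubar) zbar ≠ 0)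
    (hdecay : ∀ Binv : H →L[ℝ] H, (∀ v, (B₀ - lbar • J) (Binv v) = v) →
      ∀ c : ℝ, 0 < c → (∀ v, c * ‖v‖ ^ 2 ≤ inner ℝ ((B₀ - lbar • J) v) v) →
        Tendsto (fun b => ‖K ubar ∘L T.op b ∘L Binv ∘L K ubar‖) l (𝓝 0))
    {α : Type*} {m : Filter α} {a : α → ι → Γ}
    (ha : ∀ i j, i ≠ j → Tendsto (fun x => a x i - a x j) m l)
    (hNsplit : Tendsto (fun x => N (T.bump (a x) ubar) - T.bump (a x) (N ubar)) m (𝓝 0))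
    (hKsplit : Tendsto (fun x => K (T.bump (a x) ubar) - ∑ i, T.conj (a x i) (K ubar)) m (𝓝 0)) :
    ∃ ε₀ : ℝ, 0 < ε₀ ∧ ∀ ε : ℝ, 0 < ε → ε ≤ ε₀ → ∀ᶠ x in m, ∃ (u : H) (μ : ℝ),
      (B₀ u - μ • J u - N u = 0 ∧ inner ℝ (J u) u = Fintype.card ι * β ∧
        ‖u - T.bump (a x) ubar‖ ≤ ε ∧ |μ - lbar| ≤ ε) ∧
      (∀ (w : H) (ν : ℝ), B₀ w - ν • J w - N w = 0 → inner ℝ (J w) w = Fintype.card ι * β →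
        ‖w - T.bump (a x) ubar‖ ≤ ε → |ν - lbar| ≤ ε → w = u ∧ ν = μ) ∧
      formIndex (B₀ - μ • J - K u) ⊤ = ((Fintype.card ι * k : ℕ) : ℕ∞) ∧
      (∃ E : H ≃L[ℝ] H, (E : H →L[ℝ] H) = B₀ - μ • J - K u) ∧
      ∃ z, (B₀ - μ • J - K u) z = J u ∧ 0 < inner ℝ (J ubar) zbar * inner ℝ (J u) z := by
  set σ := inner ℝ (J ubar) zbar with hσdef
  set n : ℝ := (Fintype.card ι : ℝ) with hn
  have hn0 : 0 < n := by rw [hn]; exact_mod_cast Fintype.card_pos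
  set B := B₀ - lbar • J with hBdef
  have hsymLin : ∀ t : ℝ, ∀ u v w, inner ℝ ((B₀ - t • J - K u) v) w =
      inner ℝ v ((B₀ - t • J - K u) w) := fun t u v w => by
    simp only [sub_apply, smul_apply, inner_sub_left, inner_sub_right, real_inner_smul_left,
      real_inner_smul_right, hB₀, hJ, hK]
  have hB : ∀ v w, inner ℝ (B v) w = inner ℝ v (B w) := fun v w => by
    simp only [hBdef, sub_apply, smul_apply, inner_sub_left, inner_sub_right, real_inner_smul_left,
      real_inner_smul_right, hB₀, hJ]
  have hBT : ∀ b v, B (T.op b v) = T.op b (B v) := fun b v => by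
    simp only [hBdef, sub_apply, smul_apply, hB₀T, hJT, map_sub, map_smul]
  obtain ⟨c, hc, hsplit⟩ := exists_splitting T hB (hK ubar) hBT hKT hk hc₀ hb hdecay ha
  let s : α → H := fun x => T.bump (a x) ubar
  let z₀ : α → H := fun x => T.bump (a x) zbar
  let A : α → H →L[ℝ] H := fun x => B - ∑ i, T.conj (a x i) (K ubar)
  let A' : α × (H × ℝ) → H →L[ℝ] H := fun p => B₀ - (lbar + p.2.2) • J - K (s p.1 + p.2.1)
  have hs : ∀ x, ‖s x‖ ≤ n * ‖ubar‖ := fun x => T.norm_bump_le (a x) ubar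
  have hz₀ : ∀ x, ‖z₀ x‖ ≤ n * ‖zbar‖ := fun x => T.norm_bump_le (a x) zbar
  -- The product filter expresses statements valid at once for all well separated configurations and
  -- all small displacements from the approximate solution `(s x, lbar)`.
  let m' : Filter (α × (H × ℝ)) := m ×ˢ 𝓝 0
  have hfst : Tendsto (fun p : α × (H × ℝ) => p.1) m' m := tendsto_fst
  have hsnd : Tendsto (fun p : α × (H × ℝ) => p.2) m' (𝓝 0) := tendsto_snd
  have hh : Tendsto (fun p : α × (H × ℝ) => p.2.1) m' (𝓝 0) := by
    exact (continuous_fst.tendsto' (0 : H × ℝ) 0 rfl).comp hsnd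
  have hμ : Tendsto (fun p : α × (H × ℝ) => p.2.2) m' (𝓝 0) := by
    exact (continuous_snd.tendsto' (0 : H × ℝ) 0 rfl).comp hsnd
  have hAA : Tendsto (fun p => A' p - A p.1) m' (𝓝 0) := by
    have h1 : Tendsto (fun p : α × (H × ℝ) => K (s p.1 + p.2.1) - K (s p.1)) m' (𝓝 0) := by
      rw [tendsto_zero_iff_norm_tendsto_zero, Metric.tendsto_nhds]
      intro δ hδ
      obtain ⟨η, hη, hKη⟩ := hKuc (n * ‖ubar‖) (δ / 2) (by positivity)
      have h0 := hh.norm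
      rw [norm_zero] at h0
      filter_upwards [h0.eventually (ge_mem_nhds hη)] with p hp
      rw [dist_zero_right, norm_norm]
      exact (hKη _ _ (hs p.1) hp).trans_lt (by linarith)
    have h2 : Tendsto (fun p : α × (H × ℝ) => p.2.2 • J) m' (𝓝 0) := by
      simpa using hμ.smul_const J
    have h3 := ((h2.neg).sub h1).sub (hKsplit.comp hfst)
    simp only [neg_zero, sub_zero] at h3
    refine h3.congr fun p => ?_
    simp only [A', A, hBdef, Function.comp_apply, s, add_smul]
    abel
  have hA'sym : ∀ p v w, inner ℝ (A' p v) w = inner ℝ v (A' p w) := fun p v w => hsymLin _ _ v w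
  -- stable consequences of the splitting
  have hev₁ : ∀ᶠ p in m', (∀ v, c / 4 * ‖v‖ ≤ ‖A' p v‖) ∧
      formIndex (A' p) ⊤ = ((Fintype.card ι * k : ℕ) : ℕ∞) := by
    have h0 := hAA.norm
    rw [norm_zero] at h0
    filter_upwards [h0.eventually (ge_mem_nhds (show 0 < c / 2 by positivity)),
      hfst.eventually hsplit] with p hp hp'
    obtain ⟨⟨W, hW, hWk, hWneg⟩, ⟨Y, hY, hYk, hYpos⟩⟩ := hp'
    have hdiff : ∀ v, |inner ℝ (A' p v) v - inner ℝ (A p.1 v) v| ≤ c / 2 * ‖v‖ ^ 2 := fun v => by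
      rw [← inner_sub_left, ← sub_apply]
      refine (abs_inner_apply_le _ v v).trans ?_
      rw [mul_assoc, ← sq]
      gcongr
    have hW' : ∀ w ∈ W, inner ℝ (A' p w) w ≤ -(c / 2) * ‖w‖ ^ 2 := fun w hw => by
      have h1 := hWneg w hw
      have h2 := (abs_le.1 (hdiff w)).2
      simp only [A] at h2
      linarith
    have hY' : ∀ v, (∀ y ∈ Y, inner ℝ y v = 0) → c / 2 * ‖v‖ ^ 2 ≤ inner ℝ (A' p v) v :=
      fun v hv => by
        have h1 := hYpos v hv
        have h2 := (abs_le.1 (hdiff v)).1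
        simp only [A] at h2
        linarith
    constructor
    · intro v
      have := bounded_below_of_splitting (hA'sym p) (hYk.trans hWk.ge)
        (show 0 < c / 2 by positivity) hW' hY' v
      linarith
    · refine formIndex_eq_of_negOn_of_coercive hWk (fun w hw hw0 => (hW' w hw).trans_lt ?_) hYk
        fun v hv => le_trans (by positivity) (hY' v hv)
      have : 0 < ‖w‖ := norm_pos_iff.2 hw0
      rw [neg_mul, neg_lt_zero]
      positivity
  -- the solution of the linearized equation
  have hres : Tendsto (fun p : α × (H × ℝ) => J (s p.1 + p.2.1) - A' p (z₀ p.1)) m' (𝓝 0) := by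
    have h1 : Tendsto (fun p : α × (H × ℝ) => J p.2.1) m' (𝓝 0) := by
      exact (J.continuous.tendsto' 0 0 (map_zero J)).comp hh
    have h2 : Tendsto (fun p : α × (H × ℝ) => (A' p - A p.1) (z₀ p.1)) m' (𝓝 0) := by
      have h0 := hAA.norm
      rw [norm_zero] at h0
      refine squeeze_zero_norm (a := fun p => ‖A' p - A p.1‖ * (n * ‖zbar‖)) (fun p => ?_) ?_
      · exact ((A' p - A p.1).le_opNorm _).trans (by gcongr; exact hz₀ _)
      · simpa using h0.mul_const (n * ‖zbar‖)
    have h3 := (T.tendsto_sum_conj_bump ha hKT zbar).comp hfst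
    have h4 := (h1.sub h2).add h3
    simp only [sub_zero, add_zero] at h4
    refine h4.congr fun p => ?_
    have e1 : J (s p.1) = B (z₀ p.1) - T.bump (a p.1) (K ubar zbar) := by
      simp only [s, z₀]
      rw [T.apply_bump _ hJT, T.apply_bump _ hBT, ← hz]
      simp only [ShiftAction.bump, sub_apply, map_sub, Finset.sum_sub_distrib, hBdef]
    simp only [Function.comp_apply, sub_apply, A, map_add, e1, z₀]
    abel
  have hev₂ : ∀ᶠ p in m', ∀ z, A' p z = J (s p.1 + p.2.1) →
      |inner ℝ (J (s p.1 + p.2.1)) z - n * σ| ≤ n * |σ| / 2 ∧ ‖z‖ ≤ n * ‖zbar‖ + 1 := by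
    -- Uniform invertibility of `A'` turns the vanishing residual `hres` into closeness of any
    -- solution `z` to the sum of translates of `zbar`; the pairing is then near `n σ` and keeps its
    -- sign.
    let r : α × (H × ℝ) → ℝ := fun p => 4 / c * ‖J (s p.1 + p.2.1) - A' p (z₀ p.1)‖
    have hr : Tendsto r m' (𝓝 0) := by simpa [r] using hres.norm.const_mul (4 / c)
    let g : α × (H × ℝ) → ℝ := fun p => ‖J p.2.1‖ * (n * ‖zbar‖ + r p) +
      ‖J‖ * (n * ‖ubar‖) * r p + |inner ℝ (T.bump (a p.1) (J ubar)) (z₀ p.1) - n * σ|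
    have hg : Tendsto g m' (𝓝 0) := by
      have h1 : Tendsto (fun p : α × (H × ℝ) => J p.2.1) m' (𝓝 0) := by
        exact (J.continuous.tendsto' 0 0 (map_zero J)).comp hh
      have h2 : Tendsto (fun p : α × (H × ℝ) =>
          inner ℝ (T.bump (a p.1) (J ubar)) (z₀ p.1) - n * σ) m' (𝓝 0) := by
        have := ((T.tendsto_inner_bump ha (J ubar) zbar).comp hfst).sub_const (n * σ)
        rwa [sub_self] at this
      have h3 := ((h1.norm.mul (hr.const_add (n * ‖zbar‖))).add
        (hr.const_mul (‖J‖ * (n * ‖ubar‖)))).add h2.abs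
      simpa [g] using h3
    have hσ' : 0 < n * |σ| / 2 := by positivity
    filter_upwards [hev₁, hg.eventually (ge_mem_nhds hσ'), hr.eventually (ge_mem_nhds one_pos)]
      with p hp hgp hrp z hzp
    have h1 : ‖z - z₀ p.1‖ ≤ r p := by
      have := hp.1 (z - z₀ p.1)
      rw [map_sub, hzp] at this
      have e : r p = ‖J (s p.1 + p.2.1) - A' p (z₀ p.1)‖ / (c / 4) := by
        simp only [r]; field_simp
      rw [e, le_div_iff₀ (by positivity), mul_comm]
      exact this
    have h2 : ‖z‖ ≤ n * ‖zbar‖ + r p := by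
      have : z = z₀ p.1 + (z - z₀ p.1) := by abel
      rw [this]
      exact (norm_add_le _ _).trans (add_le_add (hz₀ _) h1)
    refine ⟨?_, h2.trans (by linarith)⟩
    have e : inner ℝ (J (s p.1 + p.2.1)) z - n * σ = inner ℝ (J p.2.1) z +
        inner ℝ (J (s p.1)) (z - z₀ p.1) +
        (inner ℝ (T.bump (a p.1) (J ubar)) (z₀ p.1) - n * σ) := by
      rw [← T.apply_bump _ hJT]
      simp only [map_add, inner_add_left, inner_sub_right, s]
      ring
    rw [e]
    refine (abs_add_three _ _ _).trans (le_trans ?_ hgp)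
    simp only [g]
    gcongr
    · exact (abs_real_inner_le_norm _ _).trans (by gcongr)
    · refine (abs_inner_apply_le _ _ _).trans ?_
      gcongr
      exact hs _
  -- the centre
  let D := 1 / (c / 4) + ((‖J‖ * (n * ‖ubar‖) + (n * ‖zbar‖ + 1)) + 1) *
    ((1 + (‖J‖ * (n * ‖ubar‖) + (n * ‖zbar‖ + 1)) / (c / 4)) / (n * |σ| / 2))
  have hD : 0 < D := by
    have : 0 < n * |σ| / 2 := by positivity
    positivity
  have hcen : Tendsto (fun p : α × (H × ℝ) => ((p.1, 0) : α × (H × ℝ))) m' m' :=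
    hfst.prodMk (tendsto_const_nhds)
  have hev₃ : ∀ᶠ p in m', ‖A' p - A' (p.1, 0)‖ + ‖J p.2.1‖ ≤ 1 / (2 * D) := by
    have h1 : Tendsto (fun p : α × (H × ℝ) => J p.2.1) m' (𝓝 0) := by
      exact (J.continuous.tendsto' 0 0 (map_zero J)).comp hh
    have h2 := ((hAA.sub (hAA.comp hcen)).norm.add h1.norm)
    simp only [sub_zero, norm_zero, add_zero] at h2
    have h3 : (0 : ℝ) < 1 / (2 * D) := by positivity
    filter_upwards [h2.eventually (ge_mem_nhds h3)] with p hp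
    have e : A' p - A p.1 - ((fun p => A' p - A p.1) ∘ fun p => (p.1, 0)) p =
        A' p - A' (p.1, 0) := by
      simp only [Function.comp_apply]; abel
    rwa [e] at hp
  -- The centre `(p.1, 0)` is included because the model operator of the inverse function theorem is
  -- the derivative there.
  have hall := (hev₁.and (hev₂.and hev₃)).and (hcen.eventually (hev₁.and hev₂))
  -- Splitting the product filter yields a neighbourhood `Q` of displacements independent of the
  -- configuration. This is why `ε₀` can be fixed before the separation threshold.
  obtain ⟨P, hP, Q, hQ, hPQ⟩ := eventually_prod_iff.1 hall
  obtain ⟨ε₀, hε₀, hball⟩ := Metric.nhds_basis_closedBall.eventually_iff.1 hQ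
  refine ⟨ε₀, hε₀, fun ε hε hεε₀ => ?_⟩
  -- The factor `2⁻¹` makes the second component of the derivative exactly `⟪J u, ·⟫`, as in
  -- `borderedOp`.
  let G : H × ℝ → H × ℝ := fun p =>
    (B₀ p.1 - p.2 • J p.1 - N p.1, (inner ℝ (J p.1) p.1 - n * β) * (2 : ℝ)⁻¹)
  have hG : ∀ p, HasFDerivAt G (borderedOp (B₀ - p.2 • J - K p.1) (J p.1)) p := by
    intro p
    have h1 : HasFDerivAt (fun p : H × ℝ => p.1) (ContinuousLinearMap.fst ℝ H ℝ) p :=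
      hasFDerivAt_fst
    have h2 : HasFDerivAt (fun p : H × ℝ => p.2) (ContinuousLinearMap.snd ℝ H ℝ) p :=
      hasFDerivAt_snd
    have hB1 := B₀.hasFDerivAt.comp p h1
    have hJ1 := J.hasFDerivAt.comp p h1
    have hN1 := (hN p.1).comp p h1
    have hq := ((hJ1.inner ℝ h1).sub_const (n * β)).mul_const ((2 : ℝ)⁻¹)
    have hfull := ((hB1.sub (h2.smul hJ1)).sub hN1).prodMk hq
    refine HasFDerivAt.congr_fderiv hfull (ContinuousLinearMap.ext fun q => ?_)
    have e : inner ℝ (J q.1) p.1 = inner ℝ (J p.1) q.1 := by rw [hJ, real_inner_comm]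
    rw [borderedOp_apply]
    refine Prod.ext ?_ ?_
    · simp
      abel
    · simp [e]
      ring
  have hG0 : Tendsto (fun x => ‖G (s x, lbar)‖) m (𝓝 0) := by
    have h1 : Tendsto (fun x => B₀ (s x) - lbar • J (s x) - N (s x)) m (𝓝 0) := by
      have h2 := hNsplit.neg
      rw [neg_zero] at h2
      refine h2.congr fun x => ?_
      have h3 : B (s x) = T.bump (a x) (N ubar) := by
        have : B ubar = N ubar := by
          rw [← sub_eq_zero, ← hsol]
          simp [hBdef]
        rw [← this]
        exact T.apply_bump _ hBT _
      have h4 : B (s x) = B₀ (s x) - lbar • J (s x) := by simp [hBdef]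
      rw [← h4, h3]
      simp only [s]
      abel
    have h2 : Tendsto (fun x => (inner ℝ (J (s x)) (s x) - n * β) / 2) m (𝓝 0) := by
      have h3 := ((T.tendsto_inner_bump ha (J ubar) ubar).sub_const (n * β)).div_const 2
      rw [hmass, sub_self, zero_div] at h3
      refine h3.congr fun x => ?_
      simp only [s]
      rw [T.apply_bump _ hJT]
    have h3 := (h1.prodMk_nhds h2).norm
    rw [Prod.mk_zero_zero, norm_zero] at h3
    refine h3.congr fun x => ?_
    simp only [G, div_eq_mul_inv]
  filter_upwards [hP, hG0.eventually (ge_mem_nhds (show 0 < ε / (2 * D) by positivity))]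
    with x hx hx0
  have hkey : ∀ (u : H) (μ : ℝ), (u, μ) ∈ Metric.closedBall (s x, lbar) ε₀ →
      Q (u - s x, μ - lbar) := by
    intro u μ hu
    refine hball (x := (u - s x, μ - lbar)) ?_
    rw [Metric.mem_closedBall, dist_eq_norm] at hu ⊢
    simpa using hu
  have hA'eq : ∀ (u : H) (μ : ℝ), A' (x, (u - s x, μ - lbar)) = B₀ - μ • J - K u := by
    intro u μ
    simp only [A', add_sub_cancel]
  have hcentre := hPQ hx (hkey (s x) lbar (Metric.mem_closedBall_self hε₀.le))
  have hA'0 : A' (x, 0) = B₀ - lbar • J - K (s x) := by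
    simp only [A', Prod.snd_zero, Prod.fst_zero, add_zero]
  obtain ⟨-, ⟨hc1, hc2⟩, hc3⟩ := hcentre
  simp only [Prod.fst_zero, add_zero] at hc3
  obtain ⟨E₀, hE₀⟩ := exists_continuousLinearEquiv_of_bounded_below (hA'sym (x, 0))
    (show 0 < c / 4 by positivity) hc1
  obtain ⟨z, hz'⟩ : ∃ z, A' (x, 0) z = J (s x) := ⟨E₀.symm (J (s x)), by rw [← hE₀]; simp⟩
  obtain ⟨hz1, hz2⟩ := hc3 z hz'
  have habs : n * |σ| / 2 ≤ |inner ℝ (J (s x)) z| := by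
    have h1 : |n * σ| = n * |σ| := by rw [abs_mul, abs_of_pos hn0]
    have h2 := abs_sub_abs_le_abs_sub (n * σ) (inner ℝ (J (s x)) z)
    rw [abs_sub_comm] at h2
    linarith
  have hJs : ‖J (s x)‖ ≤ ‖J‖ * (n * ‖ubar‖) :=
    (J.le_opNorm _).trans (by gcongr; exact hs x)
  have hσ2 : 0 < n * |σ| / 2 := by positivity
  obtain ⟨⟨u, μ⟩, hpε, hp0, hpuniq⟩ := exists_unique_zero (p₀ := (s x, lbar)) (r := ε₀) hD
    (fun p _ => hG p)
    (borderedOp_bounded_below (A := A' (x, 0)) (g := J (s x)) (z := z) (σ := n * |σ| / 2)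
      (M := ‖J‖ * (n * ‖ubar‖) + (n * ‖zbar‖ + 1)) (show 0 < c / 4 by positivity)
      hσ2 hc1 hz' habs (hJs.trans (by linarith [norm_nonneg z]))
      (hz2.trans (by linarith [norm_nonneg (J (s x))])))
    (borderedOp_surjective (fun y => ⟨E₀.symm y, by rw [← hE₀]; simp⟩) hz'
      (fun h => by rw [h, abs_zero] at habs; linarith))
    (fun p hp => by
      have h1 := (hPQ hx (hkey p.1 p.2 hp)).1.2.2
      simp only [hA'eq] at h1
      refine (norm_borderedOp_sub_le _ _ _ _).trans ?_
      rw [← map_sub]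
      exact h1) hε hεε₀ hx0
  have hsolve : ∀ (w : H) (ν : ℝ), G (w, ν) = 0 ↔
      (B₀ w - ν • J w - N w = 0 ∧ inner ℝ (J w) w = n * β) := by
    intro w ν
    simp only [G, Prod.mk_eq_zero]
    refine and_congr_right fun _ => ?_
    constructor
    · intro h; linarith
    · intro h; rw [h]; simp
  have hmem : ∀ (w : H) (ν : ℝ) (r : ℝ), (w, ν) ∈ Metric.closedBall (s x, lbar) r ↔
      (‖w - T.bump (a x) ubar‖ ≤ r ∧ |ν - lbar| ≤ r) := by
    intro w ν r
    rw [Metric.mem_closedBall, dist_eq_norm, Prod.mk_sub_mk, Prod.norm_mk, max_le_iff,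
      Real.norm_eq_abs]
  have hu₀ : (u, μ) ∈ Metric.closedBall (s x, lbar) ε₀ :=
    Metric.closedBall_subset_closedBall hεε₀ hpε
  obtain ⟨⟨⟨hb1, hb2⟩, hb3, -⟩, -⟩ := hPQ hx (hkey u μ hu₀)
  simp only [hA'eq, add_sub_cancel] at hb1 hb2 hb3
  obtain ⟨E, hE⟩ := exists_continuousLinearEquiv_of_bounded_below (hsymLin μ u)
    (show 0 < c / 4 by positivity) hb1
  refine ⟨u, μ, ?_, fun w ν h1 h2 h3 h4 => ?_, hb2, ⟨E, hE⟩, E.symm (J u), ?_, ?_⟩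
  · obtain ⟨h1, h2⟩ := (hsolve u μ).1 hp0
    obtain ⟨h3, h4⟩ := (hmem u μ ε).1 hpε
    exact ⟨h1, h2, h3, h4⟩
  · have := hpuniq (w, ν) ((hmem w ν ε₀).2 ⟨h3.trans hεε₀, h4.trans hεε₀⟩)
      ((hsolve w ν).2 ⟨h1, h2⟩)
    exact Prod.mk_inj.1 this
  · rw [← hE]; simp
  · have h1 := (hb3 (E.symm (J u)) (by rw [← hE]; simp)).1
    have h2 := abs_le.1 h1
    set y := inner ℝ (J u) (E.symm (J u))
    rcases lt_or_gt_of_ne hσ with h | h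
    · rw [abs_of_neg h] at h2
      have : y < 0 := by nlinarith
      exact mul_pos_of_neg_of_neg h this
    · rw [abs_of_pos h] at h2
      have : 0 < y := by nlinarith
      exact mul_pos h this

end AbstractNonlinear

/-! ### The Sobolev space: completeness, translations, products. -/

noncomputable section SobolevSpace

variable {N : ℕ}

namespace H1

theorem memLp_toL2 (u : H1 N) : MemLp (toL2 N u) 2 volume := Lp.memLp _

theorem memLp_grad (u : H1 N) : MemLp (grad N u) 2 volume := Lp.memLp _

theorem isWeakGradient (u : H1 N) : IsWeakGradient (toL2 N u) (grad N u) := u.2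

theorem inner_eq (u v : H1 N) :
    inner ℝ u v = inner ℝ (toL2 N u) (toL2 N v) + inner ℝ (grad N u) (grad N v) :=
  WithLp.prod_inner_apply u.1 v.1

theorem norm_sq_eq (u : H1 N) : ‖u‖ ^ 2 = ‖toL2 N u‖ ^ 2 + ‖grad N u‖ ^ 2 :=
  WithLp.prod_norm_sq_eq_of_L2 u.1

theorem norm_toL2_le (u : H1 N) : ‖toL2 N u‖ ≤ ‖u‖ := by
  have := norm_sq_eq u
  exact le_of_sq_le_sq (by nlinarith [sq_nonneg ‖grad N u‖]) (norm_nonneg _)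

theorem norm_grad_le (u : H1 N) : ‖grad N u‖ ≤ ‖u‖ := by
  have := norm_sq_eq u
  exact le_of_sq_le_sq (by nlinarith [sq_nonneg ‖toL2 N u‖]) (norm_nonneg _)

theorem ext_of_eq {u v : H1 N} (h : toL2 N u = toL2 N v) (h' : grad N u = grad N v) : u = v :=
  Subtype.ext (WithLp.ofLp_injective 2 (Prod.ext h h'))

/-- The element of `H1` with a given function and a given weak gradient. -/
def ofWeakGradient (u : RN N → ℝ) (G : RN N → RN N) (hu : MemLp u 2 volume)
    (hG : MemLp G 2 volume) (h : IsWeakGradient u G) : H1 N :=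
  ⟨WithLp.toLp 2 (hu.toLp u, hG.toLp G), h.congr hu.coeFn_toLp hG.coeFn_toLp⟩

theorem toL2_ofWeakGradient {u : RN N → ℝ} {G : RN N → RN N} (hu : MemLp u 2 volume)
    (hG : MemLp G 2 volume) (h : IsWeakGradient u G) :
    toL2 N (ofWeakGradient u G hu hG h) =ᵐ[volume] u := hu.coeFn_toLp

theorem grad_ofWeakGradient {u : RN N → ℝ} {G : RN N → RN N} (hu : MemLp u 2 volume)
    (hG : MemLp G 2 volume) (h : IsWeakGradient u G) :
    grad N (ofWeakGradient u G hu hG h) =ᵐ[volume] G := hG.coeFn_toLp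

theorem integral_toL2_mul (u : Lp ℝ 2 (volume : Measure (RN N))) {g : RN N → ℝ}
    (hg : MemLp g 2 volume) : ∫ x, u x * g x = inner ℝ (hg.toLp g) u := by
  rw [L2.inner_def]
  refine integral_congr_ae ?_
  filter_upwards [hg.coeFn_toLp] with x hx
  rw [hx]; rfl

theorem memLp_smul_const {φ : RN N → ℝ} (hφ : MemLp φ 2 volume) (y : RN N) :
    MemLp (fun x => φ x • y) 2 volume := by
  refine MemLp.of_le_mul (c := ‖y‖) hφ (hφ.aestronglyMeasurable.smul_const y) ?_
  filter_upwards with x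
  rw [norm_smul, mul_comm]

theorem integral_inner_mul (G : Lp (RN N) 2 (volume : Measure (RN N))) {φ : RN N → ℝ}
    (hφ : MemLp φ 2 volume) (y : RN N) :
    ∫ x, inner ℝ (G x) y * φ x = inner ℝ ((memLp_smul_const hφ y).toLp _) G := by
  rw [L2.inner_def]
  refine integral_congr_ae ?_
  filter_upwards [(memLp_smul_const hφ y).coeFn_toLp] with x hx
  rw [hx, real_inner_smul_left, real_inner_comm, mul_comm]

theorem memLp_test {φ : RN N → ℝ} (hφ : ContDiff ℝ ∞ φ) (hc : HasCompactSupport φ) :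
    MemLp φ 2 volume := hφ.continuous.memLp_of_hasCompactSupport hc

theorem memLp_fderiv_test {φ : RN N → ℝ} (hφ : ContDiff ℝ ∞ φ) (hc : HasCompactSupport φ)
    (y : RN N) : MemLp (fun x => fderiv ℝ φ x y) 2 volume :=
  ((hφ.continuous_fderiv (by simp)).clm_apply continuous_const).memLp_of_hasCompactSupport
    (hc.fderiv_apply (𝕜 := ℝ) y)

/-- For a fixed test function and direction, the identity defining the weak gradient equates two
continuous functionals, so the space is an intersection of closed sets. -/
theorem isClosed : IsClosed (H1 N : Set (WithLp 2
    (Lp ℝ 2 (volume : Measure (RN N)) × Lp (RN N) 2 (volume : Measure (RN N))))) := by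
  have : (H1 N : Set (WithLp 2
      (Lp ℝ 2 (volume : Measure (RN N)) × Lp (RN N) 2 (volume : Measure (RN N))))) =
      ⋂ (φ : RN N → ℝ) (hφ : ContDiff ℝ ∞ φ) (hc : HasCompactSupport φ) (y : RN N),
        {p | inner ℝ ((memLp_fderiv_test hφ hc y).toLp _) p.fst =
          -inner ℝ ((memLp_smul_const (memLp_test hφ hc) y).toLp _) p.snd} := by
    ext p
    simp only [Set.mem_iInter, Set.mem_ofPred_eq]
    refine forall_congr' fun φ => forall_congr' fun hφ => forall_congr' fun hc =>
      forall_congr' fun y => ?_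
    rw [← integral_toL2_mul, ← integral_inner_mul p.snd (memLp_test hφ hc)]
  rw [this]
  refine isClosed_iInter fun φ => isClosed_iInter fun hφ => isClosed_iInter fun hc =>
    isClosed_iInter fun y => isClosed_eq ?_ ?_
  · exact continuous_const.inner (WithLp.fstL 2 ℝ _ _).continuous
  · exact (continuous_const.inner (WithLp.sndL 2 ℝ _ _).continuous).neg

instance : CompleteSpace (H1 N) := isClosed.completeSpace_coe

/-- The weak gradient is unique. -/
theorem toL2_injective : Function.Injective (toL2 N) := by
  refine (injective_iff_map_eq_zero _).2 fun u hu => ?_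
  have hG : grad N u = 0 := by
    refine Lp.ext ?_
    have hloc : LocallyIntegrable (grad N u) volume :=
      (memLp_grad u).locallyIntegrable (by norm_num)
    have h0 : ∀ᵐ x, (grad N u) x = 0 := by
      have h1 : ∀ y : RN N, ∀ᵐ x, inner ℝ (grad N u x) y = 0 := by
        intro y
        refine ae_eq_zero_of_integral_contDiff_smul_eq_zero
          (((memLp_grad u).inner_const y).locallyIntegrable (by norm_num)) fun φ hφ hc => ?_
        have h2 := isWeakGradient u φ hφ hc y
        rw [hu] at h2
        have h3 : ∫ x, (0 : Lp ℝ 2 (volume : Measure (RN N))) x * fderiv ℝ φ x y = 0 := by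
          rw [integral_toL2_mul _ (memLp_fderiv_test hφ hc y)]; simp
        rw [h3] at h2
        simp only [smul_eq_mul]
        rw [← neg_eq_zero, ← h2.symm.trans rfl]
        simp only [mul_comm]
      have h2 : ∀ᵐ x, ∀ i : Fin N, inner ℝ (grad N u x) (EuclideanSpace.single i (1 : ℝ)) = 0 :=
        ae_all_iff.2 fun i => h1 _
      filter_upwards [h2] with x hx
      ext i
      simpa [EuclideanSpace.inner_single_right] using hx i
    filter_upwards [h0, Lp.coeFn_zero (RN N) 2 (volume : Measure (RN N))] with x hx hx'
    rw [hx, hx']; rfl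
  exact ext_of_eq (by simpa using hu) (by simpa using hG)

theorem shift_toL2_ae (b : RN N) (u : H1 N) :
    toL2 N (shift b u) =ᵐ[volume] fun x => toL2 N u (x - b) :=
  Lp.coeFn_compMeasurePreserving _ (measurePreserving_sub_right volume b)

theorem shift_grad_ae (b : RN N) (u : H1 N) :
    grad N (shift b u) =ᵐ[volume] fun x => grad N u (x - b) :=
  Lp.coeFn_compMeasurePreserving _ (measurePreserving_sub_right volume b)

/-- Translation by `b` as a linear isometry of `H1`. -/
def shiftIso (b : RN N) : H1 N →ₗᵢ[ℝ] H1 N where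
  toFun := shift b
  map_add' u v := ext_of_eq
    (map_add (Lp.compMeasurePreservingₗᵢ ℝ (p := 2) (E := ℝ) (fun x : RN N => x - b)
      (measurePreserving_sub_right volume b)) (toL2 N u) (toL2 N v))
    (map_add (Lp.compMeasurePreservingₗᵢ ℝ (p := 2) (E := RN N) (fun x : RN N => x - b)
      (measurePreserving_sub_right volume b)) (grad N u) (grad N v))
  map_smul' c u := ext_of_eq
    (map_smul (Lp.compMeasurePreservingₗᵢ ℝ (p := 2) (E := ℝ) (fun x : RN N => x - b)
      (measurePreserving_sub_right volume b)) c (toL2 N u))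
    (map_smul (Lp.compMeasurePreservingₗᵢ ℝ (p := 2) (E := RN N) (fun x : RN N => x - b)
      (measurePreserving_sub_right volume b)) c (grad N u))
  norm_map' u := by
    have h1 : ‖toL2 N (shift b u)‖ = ‖toL2 N u‖ :=
      Lp.norm_compMeasurePreserving _ (measurePreserving_sub_right volume b)
    have h2 : ‖grad N (shift b u)‖ = ‖grad N u‖ :=
      Lp.norm_compMeasurePreserving _ (measurePreserving_sub_right volume b)
    have h3 : ‖shift b u‖ ^ 2 = ‖u‖ ^ 2 := by rw [norm_sq_eq, norm_sq_eq, h1, h2]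
    exact (pow_left_inj₀ (norm_nonneg _) (norm_nonneg _) two_ne_zero).1 h3

theorem ae_sub_right {p : RN N → Prop} (h : ∀ᵐ x, p x) (b : RN N) : ∀ᵐ x, p (x - b) :=
  (measurePreserving_sub_right volume b).quasiMeasurePreserving.ae h

theorem shift_zero (u : H1 N) : shift 0 u = u := by
  refine toL2_injective (Lp.ext ?_)
  filter_upwards [shift_toL2_ae 0 u] with x hx
  rw [hx, sub_zero]

theorem shift_add (b b' : RN N) (u : H1 N) : shift (b + b') u = shift b (shift b' u) := by
  refine toL2_injective (Lp.ext ?_)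
  filter_upwards [shift_toL2_ae (b + b') u, shift_toL2_ae b (shift b' u),
    ae_sub_right (shift_toL2_ae b' u) b] with x h1 h2 h3
  rw [h1, h2, h3, sub_sub]

/-- Translation is strongly continuous in `L²`, for the function and for its gradient. Mollification
thereby becomes a vector-valued integral in `H1 N`. -/
theorem continuous_shift (u : H1 N) : Continuous fun b => shift b u := by
  have hg : Continuous fun b : RN N => (ContinuousMap.mk (fun x : RN N => x - b) (by fun_prop)) := by
    refine ContinuousMap.continuous_of_continuous_uncurry _ ?_
    exact continuous_snd.sub continuous_fst
  have h1 : Continuous fun b => toL2 N (shift b u) :=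
    (continuous_const (y := toL2 N u)).compMeasurePreservingLp hg
      (fun b => measurePreserving_sub_right volume b) (by simp)
  have h2 : Continuous fun b => grad N (shift b u) :=
    (continuous_const (y := grad N u)).compMeasurePreservingLp hg
      (fun b => measurePreserving_sub_right volume b) (by simp)
  refine Continuous.subtype_mk (f := fun b => (shift b u).1) ?_ fun b => (shift b u).2
  exact (WithLp.prod_continuous_toLp 2 _ _).comp (h1.prodMk h2)

theorem isWeakGradient_of_contDiff {φ : RN N → ℝ} (hφ : ContDiff ℝ ∞ φ) :
    IsWeakGradient φ (fun x => gradient φ x) := by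
  intro ψ hψ hc y
  have hd : ∀ x, inner ℝ (gradient φ x) y = fderiv ℝ φ x y := fun x => by
    simp [gradient]
  simp only [hd]
  have hcψ : Continuous fun x => fderiv ℝ ψ x y :=
    (hψ.continuous_fderiv (by simp)).clm_apply continuous_const
  have hcφ : Continuous fun x => fderiv ℝ φ x y :=
    (hφ.continuous_fderiv (by simp)).clm_apply continuous_const
  refine integral_mul_fderiv_eq_neg_fderiv_mul_of_integrable ?_ ?_ ?_ ?_ ?_
  · exact (hcφ.mul hψ.continuous).integrable_of_hasCompactSupport hc.mul_left
  · exact (hφ.continuous.mul hcψ).integrable_of_hasCompactSupport (hc.fderiv_apply (𝕜 := ℝ) y).mul_left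
  · exact (hφ.continuous.mul hψ.continuous).integrable_of_hasCompactSupport hc.mul_left
  · exact fun x _ => (hφ.differentiable (by simp)).differentiableAt
  · exact fun x _ => (hψ.differentiable (by simp)).differentiableAt

theorem norm_gradient (φ : RN N → ℝ) (x : RN N) : ‖gradient φ x‖ = ‖fderiv ℝ φ x‖ := by
  simp [gradient]

theorem continuous_gradient {φ : RN N → ℝ} (hφ : ContDiff ℝ ∞ φ) : Continuous (gradient φ) :=
  (InnerProductSpace.toDual ℝ (RN N)).symm.continuous.comp (hφ.continuous_fderiv (by simp))

theorem hasCompactSupport_gradient {φ : RN N → ℝ} (hc : HasCompactSupport φ) :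
    HasCompactSupport (gradient φ) :=
  (hc.fderiv (𝕜 := ℝ)).comp_left (map_zero _)

/-- A test function as an element of `H1`. -/
def ofTest (φ : RN N → ℝ) (hφ : ContDiff ℝ ∞ φ) (hc : HasCompactSupport φ) : H1 N :=
  ofWeakGradient φ (gradient φ) (memLp_test hφ hc)
    ((continuous_gradient hφ).memLp_of_hasCompactSupport (hasCompactSupport_gradient hc))
    (isWeakGradient_of_contDiff hφ)

theorem toL2_ofTest {φ : RN N → ℝ} (hφ : ContDiff ℝ ∞ φ) (hc : HasCompactSupport φ) :
    toL2 N (ofTest φ hφ hc) =ᵐ[volume] φ := toL2_ofWeakGradient _ _ _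

theorem grad_ofTest {φ : RN N → ℝ} (hφ : ContDiff ℝ ∞ φ) (hc : HasCompactSupport φ) :
    grad N (ofTest φ hφ hc) =ᵐ[volume] gradient φ := grad_ofWeakGradient _ _ _

theorem isWeakGradient_mul {ψ : RN N → ℝ} (hψ : ContDiff ℝ ∞ ψ) {u : RN N → ℝ} {G : RN N → RN N}
    (h : IsWeakGradient u G) (hu : MemLp u 2 volume) (hG : MemLp G 2 volume) :
    IsWeakGradient (fun x => ψ x * u x) (fun x => ψ x • G x + u x • gradient ψ x) := by
  intro φ hφ hc y
  have h1 := h (fun x => ψ x * φ x) (hψ.mul hφ) hc.mul_left y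
  have hcφ : Continuous fun x => fderiv ℝ φ x y :=
    (hφ.continuous_fderiv (by simp)).clm_apply continuous_const
  have hcψ : Continuous fun x => fderiv ℝ ψ x y :=
    (hψ.continuous_fderiv (by simp)).clm_apply continuous_const
  have hd : ∀ x, fderiv ℝ (fun x => ψ x * φ x) x y = ψ x * fderiv ℝ φ x y + φ x * fderiv ℝ ψ x y := by
    intro x
    rw [fderiv_fun_mul (hψ.differentiable (by simp)).differentiableAt
      (hφ.differentiable (by simp)).differentiableAt]
    simp
  have m1 : MemLp (fun x => ψ x * fderiv ℝ φ x y) 2 volume :=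
    (hψ.continuous.mul hcφ).memLp_of_hasCompactSupport (hc.fderiv_apply (𝕜 := ℝ) y).mul_left
  have m2 : MemLp (fun x => φ x * fderiv ℝ ψ x y) 2 volume :=
    (hφ.continuous.mul hcψ).memLp_of_hasCompactSupport hc.mul_right
  have m3 : MemLp (fun x => ψ x * φ x) 2 volume :=
    (hψ.continuous.mul hφ.continuous).memLp_of_hasCompactSupport hc.mul_left
  have i1 : Integrable (fun x => u x * (ψ x * fderiv ℝ φ x y)) volume :=
    hu.integrable_mul m1
  have i2 : Integrable (fun x => u x * (φ x * fderiv ℝ ψ x y)) volume :=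
    hu.integrable_mul m2
  have i3 : Integrable (fun x => inner ℝ (G x) y * (ψ x * φ x)) volume :=
    (hG.inner_const y).integrable_mul m3
  have gen : ∀ (s t : ℝ) (a b : RN N),
      inner ℝ (s • a + t • b) y = s * inner ℝ a y + t * inner ℝ b y := fun s t a b => by
    rw [inner_add_left, real_inner_smul_left, real_inner_smul_left]
  have h0 : ∀ x, inner ℝ (gradient ψ x) y = fderiv ℝ ψ x y := fun x => by simp [gradient]
  have e1 : ∫ x, u x * fderiv ℝ (fun x => ψ x * φ x) x y =
      (∫ x, u x * (ψ x * fderiv ℝ φ x y)) + ∫ x, u x * (φ x * fderiv ℝ ψ x y) := by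
    rw [← integral_add i1 i2]
    exact integral_congr_ae (by filter_upwards with x; rw [hd]; ring)
  have e2 : ∫ x, inner ℝ (ψ x • G x + u x • gradient ψ x) y * φ x =
      (∫ x, inner ℝ (G x) y * (ψ x * φ x)) + ∫ x, u x * (φ x * fderiv ℝ ψ x y) := by
    rw [← integral_add i3 i2]
    refine integral_congr_ae (Eventually.of_forall fun x => ?_)
    simp only [gen, h0]
    ring
  have e3 : ∫ x, ψ x * u x * fderiv ℝ φ x y =
      ∫ x, u x * (ψ x * fderiv ℝ φ x y) :=
    integral_congr_ae (by filter_upwards with x; ring)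
  rw [e1] at h1
  rw [e2, e3]
  linarith

/-- The product of a bounded smooth function with bounded gradient and an element of `H1`. -/
theorem exists_mul {ψ : RN N → ℝ} (hψ : ContDiff ℝ ∞ ψ) {C C' : ℝ} (hC : ∀ x, |ψ x| ≤ C)
    (hC' : ∀ x, ‖gradient ψ x‖ ≤ C') (u : H1 N) :
    ∃ v : H1 N, toL2 N v =ᵐ[volume] (fun x => ψ x * toL2 N u x) ∧
      grad N v =ᵐ[volume] fun x => ψ x • grad N u x + toL2 N u x • gradient ψ x := by
  have h1 : MemLp (fun x => ψ x * toL2 N u x) 2 volume := by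
    refine MemLp.of_le_mul (c := C) (memLp_toL2 u)
      (hψ.continuous.aestronglyMeasurable.mul (memLp_toL2 u).aestronglyMeasurable) ?_
    filter_upwards with x
    rw [norm_mul]
    gcongr
    exact hC x
  have h2 : MemLp (fun x => ψ x • grad N u x) 2 volume := by
    refine MemLp.of_le_mul (c := C) (memLp_grad u)
      (hψ.continuous.aestronglyMeasurable.smul (memLp_grad u).aestronglyMeasurable) ?_
    filter_upwards with x
    rw [norm_smul]
    gcongr
    exact hC x
  have h3 : MemLp (fun x => toL2 N u x • gradient ψ x) 2 volume := by
    refine MemLp.of_le_mul (c := C') (memLp_toL2 u)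
      ((memLp_toL2 u).aestronglyMeasurable.smul (continuous_gradient hψ).aestronglyMeasurable) ?_
    filter_upwards with x
    rw [norm_smul, mul_comm]
    gcongr
    exact hC' x
  exact ⟨ofWeakGradient _ _ h1 (h2.add h3) 
    (isWeakGradient_mul hψ (isWeakGradient u) (memLp_toL2 u) (memLp_grad u)), toL2_ofWeakGradient _ _ _,
    grad_ofWeakGradient _ _ _⟩

end H1

end SobolevSpace

/-! ### Density of test functions by cutoff and mollification. -/

noncomputable section Density

attribute [local irreducible] shift toL2 grad

variable {N : ℕ}

/-- The standard bump function, equal to `1` on the unit ball and supported in the ball of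
radius `2`. -/
def unitBump (N : ℕ) : ContDiffBump (0 : RN N) := ⟨1, 2, one_pos, one_lt_two⟩

/-- A smooth function which is `1` for `‖x‖ ≤ R` and `0` for `‖x‖ ≥ 2 R`. -/
def cutoff (N : ℕ) (R : ℝ) (x : RN N) : ℝ := unitBump N (R⁻¹ • x)

theorem contDiff_cutoff (R : ℝ) : ContDiff ℝ ∞ (cutoff N R) :=
  (unitBump N).contDiff.comp (contDiff_const_smul _)

theorem cutoff_nonneg (R : ℝ) (x : RN N) : 0 ≤ cutoff N R x := (unitBump N).nonneg

theorem cutoff_le_one (R : ℝ) (x : RN N) : cutoff N R x ≤ 1 := (unitBump N).le_one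

theorem cutoff_eq_one {R : ℝ} (hR : 0 < R) {x : RN N} (hx : ‖x‖ ≤ R) : cutoff N R x = 1 := by
  refine (unitBump N).one_of_mem_closedBall ?_
  rw [mem_closedBall_zero_iff, norm_smul, norm_inv, Real.norm_of_nonneg hR.le]
  exact (inv_mul_le_iff₀ hR).2 (by simpa [unitBump] using hx)

theorem cutoff_eq_zero {R : ℝ} (hR : 0 < R) {x : RN N} (hx : 2 * R ≤ ‖x‖) : cutoff N R x = 0 := by
  refine (unitBump N).zero_of_le_dist ?_
  rw [dist_zero_right, norm_smul, norm_inv, Real.norm_of_nonneg hR.le, le_inv_mul_iff₀ hR]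
  simpa [unitBump, mul_comm] using hx

theorem hasCompactSupport_cutoff {R : ℝ} (hR : 0 < R) : HasCompactSupport (cutoff N R) :=
  HasCompactSupport.intro (isCompact_closedBall (0 : RN N) (2 * R)) fun x hx =>
    cutoff_eq_zero hR (by
      rw [mem_closedBall_zero_iff, not_le] at hx; exact hx.le)

/-- Rescaling one fixed bump by `R⁻¹` divides its gradient by `R`, with a constant independent of
`R`. This rate drives the decay estimates for the interactions as well. -/
theorem exists_gradient_cutoff_le (N : ℕ) :
    ∃ C : ℝ, 0 < C ∧ ∀ R : ℝ, 0 < R → ∀ x, ‖gradient (cutoff N R) x‖ ≤ C / R := by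
  have hcont : Continuous (fderiv ℝ (unitBump N)) :=
    ((unitBump N).contDiff (n := (⊤ : ℕ∞))).continuous_fderiv (by simp)
  obtain ⟨C, hC⟩ := hcont.bounded_above_of_compact_support
    ((unitBump N).hasCompactSupport.fderiv (𝕜 := ℝ))
  refine ⟨|C| + 1, by positivity, fun R hR x => ?_⟩
  rw [H1.norm_gradient]
  have : fderiv ℝ (cutoff N R) x = R⁻¹ • fderiv ℝ (unitBump N) (R⁻¹ • x) :=
    fderiv_comp_smul _
  rw [this, norm_smul, norm_inv, Real.norm_of_nonneg hR.le, div_eq_inv_mul]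
  gcongr
  exact (hC _).trans ((le_abs_self C).trans (by linarith))

theorem norm_sq_eq_integral {E : Type*} [NormedAddCommGroup E] [InnerProductSpace ℝ E]
    (g : Lp E 2 (volume : Measure (RN N))) : ‖g‖ ^ 2 = ∫ x, ‖g x‖ ^ 2 := by
  rw [← real_inner_self_eq_norm_sq, L2.inner_def]
  simp only [real_inner_self_eq_norm_sq]

theorem integrable_norm_sq {E : Type*} [NormedAddCommGroup E] [InnerProductSpace ℝ E]
    (g : Lp E 2 (volume : Measure (RN N))) : Integrable (fun x => ‖g x‖ ^ 2) volume :=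
  (Lp.memLp g).integrable_norm_pow (by norm_num)

theorem norm_cutoff_smul_sq_le {E : Type*} [NormedAddCommGroup E] [NormedSpace ℝ E] (R : ℝ)
    (x : RN N) (a : E) : ‖(1 - cutoff N R x) • a‖ ^ 2 ≤ ‖a‖ ^ 2 := by
  have h1 := cutoff_nonneg R x
  have h2 := cutoff_le_one R x
  rw [norm_smul, Real.norm_of_nonneg (by linarith)]
  gcongr
  exact mul_le_of_le_one_left (norm_nonneg _) (by linarith)

theorem aestronglyMeasurable_cutoff_smul_sq {E : Type*} [NormedAddCommGroup E]
    [InnerProductSpace ℝ E] (R : ℝ) (g : Lp E 2 (volume : Measure (RN N))) :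
    AEStronglyMeasurable (fun x => ‖(1 - cutoff N R x) • g x‖ ^ 2) volume :=
  ((continuous_const.sub (contDiff_cutoff _).continuous).aestronglyMeasurable.smul
    (Lp.aestronglyMeasurable g)).norm.pow 2

theorem integrable_cutoff_smul_sq {E : Type*} [NormedAddCommGroup E]
    [InnerProductSpace ℝ E] (R : ℝ) (g : Lp E 2 (volume : Measure (RN N))) :
    Integrable (fun x => ‖(1 - cutoff N R x) • g x‖ ^ 2) volume := by
  refine (integrable_norm_sq g).mono' (aestronglyMeasurable_cutoff_smul_sq R g) ?_
  filter_upwards with x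
  rw [Real.norm_of_nonneg (by positivity)]
  exact norm_cutoff_smul_sq_le R x _

theorem norm_sub_smul_add_sq_le {E : Type*} [NormedAddCommGroup E] [NormedSpace ℝ E] (a h : E)
    {t s c : ℝ} (hc : ‖h‖ ≤ c) :
    ‖a - (t • a + s • h)‖ ^ 2 ≤ 2 * ‖(1 - t) • a‖ ^ 2 + 2 * (c ^ 2 * ‖s‖ ^ 2) := by
  have e : a - (t • a + s • h) = (1 - t) • a - s • h := by module
  have h3 : ‖s • h‖ ≤ c * ‖s‖ := by
    rw [norm_smul, mul_comm]
    gcongr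
  rw [e]
  have h4 := norm_sub_le ((1 - t) • a) (s • h)
  have h5 : ‖(1 - t) • a - s • h‖ ^ 2 ≤ (‖(1 - t) • a‖ + c * ‖s‖) ^ 2 := by gcongr; linarith
  nlinarith [sq_nonneg (‖(1 - t) • a‖ - c * ‖s‖)]

theorem tendsto_cutoff_tail {E : Type*} [NormedAddCommGroup E] [InnerProductSpace ℝ E]
    (g : Lp E 2 (volume : Measure (RN N))) :
    Tendsto (fun n : ℕ => ∫ x, ‖(1 - cutoff N (n + 1) x) • g x‖ ^ 2) atTop (𝓝 0) := by
  have h0 : (∫ _ : RN N, (0 : ℝ)) = 0 := by simp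
  rw [← h0]
  refine tendsto_integral_of_dominated_convergence (fun x => ‖g x‖ ^ 2) (fun n => ?_)
    (integrable_norm_sq g) (fun n => ?_) ?_
  · exact aestronglyMeasurable_cutoff_smul_sq _ g
  · filter_upwards with x
    rw [Real.norm_of_nonneg (by positivity)]
    exact norm_cutoff_smul_sq_le _ x _
  · filter_upwards with x
    obtain ⟨n₀, hn₀⟩ := exists_nat_ge ‖x‖
    refine tendsto_const_nhds.congr' ?_
    filter_upwards [eventually_ge_atTop n₀] with n hn
    have : ‖x‖ ≤ (n : ℝ) + 1 := by
      have : (n₀ : ℝ) ≤ n := by exact_mod_cast hn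
      linarith
    rw [cutoff_eq_one (by positivity) this]
    simp

theorem integral_le_two_mul_add {A B D : RN N → ℝ} {c : ℝ} (hD : Integrable D volume)
    (hA : Integrable A volume) (hB : Integrable B volume)
    (h : ∀ᵐ x, D x ≤ 2 * A x + 2 * (c * B x)) :
    ∫ x, D x ≤ 2 * (∫ x, A x) + 2 * (c * ∫ x, B x) := by
  rw [← integral_const_mul, ← integral_const_mul c, ← integral_const_mul,
    ← integral_add (hA.const_mul 2) ((hB.const_mul _).const_mul 2)]
  exact integral_mono_ae hD ((hA.const_mul 2).add ((hB.const_mul _).const_mul 2)) h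

theorem norm_integral_normed_smul_sub_le {E : Type*} [NormedAddCommGroup E] [NormedSpace ℝ E]
    [CompleteSpace E] (ρ : ContDiffBump (0 : RN N)) {g : RN N → E} {v : E} {δ : ℝ}
    (hint : Integrable (fun y => ρ.normed volume y • g y) volume)
    (hg : ∀ y, ‖y‖ < ρ.rOut → ‖g y - v‖ ≤ δ) :
    ‖(∫ y, ρ.normed volume y • g y) - v‖ ≤ δ := by
  have h1 : v = ∫ y, ρ.normed volume y • v := by
    rw [integral_smul_const, ρ.integral_normed, one_smul]
  have hint' : Integrable (fun y => ρ.normed volume y • v) volume := ρ.integrable_normed.smul_const v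
  have h2 : (∫ y, ρ.normed volume y • g y) - v = ∫ y, ρ.normed volume y • (g y - v) := by
    conv_lhs => rw [h1]
    simp only [smul_sub]
    rw [integral_sub hint hint']
  rw [h2]
  refine (norm_integral_le_of_norm_le (g := fun y => ρ.normed volume y * δ)
    (ρ.integrable_normed.mul_const δ) ?_).trans ?_
  · filter_upwards with y
    rw [norm_smul, Real.norm_of_nonneg (ρ.nonneg_normed y)]
    by_cases hy : ‖y‖ < ρ.rOut
    · exact mul_le_mul_of_nonneg_left (hg y hy) (ρ.nonneg_normed y)
    · have h0 : ρ.normed volume y = 0 := by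
        have : y ∉ Function.support (ρ.normed volume) := by
          rw [ρ.support_normed_eq]
          simpa using hy
        simpa using this
      rw [h0]; simp
  · rw [integral_mul_const, ρ.integral_normed, one_mul]

theorem H1.norm_toL2_sub_cutoff_sq {u v : H1 N} {R : ℝ}
    (hv : toL2 N v =ᵐ[volume] fun x => cutoff N R x * toL2 N u x) :
    ‖toL2 N (u - v)‖ ^ 2 = ∫ x, ‖(1 - cutoff N R x) • toL2 N u x‖ ^ 2 := by
  have hsub : toL2 N (u - v) = toL2 N u - toL2 N v := map_sub _ _ _
  have gen : ∀ s t : ℝ, ‖s - t * s‖ ^ 2 = ‖(1 - t) • s‖ ^ 2 := fun s t => by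
    rw [smul_eq_mul]; ring_nf
  rw [hsub, norm_sq_eq_integral]
  refine integral_congr_ae ?_
  filter_upwards [Lp.coeFn_sub (toL2 N u) (toL2 N v), hv] with x h1 h2
  simp only [h1, Pi.sub_apply, h2]
  exact gen _ _

theorem H1.norm_grad_sub_cutoff_sq_le {u v : H1 N} {R C : ℝ}
    (hgrad : ∀ x, ‖gradient (cutoff N R) x‖ ≤ C)
    (hv' : grad N v =ᵐ[volume] fun x => cutoff N R x • grad N u x +
        toL2 N u x • gradient (cutoff N R) x) :
    ‖grad N (u - v)‖ ^ 2 ≤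
      2 * (∫ x, ‖(1 - cutoff N R x) • grad N u x‖ ^ 2) + 2 * (C ^ 2 * ‖toL2 N u‖ ^ 2) := by
  have hsub : grad N (u - v) = grad N u - grad N v := map_sub _ _ _
  rw [hsub, norm_sq_eq_integral (grad N u - grad N v), norm_sq_eq_integral (toL2 N u)]
  refine integral_le_two_mul_add (integrable_norm_sq (grad N u - grad N v))
    (integrable_cutoff_smul_sq R (grad N u)) (integrable_norm_sq (toL2 N u)) ?_
  filter_upwards [Lp.coeFn_sub (grad N u) (grad N v), hv'] with x h1 h2
  simp only [h1, Pi.sub_apply, h2]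
  exact norm_sub_smul_add_sq_le _ _ (hgrad x)

/-- Multiply by cutoffs of growing radius: the tails vanish by dominated convergence, and the extra
term `u ∇χ` has norm at most `C / (n + 1)` times that of `u`. -/
theorem H1.exists_hasCompactSupport_near (u : H1 N) {δ : ℝ} (hδ : 0 < δ) :
    ∃ (v : H1 N) (U : RN N → ℝ), HasCompactSupport U ∧ toL2 N v =ᵐ[volume] U ∧ ‖u - v‖ < δ := by
  obtain ⟨C, hC, hgrad⟩ := exists_gradient_cutoff_le N
  have key : ∀ n : ℕ, ∃ v : H1 N, toL2 N v =ᵐ[volume] (fun x => cutoff N (n + 1) x * toL2 N u x) ∧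
      grad N v =ᵐ[volume] fun x => cutoff N (n + 1) x • grad N u x +
        toL2 N u x • gradient (cutoff N (n + 1)) x := fun n =>
    H1.exists_mul (contDiff_cutoff _) (C := 1)
      (fun x => by rw [abs_of_nonneg (cutoff_nonneg _ _)]; exact cutoff_le_one _ _)
      (fun x => hgrad _ (by positivity) x) u
  choose v hv hv' using key
  have h4 : Tendsto (fun n : ℕ => C / ((n : ℝ) + 1)) atTop (𝓝 0) := by
    simpa [div_eq_mul_inv] using (tendsto_one_div_add_atTop_nhds_zero_nat (𝕜 := ℝ)).const_mul C
  have h3 := (tendsto_cutoff_tail (toL2 N u)).add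
      (((tendsto_cutoff_tail (grad N u)).const_mul 2).add
        (((h4.pow 2).mul_const (‖toL2 N u‖ ^ 2)).const_mul 2))
  have h0 : (0 : ℝ) + (2 * 0 + 2 * (0 ^ 2 * ‖toL2 N u‖ ^ 2)) = 0 := by ring
  rw [h0] at h3
  obtain ⟨n, hn⟩ := (h3.eventually (gt_mem_nhds (show 0 < δ ^ 2 by positivity))).exists
  refine ⟨v n, _, (hasCompactSupport_cutoff (by positivity)).mul_right, hv n, ?_⟩
  have h5 : ‖u - v n‖ ^ 2 < δ ^ 2 := by
    rw [H1.norm_sq_eq, H1.norm_toL2_sub_cutoff_sq (hv n)]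
    have := H1.norm_grad_sub_cutoff_sq_le (hgrad (n + 1) (by positivity)) (hv' n)
    linarith
  exact lt_of_pow_lt_pow_left₀ 2 hδ.le h5

/-- Mollification of a compactly supported element of `H1`. -/
theorem H1.exists_test_near_of_hasCompactSupport (v : H1 N) {U : RN N → ℝ}
    (hU : HasCompactSupport U) (hvU : toL2 N v =ᵐ[volume] U) {δ : ℝ} (hδ : 0 < δ) :
    ∃ (φ : RN N → ℝ) (hφ : ContDiff ℝ ∞ φ) (hc : HasCompactSupport φ),
      ‖v - H1.ofTest φ hφ hc‖ ≤ δ := by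
  have hU2 : MemLp U 2 volume := (memLp_congr_ae hvU).1 (H1.memLp_toL2 v)
  have hUi : Integrable U volume := by
    have h1 : MemLp (U) 1 volume := by
      refine hU2.mono_exponent_of_measure_support_ne_top (s := tsupport U)
        (fun x hx => image_eq_zero_of_notMem_tsupport hx) hU.measure_lt_top.ne (by norm_num)
    exact memLp_one_iff_integrable.1 h1
  have hcont := H1.continuous_shift v
  obtain ⟨η, hη, hball⟩ := Metric.continuousAt_iff.1 (hcont.continuousAt (x := 0)) δ hδ
  let ρ : ContDiffBump (0 : RN N) := ⟨η / 2, η, by positivity, by linarith⟩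
  let r : RN N → ℝ := ρ.normed volume
  have hr : ContDiff ℝ ∞ r := ρ.contDiff_normed
  have hrc : HasCompactSupport r := ρ.hasCompactSupport_normed
  let φ : RN N → ℝ := convolution r U (ContinuousLinearMap.lsmul ℝ ℝ) volume
  have hφ : ContDiff ℝ ∞ φ := hrc.contDiff_convolution_left _ hr hUi.locallyIntegrable
  have hφc : HasCompactSupport φ := hrc.convolution _ hU
  have hint : Integrable (fun y => r y • shift y v) volume :=
    (hr.continuous.smul hcont).integrable_of_hasCompactSupport hrc.smul_right
  -- Mollifying inside `H1 N` gives closeness in the full norm without computing the gradient of the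
  -- convolution; the function part of `w` is then identified with `φ` by testing and Fubini.
  let w : H1 N := ∫ y, r y • shift y v
  have hwv : ‖w - v‖ ≤ δ :=
    norm_integral_normed_smul_sub_le ρ hint fun y hy => by
      have := hball (x := y) (by simpa using hy)
      rw [dist_eq_norm, H1.shift_zero] at this
      exact this.le
  have hw : toL2 N w =ᵐ[volume] φ := by
    refine ae_eq_of_integral_contDiff_smul_eq ((H1.memLp_toL2 w).locallyIntegrable (by norm_num))
      hφ.continuous.locallyIntegrable fun g hg hgc => ?_
    have hg2 := H1.memLp_test hg hgc
    let ℓ : H1 N →L[ℝ] ℝ := (innerSL ℝ (hg2.toLp g)).comp (toL2 N)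
    have hℓ : ∀ z : H1 N, ℓ z = ∫ x, toL2 N z x * g x := fun z =>
      (H1.integral_toL2_mul (toL2 N z) hg2).symm
    have h1 : ∫ x, g x • toL2 N w x = ∫ y, r y * ∫ x, U (x - y) * g x := by
      have e1 : ∫ x, g x • toL2 N w x = ℓ w := by
        rw [hℓ]; simp only [smul_eq_mul, mul_comm]
      rw [e1, ← ContinuousLinearMap.integral_comp_comm ℓ hint]
      refine integral_congr_ae (Eventually.of_forall fun y => ?_)
      have e2 : ∫ x, toL2 N (shift y v) x * g x = ∫ x, U (x - y) * g x := by
        refine integral_congr_ae ?_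
        filter_upwards [H1.shift_toL2_ae y v, H1.ae_sub_right hvU y] with x h2 h3
        rw [h2, h3]
      show ℓ (r y • shift y v) = _
      rw [map_smul, smul_eq_mul, hℓ, e2]
    have h2 : ∫ x, g x • φ x = ∫ x, ∫ y, g x * (r y * U (x - y)) := by
      refine integral_congr_ae (Eventually.of_forall fun x => ?_)
      simp only [φ, convolution_def, smul_eq_mul, ContinuousLinearMap.lsmul_apply]
      rw [integral_const_mul]
    obtain ⟨M, hM⟩ := hg.continuous.bounded_above_of_compact_support hgc
    have hI : Integrable (fun p : RN N × RN N => g p.1 * (r p.2 * U (p.1 - p.2)))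
        (volume.prod volume) := by
      have h3 := (hr.continuous.integrable_of_hasCompactSupport hrc (μ := volume)).convolution_integrand
        (ContinuousLinearMap.lsmul ℝ ℝ) hUi
      refine Integrable.bdd_mul (c := M) h3
        (hg.continuous.comp continuous_fst).aestronglyMeasurable ?_
      exact Eventually.of_forall fun p => hM p.1
    rw [h1, h2, integral_integral_swap hI]
    refine integral_congr_ae (Eventually.of_forall fun y => ?_)
    simp only
    rw [← integral_const_mul]
    refine integral_congr_ae (Eventually.of_forall fun x => ?_)
    simp only
    ring
  refine ⟨φ, hφ, hφc, ?_⟩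
  have : w = H1.ofTest φ hφ hφc :=
    H1.toL2_injective (Lp.ext (hw.trans (H1.toL2_ofTest hφ hφc).symm))
  rw [← this, norm_sub_rev]
  exact hwv

/-- Test functions are dense in `H1`. -/
theorem H1.exists_test_near (u : H1 N) {δ : ℝ} (hδ : 0 < δ) :
    ∃ (φ : RN N → ℝ) (hφ : ContDiff ℝ ∞ φ) (hc : HasCompactSupport φ),
      ‖u - H1.ofTest φ hφ hc‖ < δ := by
  obtain ⟨v, U, hU, hvU, hv⟩ := H1.exists_hasCompactSupport_near u (half_pos hδ)
  obtain ⟨φ, hφ, hc, h⟩ := H1.exists_test_near_of_hasCompactSupport v hU hvU (half_pos hδ)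
  refine ⟨φ, hφ, hc, ?_⟩
  have e : u - H1.ofTest φ hφ hc = (u - v) + (v - H1.ofTest φ hφ hc) := by abel
  rw [e]
  refine (norm_add_le _ _).trans_lt ?_
  linarith

end Density

/-! ### Sobolev inequalities. -/

noncomputable section Sobolev

attribute [local irreducible] shift toL2 grad

variable {N : ℕ}

theorem eLpNorm_test_le {φ : RN N → ℝ} (hφ : ContDiff ℝ ∞ φ) (hc : HasCompactSupport φ) :
    eLpNorm φ 2 volume ≤ ENNReal.ofReal ‖H1.ofTest φ hφ hc‖ := by
  rw [← eLpNorm_congr_ae (H1.toL2_ofTest hφ hc),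
    ← ENNReal.ofReal_toReal (Lp.eLpNorm_ne_top (toL2 N (H1.ofTest φ hφ hc))), ← Lp.norm_def]
  exact ENNReal.ofReal_le_ofReal (H1.norm_toL2_le _)

theorem eLpNorm_fderiv_test_le {φ : RN N → ℝ} (hφ : ContDiff ℝ ∞ φ) (hc : HasCompactSupport φ) :
    eLpNorm (fderiv ℝ φ) 2 volume ≤ ENNReal.ofReal ‖H1.ofTest φ hφ hc‖ := by
  have h : eLpNorm (fderiv ℝ φ) 2 volume = eLpNorm (gradient φ) 2 volume :=
    eLpNorm_congr_norm_ae (Eventually.of_forall fun x => (H1.norm_gradient φ x).symm)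
  rw [h, ← eLpNorm_congr_ae (H1.grad_ofTest hφ hc),
    ← ENNReal.ofReal_toReal (Lp.eLpNorm_ne_top (grad N (H1.ofTest φ hφ hc))), ← Lp.norm_def]
  exact ENNReal.ofReal_le_ofReal (H1.norm_grad_le _)

theorem eLpNorm_const_smul_smul_le (c : ℝ) {g G : RN N → ℝ} (hg : AEStronglyMeasurable g volume)
    (hG : AEStronglyMeasurable G volume) :
    eLpNorm (fun x => c • g x • G x) 1 volume ≤
      ‖c‖ₑ * (eLpNorm g 2 volume * eLpNorm G 2 volume) := by
  have h1 : eLpNorm (c • (g • G)) 1 volume ≤ ‖c‖ₑ * eLpNorm (g • G) 1 volume :=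
    eLpNorm_const_smul_le
  have h2 : eLpNorm (g • G) 1 volume ≤ eLpNorm g 2 volume * eLpNorm G 2 volume :=
    eLpNorm_smul_le_mul_eLpNorm hG hg
  exact h1.trans (mul_le_mul_right h2 _)

/-- The chain rule and Cauchy–Schwarz. Passing to powers is what makes the `L¹` endpoint
inequalities useful in dimensions one and two. -/
theorem eLpNorm_fderiv_pow_le {φ : RN N → ℝ} (hφ : ContDiff ℝ ∞ φ) (k : ℕ) :
    eLpNorm (fderiv ℝ fun x => φ x ^ (k + 1)) 1 volume ≤
      ((k : ℝ≥0∞) + 1) * (eLpNorm (fun x => φ x ^ k) 2 volume * eLpNorm (fderiv ℝ φ) 2 volume) := by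
  have h : (fderiv ℝ fun x => φ x ^ (k + 1)) =
      fun x => ((k : ℝ) + 1) • (φ x ^ k) • fderiv ℝ φ x := by
    funext x
    have hd : HasFDerivAt φ (fderiv ℝ φ x) x := (hφ.differentiable (by simp) x).hasFDerivAt
    rw [(hd.pow (k + 1)).fderiv]
    simp [smul_smul]
  have hk : ‖(k : ℝ) + 1‖ₑ = (k : ℝ≥0∞) + 1 := by
    rw [← ofReal_norm, Real.norm_of_nonneg (by positivity),
      ENNReal.ofReal_add (by positivity) (by positivity)]
    simp
  have h1 : eLpNorm (fderiv ℝ fun x => φ x ^ (k + 1)) 1 volume =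
      eLpNorm (fun x => ((k : ℝ) + 1) • (φ x ^ k) • ‖fderiv ℝ φ x‖) 1 volume := by
    refine eLpNorm_congr_norm_ae (Eventually.of_forall fun x => ?_)
    rw [h]
    simp only [norm_smul, norm_norm]
  rw [h1, ← hk, ← eLpNorm_norm (fderiv ℝ φ)]
  exact eLpNorm_const_smul_smul_le _ (hφ.continuous.pow k).aestronglyMeasurable
    (hφ.continuous_fderiv (by simp)).norm.aestronglyMeasurable

/-- The fundamental theorem of calculus on a half-line, after an isometric identification of `RN 1`
with `ℝ`. -/
theorem enorm_le_eLpNorm_fderiv {g : RN 1 → ℝ} (hg : ContDiff ℝ ∞ g) (hc : HasCompactSupport g)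
    (x : RN 1) : ‖g x‖ₑ ≤ eLpNorm (fderiv ℝ g) 1 volume := by
  let e : ℝ ≃ₗᵢ[ℝ] RN 1 := (OrthonormalBasis.singleton (Fin 1) ℝ).repr
  have hge : ContDiff ℝ 1 (g ∘ e) := (hg.of_le (by simp)).comp e.toContinuousLinearEquiv.contDiff
  have hgc : HasCompactSupport (g ∘ e) := hc.comp_homeomorph e.toHomeomorph
  have hd : ∀ t, ‖deriv (g ∘ e) t‖ₑ ≤ ‖fderiv ℝ g (e t)‖ₑ := by
    intro t
    have h1 : HasFDerivAt g (fderiv ℝ g (e t)) (e t) :=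
      (hg.differentiable (by simp) _).hasFDerivAt
    have h2 : HasDerivAt e (e 1) t := by
      have := (e.toContinuousLinearEquiv.toContinuousLinearMap.hasFDerivAt (x := t)).hasDerivAt
      simpa using this
    rw [(h1.comp_hasDerivAt t h2).deriv]
    have h3 := (fderiv ℝ g (e t)).le_opNorm (e 1)
    rw [e.norm_map, norm_one, mul_one] at h3
    rw [← ofReal_norm, ← ofReal_norm]
    exact ENNReal.ofReal_le_ofReal h3
  have h4 := HasCompactSupport.enorm_le_lintegral_Ici_deriv hge hgc (e.symm x)
  have h5 : (g ∘ e) (e.symm x) = g x := by simp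
  rw [h5] at h4
  refine h4.trans ((setLIntegral_le_lintegral _ _).trans ((lintegral_mono hd).trans ?_))
  rw [eLpNorm_one_eq_lintegral_enorm]
  have hmp : MeasurePreserving e volume volume := e.measurePreserving
  rw [← hmp.lintegral_comp (hg.continuous_fderiv (by simp)).enorm.measurable]

/-- In dimensions one and two, `‖φ ^ (k + 1)‖₂` is controlled by `‖φ ^ k‖₂` and the `H¹` norm. -/
theorem exists_eLpNorm_pow_succ_le (hN : 1 ≤ N) (hN2 : N ≤ 2) (k : ℕ) :
    ∃ C : ℝ≥0∞, C ≠ ⊤ ∧ ∀ (φ : RN N → ℝ) (hφ : ContDiff ℝ ∞ φ) (hc : HasCompactSupport φ),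
      eLpNorm (fun x => φ x ^ (k + 1)) 2 volume ≤
        C * (eLpNorm (fun x => φ x ^ k) 2 volume * ENNReal.ofReal ‖H1.ofTest φ hφ hc‖) := by
  obtain rfl | rfl : N = 1 ∨ N = 2 := by omega
  · refine ⟨2, by simp, fun φ hφ hc => ?_⟩
    set S := ENNReal.ofReal ‖H1.ofTest φ hφ hc‖ with hS
    -- The endpoint inequality for `φ ^ 2` bounds the square of the supremum by twice the product of
    -- the `L²` norms of `φ` and its derivative; a supremum factor can then be pulled out of `φ ^ (k
    -- + 1)`.
    have hsup : ∀ x, ‖φ x‖ₑ ≤ 2 * S := by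
      intro x
      have h1 := enorm_le_eLpNorm_fderiv (g := fun x => φ x ^ (1 + 1)) (hφ.pow 2)
        (hc.comp_left (g := fun s : ℝ => s ^ (1 + 1)) (by simp)) x
      have h2 := eLpNorm_fderiv_pow_le hφ 1
      simp only [pow_one, Nat.cast_one] at h2
      have h3 : ‖φ x‖ₑ ^ 2 ≤ (2 * S) ^ 2 := by
        rw [← enorm_pow]
        calc ‖φ x ^ 2‖ₑ ≤ (1 + 1) * (eLpNorm φ 2 volume * eLpNorm (fderiv ℝ φ) 2 volume) :=
              h1.trans h2
          _ ≤ (1 + 1) * (S * S) := by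
              gcongr
              · exact eLpNorm_test_le hφ hc
              · exact eLpNorm_fderiv_test_le hφ hc
          _ ≤ (2 * S) ^ 2 := by
              rw [one_add_one_eq_two, mul_pow, ← pow_two]
              gcongr
              norm_num
      by_contra hlt
      rw [not_le] at hlt
      exact absurd h3 (not_le.2 (ENNReal.pow_lt_pow_left (by norm_num) hlt))
    have h4 := eLpNorm_smul_le_mul_eLpNorm (p := ∞) (q := 2) (r := 2) (μ := volume)
      (f := fun x => φ x ^ k) (φ := φ) (hφ.continuous.pow k).aestronglyMeasurable
      hφ.continuous.aestronglyMeasurable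
    have h5 : (φ • fun x => φ x ^ k) = fun x => φ x ^ (k + 1) := by
      funext x
      simp [pow_succ, mul_comm]
    rw [h5] at h4
    refine h4.trans ?_
    have h6 : eLpNorm φ ∞ volume ≤ 2 * S := by
      rw [eLpNorm_exponent_top]
      exact eLpNormEssSup_le_of_ae_enorm_bound (Eventually.of_forall hsup)
    calc eLpNorm φ ∞ volume * eLpNorm (fun x => φ x ^ k) 2 volume
        ≤ (2 * S) * eLpNorm (fun x => φ x ^ k) 2 volume := by gcongr
      _ = _ := by ring
  -- In dimension two the embedding of `W^{1,1}` into `L²` is applied to `φ ^ (k + 1)`.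
  · refine ⟨eLpNormLESNormFDerivOneConst (volume : Measure (RN 2)) 2 * ((k : ℝ≥0∞) + 1),
      by finiteness, fun φ hφ hc => ?_⟩
    have h1 := eLpNorm_le_eLpNorm_fderiv_one (volume : Measure (RN 2))
      (u := fun x => φ x ^ (k + 1)) ((hφ.pow _).of_le (by simp))
      (hc.comp_left (g := fun s : ℝ => s ^ (k + 1)) (by simp)) (p := 2)
      (by simpa using NNReal.HolderConjugate.two_two)
    refine h1.trans ?_
    rw [mul_assoc]
    refine mul_le_mul_right ((eLpNorm_fderiv_pow_le hφ k).trans ?_) _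
    gcongr
    exact eLpNorm_fderiv_test_le hφ hc

/-- Iterating the step from one power to the next reaches every even Lebesgue exponent, which is
enough for arbitrary polynomial growth. -/
theorem exists_eLpNorm_test_le_of_le_two (hN : 1 ≤ N) (hN2 : N ≤ 2) (k : ℕ) :
    ∃ C : ℝ≥0∞, C ≠ ⊤ ∧ ∀ (φ : RN N → ℝ) (hφ : ContDiff ℝ ∞ φ) (hc : HasCompactSupport φ),
      eLpNorm (fun x => φ x ^ (k + 1)) 2 volume ≤
        C * ENNReal.ofReal ‖H1.ofTest φ hφ hc‖ ^ (k + 1) := by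
  induction k with
  | zero =>
    refine ⟨1, by simp, fun φ hφ hc => ?_⟩
    simpa using eLpNorm_test_le hφ hc
  | succ k ih =>
    obtain ⟨C, hC, h⟩ := ih
    obtain ⟨D, hD, h'⟩ := exists_eLpNorm_pow_succ_le hN hN2 (k + 1)
    refine ⟨D * C, by finiteness, fun φ hφ hc => (h' φ hφ hc).trans ?_⟩
    calc _ ≤ D * (C * ENNReal.ofReal ‖H1.ofTest φ hφ hc‖ ^ (k + 1) *
          ENNReal.ofReal ‖H1.ofTest φ hφ hc‖) := by gcongr; exact h φ hφ hc
      _ = _ := by ring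

/-- The Sobolev inequality for test functions with an exponent `q > 2` at our disposal. -/
def SobolevExponent (N : ℕ) (q : ℝ) : Prop :=
  ∃ C : ℝ, 0 < C ∧ ∀ (φ : RN N → ℝ) (hφ : ContDiff ℝ ∞ φ) (hc : HasCompactSupport φ),
    eLpNorm φ (ENNReal.ofReal q) volume ≤ ENNReal.ofReal (C * ‖H1.ofTest φ hφ hc‖)

theorem sobolevExponent_of_le_two (hN : 1 ≤ N) (hN2 : N ≤ 2) (k : ℕ) :
    SobolevExponent N (2 * ((k : ℝ) + 1)) := by
  obtain ⟨C, hC, h⟩ := exists_eLpNorm_test_le_of_le_two hN hN2 k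
  refine ⟨(C.toReal + 1) ^ ((k : ℝ) + 1)⁻¹, by positivity, fun φ hφ hc => ?_⟩
  have h1 := eLpNorm_norm_rpow (p := 2) (μ := volume) φ (q := (k : ℝ) + 1) (by positivity)
  have h2 : eLpNorm (fun x => ‖φ x‖ ^ ((k : ℝ) + 1)) 2 volume =
      eLpNorm (fun x => φ x ^ (k + 1)) 2 volume := by
    refine eLpNorm_congr_norm_ae (Eventually.of_forall fun x => ?_)
    have : (k : ℝ) + 1 = ((k + 1 : ℕ) : ℝ) := by push_cast; ring
    rw [this, Real.rpow_natCast, norm_pow, norm_pow, norm_norm]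
  rw [h2] at h1
  have h3 : ENNReal.ofReal (2 * ((k : ℝ) + 1)) = 2 * ENNReal.ofReal ((k : ℝ) + 1) := by
    rw [ENNReal.ofReal_mul (by norm_num)]; simp
  have hk : (0 : ℝ) < (k : ℝ) + 1 := by positivity
  rw [h3, ← ENNReal.rpow_le_rpow_iff hk, ← h1]
  refine (h φ hφ hc).trans ?_
  have h4 : ENNReal.ofReal ((C.toReal + 1) ^ ((k : ℝ) + 1)⁻¹ * ‖H1.ofTest φ hφ hc‖) ^ ((k : ℝ) + 1)
      = ENNReal.ofReal (C.toReal + 1) * ENNReal.ofReal ‖H1.ofTest φ hφ hc‖ ^ (k + 1) := by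
    rw [ENNReal.ofReal_mul (by positivity), ENNReal.mul_rpow_of_nonneg _ _ hk.le,
      ENNReal.ofReal_rpow_of_nonneg (by positivity) hk.le, ← Real.rpow_mul (by positivity),
      inv_mul_cancel₀ hk.ne', Real.rpow_one]
    congr 1
    rw [← ENNReal.rpow_natCast]
    push_cast
    rfl
  rw [h4]
  gcongr
  rw [ENNReal.ofReal_add (by positivity) (by norm_num), ENNReal.ofReal_toReal hC]
  simp

theorem sobolevExponent_of_three_le (hN : 3 ≤ N) :
    SobolevExponent N (2 * (N : ℝ) / ((N : ℝ) - 2)) := by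
  have hN' : (3 : ℝ) ≤ N := by exact_mod_cast hN
  have hpos : 0 < 2 * (N : ℝ) / ((N : ℝ) - 2) := div_pos (by linarith) (by linarith)
  set q : NNReal := ⟨2 * (N : ℝ) / ((N : ℝ) - 2), hpos.le⟩ with hq
  set D := eLpNormLESNormFDerivOfEqInnerConst (volume : Measure (RN N)) 2 with hD
  refine ⟨(D : ℝ) + 1, by positivity, fun φ hφ hc => ?_⟩
  have h1 := eLpNorm_le_eLpNorm_fderiv_of_eq_inner (volume : Measure (RN N))
    (hφ.of_le (by simp)) hc (p := 2) (p' := q) (by norm_num) (by simp; omega) (by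
      have h0 : (N : ℝ) - 2 ≠ 0 := by linarith
      have h3 : (q : ℝ) = 2 * (N : ℝ) / ((N : ℝ) - 2) := rfl
      rw [h3, finrank_euclideanSpace, Fintype.card_fin]
      push_cast
      field_simp)
  have h2 : ENNReal.ofReal (2 * (N : ℝ) / ((N : ℝ) - 2)) = (q : ℝ≥0∞) :=
    ENNReal.ofReal_eq_coe_nnreal hpos.le
  rw [h2]
  refine h1.trans ?_
  rw [ENNReal.ofReal_mul (by positivity), ENNReal.ofReal_add (by positivity) (by norm_num)]
  gcongr
  · rw [ENNReal.ofReal_coe_nnreal]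
    exact le_self_add
  · exact eLpNorm_fderiv_test_le hφ hc

/-- A Sobolev inequality extends from test functions to `H¹`. -/
theorem SobolevExponent.exists_eLpNorm_le {q : ℝ} (h : SobolevExponent N q) :
    ∃ C : ℝ, 0 < C ∧ ∀ u : H1 N,
      eLpNorm (toL2 N u) (ENNReal.ofReal q) volume ≤ ENNReal.ofReal (C * ‖u‖) := by
  obtain ⟨C, hC, h⟩ := h
  refine ⟨C, hC, fun u => ?_⟩
  choose φ hφ hc hlt using fun n : ℕ =>
    H1.exists_test_near u (δ := 1 / ((n : ℝ) + 1)) (by positivity)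
  have hlim : Tendsto (fun n => H1.ofTest (φ n) (hφ n) (hc n)) atTop (𝓝 u) := by
    rw [tendsto_iff_norm_sub_tendsto_zero]
    refine squeeze_zero (fun _ => norm_nonneg _) (fun n => ?_) tendsto_one_div_add_atTop_nhds_zero_nat
    rw [norm_sub_rev]
    exact (hlt n).le
  have hlim2 : Tendsto (fun n => toL2 N (H1.ofTest (φ n) (hφ n) (hc n))) atTop (𝓝 (toL2 N u)) :=
    ((toL2 N).continuous.tendsto u).comp hlim
  -- Convergence in `L²` yields an almost everywhere convergent subsequence, along which the `L^q`
  -- norm is lower semicontinuous by Fatou.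
  have hm := tendstoInMeasure_of_tendsto_Lp hlim2
  obtain ⟨ns, hns, hae⟩ := hm.exists_seq_tendsto_ae
  have h1 := Lp.eLpNorm_lim_le_liminf_eLpNorm (p := ENNReal.ofReal q)
    (f := fun n => ⇑(toL2 N (H1.ofTest (φ (ns n)) (hφ (ns n)) (hc (ns n)))))
    (fun n => Lp.aestronglyMeasurable _) _ hae
  refine h1.trans ?_
  have h2 : Tendsto (fun n => ENNReal.ofReal (C * ‖H1.ofTest (φ (ns n)) (hφ (ns n)) (hc (ns n))‖))
      atTop (𝓝 (ENNReal.ofReal (C * ‖u‖))) :=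
    ENNReal.tendsto_ofReal (((hlim.comp hns.tendsto_atTop).norm).const_mul C)
  rw [← h2.liminf_eq]
  refine liminf_le_liminf (Eventually.of_forall fun n => ?_)
  rw [eLpNorm_congr_ae (H1.toL2_ofTest (hφ (ns n)) (hc (ns n)))]
  exact h _ _ _

end Sobolev

/-! ### Weighted bilinear forms on `H¹` and their operators. -/

noncomputable section Weights

attribute [local irreducible] shift toL2 grad

variable {N : ℕ}

/-- The Hilbert space `H¹(ℝ^N)`, with its instances sealed. -/
def Sob (N : ℕ) : Type := H1 N

instance : NormedAddCommGroup (Sob N) := inferInstanceAs (NormedAddCommGroup (H1 N))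

instance : InnerProductSpace ℝ (Sob N) := inferInstanceAs (InnerProductSpace ℝ (H1 N))

instance : CompleteSpace (Sob N) := inferInstanceAs (CompleteSpace (H1 N))

/-- The function underlying an element of `H¹`. -/
def Sob.fn (v : Sob N) : RN N → ℝ := toL2 N v

theorem Sob.memLp_fn (v : Sob N) : MemLp (Sob.fn v) 2 volume := H1.memLp_toL2 v

theorem Sob.aestronglyMeasurable_fn (v : Sob N) : AEStronglyMeasurable (Sob.fn v) volume :=
  (Sob.memLp_fn v).1

theorem H1.toL2_add_ae (u v : H1 N) :
    toL2 N (u + v) =ᵐ[volume] fun x => toL2 N u x + toL2 N v x := by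
  have h : toL2 N (u + v) = toL2 N u + toL2 N v := map_add _ _ _
  rw [h]
  exact Lp.coeFn_add _ _

theorem H1.toL2_smul_ae (c : ℝ) (v : H1 N) :
    toL2 N (c • v) =ᵐ[volume] fun x => c * toL2 N v x := by
  have h : toL2 N (c • v) = c • toL2 N v := map_smul _ _ _
  rw [h]
  exact Lp.coeFn_smul _ _

theorem H1.toL2_sub_ae (u v : H1 N) :
    toL2 N (u - v) =ᵐ[volume] fun x => toL2 N u x - toL2 N v x := by
  have h : toL2 N (u - v) = toL2 N u - toL2 N v := map_sub _ _ _
  rw [h]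
  exact Lp.coeFn_sub _ _

theorem H1.toL2_zero_ae : toL2 N 0 =ᵐ[volume] fun _ => (0 : ℝ) := by
  have h : toL2 N 0 = 0 := map_zero _
  rw [h]
  exact Lp.coeFn_zero _ _ _

theorem Sob.fn_add_ae (u v : Sob N) :
    Sob.fn (u + v) =ᵐ[volume] fun x => Sob.fn u x + Sob.fn v x := H1.toL2_add_ae (N := N) u v

theorem Sob.fn_smul_ae (c : ℝ) (v : Sob N) :
    Sob.fn (c • v) =ᵐ[volume] fun x => c * Sob.fn v x := H1.toL2_smul_ae (N := N) c v

theorem Sob.fn_sub_ae (u v : Sob N) :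
    Sob.fn (u - v) =ᵐ[volume] fun x => Sob.fn u x - Sob.fn v x := H1.toL2_sub_ae (N := N) u v

theorem Sob.fn_zero_ae : Sob.fn (0 : Sob N) =ᵐ[volume] fun _ => (0 : ℝ) := H1.toL2_zero_ae

theorem integral_abs_mul_le_norm (a b : Lp ℝ 2 (volume : Measure (RN N))) :
    ∫ x, |a x * b x| ≤ ‖a‖ * ‖b‖ := by
  have h := (Lp.memLp b).norm
  have h' := (Lp.memLp a).norm
  have h1 : ∫ x, |a x * b x| = inner ℝ h'.toLp h.toLp := by
    rw [L2.inner_def]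
    refine integral_congr_ae ?_
    filter_upwards [h.coeFn_toLp, h'.coeFn_toLp] with x h2 h3
    rw [h2, h3, abs_mul]
    simp [mul_comm]
  rw [h1]
  refine (real_inner_le_norm _ _).trans (le_of_eq ?_)
  rw [Lp.norm_toLp, Lp.norm_toLp, eLpNorm_norm, eLpNorm_norm, ← Lp.norm_def, ← Lp.norm_def]

theorem H1.integral_abs_mul_le (u v : H1 N) :
    ∫ x, |toL2 N u x * toL2 N v x| ≤ ‖u‖ * ‖v‖ := by
  refine (integral_abs_mul_le_norm (toL2 N u) (toL2 N v)).trans ?_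
  have h1 := H1.norm_toL2_le u
  have h2 := H1.norm_toL2_le v
  gcongr

theorem Sob.integral_abs_mul_le (u v : Sob N) : ∫ x, |Sob.fn u x * Sob.fn v x| ≤ ‖u‖ * ‖v‖ :=
  H1.integral_abs_mul_le (N := N) u v

theorem SobolevExponent.exists_eLpNorm_fn_le {q : ℝ} (h : SobolevExponent N q) :
    ∃ C : ℝ, 0 < C ∧ ∀ u : Sob N,
      eLpNorm (Sob.fn u) (ENNReal.ofReal q) volume ≤ ENNReal.ofReal (C * ‖u‖) :=
  h.exists_eLpNorm_le

attribute [local irreducible] Sob.fn Sob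

/-- `w` is a weight for which the form `(v, y) ↦ ∫ w v y` is bounded on `H¹` with constant `c`. -/
structure IsWeight (w : RN N → ℝ) (c : ℝ) : Prop where
  aestronglyMeasurable : AEStronglyMeasurable w volume
  integrable : ∀ v y : Sob N, Integrable (fun x => w x * Sob.fn v x * Sob.fn y x) volume
  integral_le : ∀ v y : Sob N, ∫ x, |w x * Sob.fn v x * Sob.fn y x| ≤ c * ‖v‖ * ‖y‖

/-- Domination passes from one weight to another inside the integral. The later weights `f'(u)`,
`f(u) / u` and `V - 1` are all reduced to constants and powers `|u|^r` in this way. -/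
theorem IsWeight.mono {w w' : RN N → ℝ} {c : ℝ} (h : IsWeight w c)
    (hw' : AEStronglyMeasurable w' volume) (hle : ∀ᵐ x, |w' x| ≤ w x) : IsWeight w' c := by
  have hp : ∀ v y : Sob N, ∀ᵐ x, |w' x * Sob.fn v x * Sob.fn y x| ≤
      |w x * Sob.fn v x * Sob.fn y x| := by
    intro v y
    filter_upwards [hle] with x hx
    rw [abs_mul, abs_mul, abs_mul, abs_mul]
    have : |w' x| ≤ |w x| := hx.trans (le_abs_self _)
    gcongr
  have hi : ∀ v y : Sob N, Integrable (fun x => w' x * Sob.fn v x * Sob.fn y x) volume := by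
    intro v y
    refine (h.integrable v y).mono ?_ ?_
    · exact (hw'.mul (Sob.aestronglyMeasurable_fn _)).mul (Sob.aestronglyMeasurable_fn _)
    · filter_upwards [hp v y] with x hx
      simpa only [Real.norm_eq_abs] using hx
  refine ⟨hw', hi, fun v y => ?_⟩
  exact (integral_mono_ae (hi v y).abs (h.integrable v y).abs (hp v y)).trans (h.integral_le v y)

theorem integrable_mul_mul_add {w w' a b : RN N → ℝ}
    (h : Integrable (fun x => w x * a x * b x) volume)
    (h' : Integrable (fun x => w' x * a x * b x) volume) :
    Integrable (fun x => (w x + w' x) * a x * b x) volume := by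
  have e : (fun x => (w x + w' x) * a x * b x) =
      (fun x => w x * a x * b x) + fun x => w' x * a x * b x := by
    funext x
    simp only [Pi.add_apply]
    ring
  rw [e]
  exact h.add h'

theorem integral_abs_mul_mul_add_le {w w' a b : RN N → ℝ}
    (h : Integrable (fun x => w x * a x * b x) volume)
    (h' : Integrable (fun x => w' x * a x * b x) volume) :
    ∫ x, |(w x + w' x) * a x * b x| ≤ (∫ x, |w x * a x * b x|) + ∫ x, |w' x * a x * b x| := by
  rw [← integral_add h.abs h'.abs]
  refine integral_mono (integrable_mul_mul_add h h').abs (h.abs.add h'.abs) fun x => ?_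
  simp only [add_mul]
  exact abs_add_le _ _

theorem IsWeight.add {w w' : RN N → ℝ} {c c' : ℝ} (h : IsWeight w c) (h' : IsWeight w' c') :
    IsWeight (fun x => w x + w' x) (c + c') := by
  refine ⟨h.1.add h'.1, fun v y => integrable_mul_mul_add (h.2 v y) (h'.2 v y), fun v y => ?_⟩
  refine (integral_abs_mul_mul_add_le (h.2 v y) (h'.2 v y)).trans ?_
  have h1 := h.integral_le v y
  have h2 := h'.integral_le v y
  linarith

theorem integral_abs_const_mul_mul (t : ℝ) (w a b : RN N → ℝ) :
    ∫ x, |t * w x * a x * b x| = |t| * ∫ x, |w x * a x * b x| := by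
  rw [← integral_const_mul]
  refine integral_congr_ae (Eventually.of_forall fun x => ?_)
  simp only [← abs_mul]
  ring_nf

theorem integrable_const_mul_mul (t : ℝ) {w a b : RN N → ℝ}
    (h : Integrable (fun x => w x * a x * b x) volume) :
    Integrable (fun x => t * w x * a x * b x) volume := by
  simpa only [mul_assoc] using h.const_mul t

theorem IsWeight.const_mul {w : RN N → ℝ} {c : ℝ} (h : IsWeight w c) {t : ℝ} (ht : 0 ≤ t) :
    IsWeight (fun x => t * w x) (t * c) := by
  refine ⟨h.1.const_mul t, fun v y => integrable_const_mul_mul t (h.2 v y), fun v y => ?_⟩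
  rw [integral_abs_const_mul_mul, abs_of_nonneg ht]
  have h1 := mul_le_mul_of_nonneg_left (h.integral_le v y) ht
  linarith

theorem isWeight_const {c : ℝ} (hc : 0 ≤ c) : IsWeight (fun _ : RN N => c) c := by
  have hi : ∀ v y : Sob N, Integrable (fun x => 1 * Sob.fn v x * Sob.fn y x) volume := by
    intro v y
    simp only [one_mul]
    exact (Sob.memLp_fn v).integrable_mul (Sob.memLp_fn y)
  have h1 : IsWeight (fun _ : RN N => (1 : ℝ)) 1 := by
    refine ⟨aestronglyMeasurable_const, hi, fun v y => ?_⟩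
    simp only [one_mul]
    exact Sob.integral_abs_mul_le v y
  simpa using h1.const_mul hc

theorem exists_op_of_bilinear {H : Type*} [NormedAddCommGroup H] [InnerProductSpace ℝ H]
    [CompleteSpace H] (b : H →ₗ[ℝ] H →ₗ[ℝ] ℝ) {c : ℝ} (hb : ∀ v y, |b v y| ≤ c * ‖v‖ * ‖y‖) :
    ∃ A : H →L[ℝ] H, ∀ v y, inner ℝ (A v) y = b v y := by
  have hb' : ∀ v y, ‖b v y‖ ≤ c * ‖v‖ * ‖y‖ := hb
  refine ⟨InnerProductSpace.continuousLinearMapOfBilin (LinearMap.mkContinuous₂ b c hb'),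
    fun v y => ?_⟩
  have := InnerProductSpace.continuousLinearMapOfBilin_apply (𝕜 := ℝ)
    (LinearMap.mkContinuous₂ b c hb') v y
  rw [this]
  rfl

theorem integral_mul_add_mul {w a a' b : RN N → ℝ} {s : RN N → ℝ}
    (h : Integrable (fun x => w x * a x * b x) volume)
    (h' : Integrable (fun x => w x * a' x * b x) volume) (hs : s =ᵐ[volume] fun x => a x + a' x) :
    ∫ x, w x * s x * b x = (∫ x, w x * a x * b x) + ∫ x, w x * a' x * b x := by
  rw [← integral_add h h']
  refine integral_congr_ae ?_
  filter_upwards [hs] with x hx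
  simp only [hx]
  ring

theorem integral_mul_smul_mul {w a b : RN N → ℝ} {s : RN N → ℝ} (c : ℝ)
    (hs : s =ᵐ[volume] fun x => c * a x) :
    ∫ x, w x * s x * b x = c * ∫ x, w x * a x * b x := by
  rw [← integral_const_mul]
  refine integral_congr_ae ?_
  filter_upwards [hs] with x hx
  simp only [hx]
  ring

theorem integral_mul_mul_comm (w a b : RN N → ℝ) :
    ∫ x, w x * a x * b x = ∫ x, w x * b x * a x :=
  integral_congr_ae (Eventually.of_forall fun x => by simp only; ring)

theorem IsWeight.exists_op {w : RN N → ℝ} {c : ℝ} (h : IsWeight w c) :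
    ∃ A : Sob N →L[ℝ] Sob N, ∀ v y, inner ℝ (A v) y = ∫ x, w x * Sob.fn v x * Sob.fn y x := by
  have h1 : ∀ v v' y : Sob N, ∫ x, w x * Sob.fn (v + v') x * Sob.fn y x =
      (∫ x, w x * Sob.fn v x * Sob.fn y x) + ∫ x, w x * Sob.fn v' x * Sob.fn y x :=
    fun v v' y => integral_mul_add_mul (h.2 v y) (h.2 v' y) (Sob.fn_add_ae v v')
  have h2 : ∀ (t : ℝ) (v y : Sob N), ∫ x, w x * Sob.fn (t • v) x * Sob.fn y x =
      t * ∫ x, w x * Sob.fn v x * Sob.fn y x :=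
    fun t v y => integral_mul_smul_mul t (Sob.fn_smul_ae t v)
  have h3 : ∀ v y : Sob N, ∫ x, w x * Sob.fn v x * Sob.fn y x =
      ∫ x, w x * Sob.fn y x * Sob.fn v x := fun v y => integral_mul_mul_comm _ _ _
  let b : Sob N →ₗ[ℝ] Sob N →ₗ[ℝ] ℝ :=
    LinearMap.mk₂ ℝ (fun v y => ∫ x, w x * Sob.fn v x * Sob.fn y x) h1 h2
      (fun v y y' => by rw [h3, h1, h3 y v, h3 y' v])
      (fun t v y => by rw [h3, h2, h3 y v, smul_eq_mul])
  refine exists_op_of_bilinear b (c := c) fun v y => ?_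
  exact abs_integral_le_integral_abs.trans (h.integral_le v y)

/-- The operator representing `(v, y) ↦ ∫ w v y` in the `H¹` scalar product; zero if there is
none. -/
def wOp (w : RN N → ℝ) : Sob N →L[ℝ] Sob N :=
  open Classical in
  if h : ∃ A : Sob N →L[ℝ] Sob N, ∀ v y, inner ℝ (A v) y = ∫ x, w x * Sob.fn v x * Sob.fn y x
  then h.choose else 0

theorem IsWeight.inner_wOp {w : RN N → ℝ} {c : ℝ} (h : IsWeight w c) (v y : Sob N) :
    inner ℝ (wOp w v) y = ∫ x, w x * Sob.fn v x * Sob.fn y x := by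
  rw [wOp, dif_pos h.exists_op]
  exact h.exists_op.choose_spec v y

theorem IsWeight.abs_inner_wOp_le {w : RN N → ℝ} {c : ℝ} (h : IsWeight w c) (v y : Sob N) :
    |inner ℝ (wOp w v) y| ≤ c * ‖v‖ * ‖y‖ := by
  rw [h.inner_wOp]
  exact abs_integral_le_integral_abs.trans (h.integral_le v y)

theorem IsWeight.wOp_symm {w : RN N → ℝ} {c : ℝ} (h : IsWeight w c) (v y : Sob N) :
    inner ℝ (wOp w v) y = inner ℝ v (wOp w y) := by
  rw [real_inner_comm (wOp w y) v, h.inner_wOp, h.inner_wOp, integral_mul_mul_comm]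

theorem norm_le_of_forall_inner_le {H : Type*} [NormedAddCommGroup H] [InnerProductSpace ℝ H]
    {x : H} {c : ℝ} (hc : 0 ≤ c) (h : ∀ y, |inner ℝ x y| ≤ c * ‖y‖) : ‖x‖ ≤ c := by
  have h1 := h x
  rw [real_inner_self_eq_norm_sq, abs_of_nonneg (by positivity)] at h1
  rcases (norm_nonneg x).eq_or_lt' with h0 | h0
  · rw [h0]; exact hc
  · nlinarith

theorem IsWeight.norm_wOp_apply_le {w : RN N → ℝ} {c : ℝ} (h : IsWeight w c) (hc : 0 ≤ c)
    (v : Sob N) : ‖wOp w v‖ ≤ c * ‖v‖ :=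
  norm_le_of_forall_inner_le (by positivity) (h.abs_inner_wOp_le v)

theorem IsWeight.norm_wOp_le {w : RN N → ℝ} {c : ℝ} (h : IsWeight w c) (hc : 0 ≤ c) :
    ‖wOp w‖ ≤ c :=
  ContinuousLinearMap.opNorm_le_bound _ hc (h.norm_wOp_apply_le hc)

theorem rpow_mul_mul_le {a b c r : ℝ} (ha : 0 ≤ a) (hb : 0 ≤ b) (hc : 0 ≤ c) (hr : 0 < r) :
    a ^ r * b * c ≤ a ^ (r + 2) + b ^ (r + 2) + c ^ (r + 2) := by
  set m := max a (max b c) with hm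
  have hma : a ≤ m := le_max_left _ _
  have hmb : b ≤ m := (le_max_left _ _).trans (le_max_right _ _)
  have hmc : c ≤ m := (le_max_right _ _).trans (le_max_right _ _)
  have hm0 : 0 ≤ m := ha.trans hma
  have h1 : a ^ r * b * c ≤ m ^ (r + 2) := by
    calc a ^ r * b * c ≤ m ^ r * m * m := by gcongr
      _ = m ^ (r + 2) := by
        rw [Real.rpow_add_of_nonneg hm0 hr.le (by norm_num), Real.rpow_two]
        ring
  refine h1.trans ?_
  have pa := Real.rpow_nonneg ha (r + 2)
  have pb := Real.rpow_nonneg hb (r + 2)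
  have pc := Real.rpow_nonneg hc (r + 2)
  rcases max_choice a (max b c) with h | h
  · rw [hm, h]; linarith
  · rcases max_choice b c with h' | h'
    · rw [hm, h, h']; linarith
    · rw [hm, h, h']; linarith

theorem integrable_rpow_of_eLpNorm_le {g : RN N → ℝ} {q C : ℝ} (hq : 0 < q)
    (hg : AEStronglyMeasurable g volume) (hC : 0 ≤ C)
    (h : eLpNorm g (ENNReal.ofReal q) volume ≤ ENNReal.ofReal C) :
    Integrable (fun x => |g x| ^ q) volume ∧ ∫ x, |g x| ^ q ≤ C ^ q := by
  have hm : MemLp g (ENNReal.ofReal q) volume := ⟨hg, h.trans_lt ENNReal.ofReal_lt_top⟩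
  have h0 : ENNReal.ofReal q ≠ 0 := by simpa using hq
  have hi := hm.integrable_norm_rpow h0 ENNReal.ofReal_ne_top
  rw [ENNReal.toReal_ofReal hq.le] at hi
  refine ⟨hi, ?_⟩
  have h1 := hm.eLpNorm_eq_integral_rpow_norm h0 ENNReal.ofReal_ne_top
  rw [ENNReal.toReal_ofReal hq.le] at h1
  rw [h1] at h
  have hp : 0 ≤ ∫ x, ‖g x‖ ^ q := integral_nonneg fun x => by positivity
  have h2 := (ENNReal.ofReal_le_ofReal_iff hC).1 h
  have h3 := Real.rpow_le_rpow (by positivity) h2 hq.le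
  rw [← Real.rpow_mul hp, inv_mul_cancel₀ hq.ne', Real.rpow_one] at h3
  exact h3

/-- Normalizing the functions by `A`, `B`, `D` before the pointwise inequality turns the three
integrals into `3 C ^ (r + 2)`, and undoing the normalization produces the product. This plays the
role of Hölder's inequality with three factors. -/
theorem integral_rpow_mul_mul_le {a b c : RN N → ℝ} {r C A B D : ℝ} (hr : 0 < r) (hC : 0 ≤ C)
    (hA : 0 < A) (hB : 0 < B) (hD : 0 < D)
    (ha : AEStronglyMeasurable a volume) (hb : AEStronglyMeasurable b volume)
    (hc : AEStronglyMeasurable c volume)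
    (ea : eLpNorm a (ENNReal.ofReal (r + 2)) volume ≤ ENNReal.ofReal (C * A))
    (eb : eLpNorm b (ENNReal.ofReal (r + 2)) volume ≤ ENNReal.ofReal (C * B))
    (ec : eLpNorm c (ENNReal.ofReal (r + 2)) volume ≤ ENNReal.ofReal (C * D)) :
    Integrable (fun x => |a x| ^ r * b x * c x) volume ∧
      ∫ x, |(|a x| ^ r * b x * c x)| ≤ 3 * C ^ (r + 2) * A ^ r * B * D := by
  have hq : 0 < r + 2 := by linarith
  obtain ⟨ia, ja⟩ := integrable_rpow_of_eLpNorm_le hq ha (by positivity) ea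
  obtain ⟨ib, jb⟩ := integrable_rpow_of_eLpNorm_le hq hb (by positivity) eb
  obtain ⟨ic, jc⟩ := integrable_rpow_of_eLpNorm_le hq hc (by positivity) ec
  rw [Real.mul_rpow hC hA.le] at ja
  rw [Real.mul_rpow hC hB.le] at jb
  rw [Real.mul_rpow hC hD.le] at jc
  have pA := Real.rpow_pos_of_pos hA (r + 2)
  have pB := Real.rpow_pos_of_pos hB (r + 2)
  have pD := Real.rpow_pos_of_pos hD (r + 2)
  have pAr := Real.rpow_pos_of_pos hA r
  set G : RN N → ℝ := fun x => (A ^ r * B * D) * ((A ^ (r + 2))⁻¹ * |a x| ^ (r + 2) +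
    (B ^ (r + 2))⁻¹ * |b x| ^ (r + 2) + (D ^ (r + 2))⁻¹ * |c x| ^ (r + 2)) with hG
  have iab := (ia.const_mul (A ^ (r + 2))⁻¹).add (ib.const_mul (B ^ (r + 2))⁻¹)
  have hGi : Integrable G volume :=
    (iab.add (ic.const_mul (D ^ (r + 2))⁻¹)).const_mul _
  have hle : ∀ x, |(|a x| ^ r * b x * c x)| ≤ G x := by
    intro x
    have h1 := rpow_mul_mul_le (a := |a x| / A) (b := |b x| / B) (c := |c x| / D) (by positivity)
      (by positivity) (by positivity) hr
    rw [Real.div_rpow (abs_nonneg _) hA.le, Real.div_rpow (abs_nonneg _) hA.le,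
      Real.div_rpow (abs_nonneg _) hB.le, Real.div_rpow (abs_nonneg _) hD.le] at h1
    have h2 : |(|a x| ^ r * b x * c x)| =
        (A ^ r * B * D) * (|a x| ^ r / A ^ r * (|b x| / B) * (|c x| / D)) := by
      rw [abs_mul, abs_mul, abs_of_nonneg (Real.rpow_nonneg (abs_nonneg (a x)) r)]
      field_simp
    rw [h2, hG]
    refine mul_le_mul_of_nonneg_left (h1.trans (le_of_eq ?_)) (by positivity)
    ring
  have hi : Integrable (fun x => |a x| ^ r * b x * c x) volume := by
    refine hGi.mono' ?_ (Eventually.of_forall hle)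
    have := (Real.continuous_rpow_const hr.le).comp_aestronglyMeasurable
      (continuous_abs.comp_aestronglyMeasurable ha)
    exact (this.mul hb).mul hc
  refine ⟨hi, (integral_mono hi.abs hGi hle).trans ?_⟩
  have eG : ∫ x, G x = (A ^ r * B * D) * ((A ^ (r + 2))⁻¹ * (∫ x, |a x| ^ (r + 2)) +
      (B ^ (r + 2))⁻¹ * (∫ x, |b x| ^ (r + 2)) + (D ^ (r + 2))⁻¹ * ∫ x, |c x| ^ (r + 2)) := by
    rw [hG, integral_const_mul, ← integral_const_mul (A ^ (r + 2))⁻¹,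
      ← integral_const_mul (B ^ (r + 2))⁻¹, ← integral_const_mul (D ^ (r + 2))⁻¹,
      ← integral_add (ia.const_mul _) (ib.const_mul _)]
    congr 1
    exact integral_add iab (ic.const_mul _)
  rw [eG]
  have e : 3 * C ^ (r + 2) * A ^ r * B * D =
      (A ^ r * B * D) * (C ^ (r + 2) + C ^ (r + 2) + C ^ (r + 2)) := by ring
  rw [e]
  have ka : (A ^ (r + 2))⁻¹ * ∫ x, |a x| ^ (r + 2) ≤ C ^ (r + 2) := by
    rw [inv_mul_le_iff₀ pA]; linarith
  have kb : (B ^ (r + 2))⁻¹ * ∫ x, |b x| ^ (r + 2) ≤ C ^ (r + 2) := by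
    rw [inv_mul_le_iff₀ pB]; linarith
  have kc : (D ^ (r + 2))⁻¹ * ∫ x, |c x| ^ (r + 2) ≤ C ^ (r + 2) := by
    rw [inv_mul_le_iff₀ pD]; linarith
  gcongr

theorem integrable_zero_of_ae {g : RN N → ℝ} (h : ∀ᵐ x, g x = 0) :
    Integrable g volume ∧ ∫ x, |g x| ≤ 0 := by
  have h1 : g =ᵐ[volume] 0 := h
  refine ⟨(integrable_zero _ _ _).congr h1.symm, le_of_eq ?_⟩
  refine integral_eq_zero_of_ae ?_
  filter_upwards [h] with x hx
  simp [hx]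

theorem SobolevExponent.exists_isWeight {r : ℝ} (hr : 0 < r) (h : SobolevExponent N (r + 2)) :
    ∃ S : ℝ, 0 < S ∧ ∀ u : Sob N, IsWeight (fun x => |Sob.fn u x| ^ r) (S * ‖u‖ ^ r) := by
  obtain ⟨C, hC, h⟩ := h.exists_eLpNorm_fn_le
  have key : ∀ u v y : Sob N, Integrable (fun x => |Sob.fn u x| ^ r * Sob.fn v x * Sob.fn y x) volume
      ∧ ∫ x, |(|Sob.fn u x| ^ r * Sob.fn v x * Sob.fn y x)| ≤
        3 * C ^ (r + 2) * ‖u‖ ^ r * ‖v‖ * ‖y‖ := by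
    intro u v y
    -- The normalization needs positive norms; if one of the functions is zero the integrand
    -- vanishes almost everywhere, for `u = 0` because `r > 0`.
    by_cases h0 : u = 0 ∨ v = 0 ∨ y = 0
    · have h1 : ∀ᵐ x, |Sob.fn u x| ^ r * Sob.fn v x * Sob.fn y x = 0 := by
        rcases h0 with rfl | rfl | rfl <;> filter_upwards [Sob.fn_zero_ae] with x hx <;>
          rw [hx] <;> simp [hr.ne']
      obtain ⟨h2, h3⟩ := integrable_zero_of_ae h1
      exact ⟨h2, h3.trans (by positivity)⟩
    · push Not at h0
      exact integral_rpow_mul_mul_le hr hC.le (norm_pos_iff.2 h0.1) (norm_pos_iff.2 h0.2.1)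
        (norm_pos_iff.2 h0.2.2) (Sob.aestronglyMeasurable_fn _) (Sob.aestronglyMeasurable_fn _)
        (Sob.aestronglyMeasurable_fn _) (h u) (h v) (h y)
  refine ⟨3 * C ^ (r + 2), by positivity, fun u => ⟨?_, fun v y => (key u v y).1, fun v y => ?_⟩⟩
  · exact (Real.continuous_rpow_const hr.le).comp_aestronglyMeasurable
      (continuous_abs.comp_aestronglyMeasurable (Sob.aestronglyMeasurable_fn _))
  · exact (key u v y).2

end Weights

/-! ### Pointwise estimates for the nonlinearity. -/

noncomputable section Growth

/-- A `C¹` nonlinearity with `f(0) = f'(0) = 0` and `f'(s) = o(|s|^r)` as `|s| → ∞`. -/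
structure HasGrowth (f : ℝ → ℝ) (r : ℝ) : Prop where
  contDiff : ContDiff ℝ 1 f
  zero : f 0 = 0
  deriv_zero : deriv f 0 = 0
  tendsto : Tendsto (fun s : ℝ => deriv f s / |s| ^ r) (cocompact ℝ) (𝓝 0)

namespace HasGrowth

variable {f : ℝ → ℝ} {r : ℝ}

theorem hasDerivAt (h : HasGrowth f r) (s : ℝ) : HasDerivAt f (deriv f s) s :=
  (h.contDiff.differentiable (by norm_num) s).hasDerivAt

theorem continuous_deriv (h : HasGrowth f r) : Continuous (deriv f) :=
  h.contDiff.continuous_deriv le_rfl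

theorem continuous (h : HasGrowth f r) : Continuous f := h.contDiff.continuous

theorem exists_abs_deriv_le (h : HasGrowth f r) {δ : ℝ} (hδ : 0 < δ) :
    ∃ M : ℝ, 1 ≤ M ∧ ∀ s, M ≤ |s| → |deriv f s| ≤ δ * |s| ^ r := by
  have h1 := (Metric.tendsto_nhds.1 h.tendsto) δ hδ
  rw [← Metric.cobounded_eq_cocompact, ← comap_norm_atTop, eventually_comap] at h1
  obtain ⟨M, hM⟩ := eventually_atTop.1 h1
  refine ⟨max M 1, le_max_right _ _, fun s hs => ?_⟩
  have h2 := hM |s| ((le_max_left _ _).trans hs) s rfl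
  have hs0 : 0 < |s| := lt_of_lt_of_le one_pos ((le_max_right _ _).trans hs)
  have h3 : 0 < |s| ^ r := Real.rpow_pos_of_pos hs0 r
  rw [Real.dist_eq, sub_zero, abs_div, abs_of_pos h3, div_lt_iff₀ h3] at h2
  exact h2.le

theorem add_rpow_le {x y : ℝ} (hx : 0 ≤ x) (hy : 0 ≤ y) (hr : 0 < r) :
    (x + y) ^ r ≤ 2 ^ r * (x ^ r + y ^ r) := by
  have hx' := Real.rpow_nonneg hx r
  have hy' := Real.rpow_nonneg hy r
  have h2 : (0 : ℝ) < 2 ^ r := Real.rpow_pos_of_pos two_pos r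
  rcases le_total x y with hxy | hxy
  · calc (x + y) ^ r ≤ (2 * y) ^ r := by gcongr; linarith
      _ = 2 ^ r * y ^ r := Real.mul_rpow two_pos.le hy
      _ ≤ _ := by gcongr; linarith
  · calc (x + y) ^ r ≤ (2 * x) ^ r := by gcongr; linarith
      _ = 2 ^ r * x ^ r := Real.mul_rpow two_pos.le hx
      _ ≤ _ := by gcongr; linarith

/-- On a compact interval `f'` is uniformly continuous, and far out it is `o(|s|^r)`; where `|t|` is
not small the bounded part is absorbed into `C |t|^r`. The arbitrary `δ` in front of the term
without `t` is what yields continuity and differentiability of the superposition operators. -/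
theorem exists_abs_deriv_sub_le (h : HasGrowth f r) (hr : 0 < r) {δ : ℝ} (hδ : 0 < δ) :
    ∃ C : ℝ, 0 ≤ C ∧ ∀ s t, |deriv f (s + t) - deriv f s| ≤ δ * (1 + |s| ^ r) + C * |t| ^ r := by
  have h2r : (0 : ℝ) < 2 ^ r := Real.rpow_pos_of_pos two_pos r
  -- Normalized so that the bound at `s + t`, which costs a factor `2 ^ r`, and the bound at `s` add
  -- up to `δ`.
  set δ₁ := δ / (2 ^ r + 1) with hδ₁
  have hδ₁0 : 0 < δ₁ := by positivity
  have hδ₁e : δ₁ * 2 ^ r + δ₁ = δ := by rw [hδ₁]; field_simp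
  obtain ⟨M, hM1, hM⟩ := h.exists_abs_deriv_le hδ₁0
  obtain ⟨D, hD⟩ := (isCompact_Icc (a := -(M + 1)) (b := M + 1)).exists_bound_of_continuousOn
    h.continuous_deriv.continuousOn
  have hD0 : 0 ≤ D := (norm_nonneg _).trans (hD 0 ⟨by linarith, by linarith⟩)
  have huc := (isCompact_Icc (a := -(M + 1)) (b := M + 1)).uniformContinuousOn_of_continuous
    h.continuous_deriv.continuousOn
  obtain ⟨η₀, hη₀, huc⟩ := Metric.uniformContinuousOn_iff.1 huc δ hδ
  set η := min η₀ 1 with hη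
  have hη0 : 0 < η := lt_min hη₀ one_pos
  have hηr : 0 < η ^ r := Real.rpow_pos_of_pos hη0 r
  have hlarge : ∀ s t, M ≤ |s| → M ≤ |s + t| →
      |deriv f (s + t) - deriv f s| ≤ δ * |s| ^ r + δ * |t| ^ r := by
    intro s t hs hst
    have e1 := hM _ hs
    have e2 := hM _ hst
    have e3 : |s + t| ^ r ≤ 2 ^ r * (|s| ^ r + |t| ^ r) :=
      (Real.rpow_le_rpow (abs_nonneg _) (abs_add_le s t) hr.le).trans
        (add_rpow_le (abs_nonneg s) (abs_nonneg t) hr)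
    have e4 := mul_le_mul_of_nonneg_left e3 hδ₁0.le
    have e5 : 0 ≤ δ₁ * |t| ^ r := by positivity
    have e6 := abs_sub (deriv f (s + t)) (deriv f s)
    rw [← hδ₁e]
    nlinarith
  have hall : ∀ s, |deriv f s| ≤ δ₁ * |s| ^ r + D := by
    intro s
    rcases le_total M |s| with hs | hs
    · linarith [hM s hs]
    · have := hD s ⟨by linarith [neg_abs_le s], by linarith [le_abs_self s]⟩
      rw [Real.norm_eq_abs] at this
      have : 0 ≤ δ₁ * |s| ^ r := by positivity
      linarith
  refine ⟨δ + 2 * D / η ^ r, by positivity, fun s t => ?_⟩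
  have ht0 : 0 ≤ |t| ^ r := by positivity
  have hs0 : 0 ≤ |s| ^ r := by positivity
  rcases le_or_gt η |t| with ht | ht
  · have e1 := hall s
    have e2 := hall (s + t)
    have e3 : |s + t| ^ r ≤ 2 ^ r * (|s| ^ r + |t| ^ r) :=
      (Real.rpow_le_rpow (abs_nonneg _) (abs_add_le s t) hr.le).trans
        (add_rpow_le (abs_nonneg s) (abs_nonneg t) hr)
    have e4 := mul_le_mul_of_nonneg_left e3 hδ₁0.le
    have e5 : 0 ≤ δ₁ * |t| ^ r := by positivity
    have e6 := abs_sub (deriv f (s + t)) (deriv f s)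
    have e7 : 2 * D ≤ 2 * D / η ^ r * |t| ^ r := by
      rw [div_mul_eq_mul_div, le_div_iff₀ hηr]
      exact mul_le_mul_of_nonneg_left (Real.rpow_le_rpow hη0.le ht hr.le) (by positivity)
    have e8 : δ * |t| ^ r = δ₁ * 2 ^ r * |t| ^ r + δ₁ * |t| ^ r := by rw [← hδ₁e]; ring
    have e9 : δ * |s| ^ r = δ₁ * 2 ^ r * |s| ^ r + δ₁ * |s| ^ r := by rw [← hδ₁e]; ring
    nlinarith
  · have hp : 0 ≤ 2 * D / η ^ r * |t| ^ r := by positivity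
    have hq : 0 ≤ δ * |t| ^ r := by positivity
    have hq' : 0 ≤ δ * |s| ^ r := by positivity
    have ht1 : |t| < 1 := ht.trans_le (min_le_right _ _)
    have key : |deriv f (s + t) - deriv f s| ≤ δ ∨
        |deriv f (s + t) - deriv f s| ≤ δ * |s| ^ r + δ * |t| ^ r := by
      -- The interval reaches to `M + 1` so that, as `|t| < 1`, one point leaving it puts both
      -- beyond `M`.
      by_cases hcase : |s| ≤ M + 1 ∧ |s + t| ≤ M + 1
      · left
        have := huc (s + t) (abs_le.1 hcase.2) s (abs_le.1 hcase.1) (by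
          rw [Real.dist_eq, add_sub_cancel_left]
          exact ht.trans_le (min_le_left _ _))
        rw [Real.dist_eq] at this
        exact this.le
      · right
        have e1 : |s| ≤ |s + t| + |t| := by
          have := abs_sub (s + t) t
          rwa [add_sub_cancel_right] at this
        have e2 := abs_add_le s t
        have : M + 1 < |s| ∨ M + 1 < |s + t| := by
          by_contra hcon
          push Not at hcon
          exact hcase hcon
        rcases this with h3 | h3
        · exact hlarge s t (by linarith) (by linarith)
        · exact hlarge s t (by linarith) (by linarith)
    rcases key with hk | hk <;> nlinarith

theorem abs_sub_le_of_abs_deriv_le {g g' : ℝ → ℝ} (hg : ∀ x, HasDerivAt g (g' x) x) {t B : ℝ}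
    (hB : ∀ x, |x| ≤ |t| → |g' x| ≤ B) : |g t - g 0| ≤ B * |t| := by
  have := Convex.norm_image_sub_le_of_norm_hasDerivWithin_le (f := g) (f' := g')
    (s := Metric.closedBall (0 : ℝ) |t|) (C := B) (x := 0) (y := t)
    (fun x _ => (hg x).hasDerivWithinAt)
    (fun x hx => hB x (by simpa using hx)) (convex_closedBall _ _) (by simp) (by simp)
  simpa using this

theorem exists_abs_sub_sub_le (h : HasGrowth f r) (hr : 0 < r) {δ : ℝ} (hδ : 0 < δ) :
    ∃ C : ℝ, 0 ≤ C ∧ ∀ s t,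
      |f (s + t) - f s - deriv f s * t| ≤ (δ * (1 + |s| ^ r) + C * |t| ^ r) * |t| := by
  obtain ⟨C, hC, hle⟩ := h.exists_abs_deriv_sub_le hr hδ
  refine ⟨C, hC, fun s t => ?_⟩
  have := abs_sub_le_of_abs_deriv_le (g := fun x => f (s + x) - deriv f s * x)
    (g' := fun x => deriv f (s + x) - deriv f s) (t := t) (B := δ * (1 + |s| ^ r) + C * |t| ^ r)
    (fun x => by
      have h1 := (h.hasDerivAt (s + x)).comp_const_add s x
      have h2 := (hasDerivAt_id x).const_mul (deriv f s)
      simpa using h1.fun_sub h2)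
    (fun x hx => (hle s x).trans (by gcongr))
  simp only [add_zero, mul_zero, sub_zero] at this
  convert this using 2
  ring

theorem exists_abs_deriv_le_one_add (h : HasGrowth f r) (hr : 0 < r) :
    ∃ C : ℝ, 0 ≤ C ∧ ∀ t, |deriv f t| ≤ 1 + C * |t| ^ r := by
  obtain ⟨C, hC, hle⟩ := h.exists_abs_deriv_sub_le hr one_pos
  refine ⟨C, hC, fun t => ?_⟩
  have := hle 0 t
  simpa [h.deriv_zero, Real.zero_rpow hr.ne'] using this

theorem exists_abs_le (h : HasGrowth f r) (hr : 0 < r) :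
    ∃ C : ℝ, 0 ≤ C ∧ ∀ t, |f t| ≤ (1 + C * |t| ^ r) * |t| := by
  obtain ⟨C, hC, hle⟩ := h.exists_abs_sub_sub_le hr one_pos
  refine ⟨C, hC, fun t => ?_⟩
  have := hle 0 t
  simpa [h.deriv_zero, h.zero, Real.zero_rpow hr.ne'] using this

theorem hasDerivAt_primitive (h : HasGrowth f r) (s : ℝ) :
    HasDerivAt (fun s => ∫ t in (0 : ℝ)..s, f t) (f s) s :=
  intervalIntegral.integral_hasDerivAt_right (h.continuous.intervalIntegrable _ _)
    h.continuous.stronglyMeasurable.stronglyMeasurableAtFilter h.continuous.continuousAt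

/-- No small `δ` is needed: the remainder carries two factors `|t|`, so its integral will be
quadratic in the perturbation. -/
theorem exists_abs_primitive_sub_sub_le (h : HasGrowth f r) (hr : 0 < r) :
    ∃ C : ℝ, 0 ≤ C ∧ ∀ s t, |(∫ x in (0 : ℝ)..(s + t), f x) - (∫ x in (0 : ℝ)..s, f x) - f s * t| ≤
      (C * (1 + |s| ^ r) + C * |t| ^ r) * |t| * |t| := by
  obtain ⟨C, hC, hle⟩ := h.exists_abs_sub_sub_le hr one_pos
  obtain ⟨D, hD, hle'⟩ := h.exists_abs_deriv_le_one_add hr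
  refine ⟨2 + C + D, by positivity, fun s t => ?_⟩
  have := abs_sub_le_of_abs_deriv_le (g := fun x => (∫ y in (0 : ℝ)..(s + x), f y) - f s * x)
    (g' := fun x => f (s + x) - f s) (t := t)
    (B := ((2 + C + D) * (1 + |s| ^ r) + (2 + C + D) * |t| ^ r) * |t|)
    (fun x => by
      have h1 := (h.hasDerivAt_primitive (s + x)).comp_const_add s x
      have h2 := (hasDerivAt_id x).const_mul (f s)
      simpa using h1.fun_sub h2)
    (fun x hx => by
      have e1 := hle s x
      have e2 := hle' s
      have e3 : |f (s + x) - f s| ≤ |f (s + x) - f s - deriv f s * x| + |deriv f s| * |x| := by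
        have := abs_add_le (f (s + x) - f s - deriv f s * x) (deriv f s * x)
        rw [sub_add_cancel, abs_mul] at this
        exact this
      have hs0 : 0 ≤ |s| ^ r := by positivity
      have ht0 : 0 ≤ |t| ^ r := by positivity
      have e4 : |x| ^ r ≤ |t| ^ r := Real.rpow_le_rpow (abs_nonneg _) hx hr.le
      calc |f (s + x) - f s|
          ≤ (1 * (1 + |s| ^ r) + C * |x| ^ r) * |x| + (1 + D * |s| ^ r) * |x| := by
            refine e3.trans (add_le_add e1 ?_)
            gcongr
        _ = (1 * (1 + |s| ^ r) + C * |x| ^ r + (1 + D * |s| ^ r)) * |x| := by ring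
        _ ≤ ((2 + C + D) * (1 + |s| ^ r) + (2 + C + D) * |t| ^ r) * |t| := by
            refine mul_le_mul ?_ hx (abs_nonneg _) (by positivity)
            nlinarith [mul_le_mul_of_nonneg_left e4 hC, mul_nonneg hC hs0, mul_nonneg hD hs0,
              mul_nonneg hD ht0])
  simp only [add_zero, mul_zero, sub_zero] at this
  convert this using 2
  ring

end HasGrowth

/-- For `N ≤ 2` the exponent `p - 2` is raised to an even integer `2 k`, since `r + 2 = 2 (k + 1)`
is then covered by `sobolevExponent_of_le_two`. Raising it only weakens the condition at infinity.
-/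
theorem IsSubcriticalNonlinearity.exists_hasGrowth {N : ℕ} (hN : 1 ≤ N) {f : ℝ → ℝ}
    (hf : IsSubcriticalNonlinearity N f) :
    ∃ r : ℝ, 0 < r ∧ HasGrowth f r ∧ SobolevExponent N (r + 2) := by
  rcases le_or_gt 3 N with h3 | h3
  · have hN' : (3 : ℝ) ≤ N := by exact_mod_cast h3
    refine ⟨2 * (N : ℝ) / ((N : ℝ) - 2) - 2, ?_, ⟨hf.contDiff, hf.zero, hf.deriv_zero,
      hf.growth_of_three_le h3⟩, by simpa using sobolevExponent_of_three_le h3⟩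
    rw [sub_pos, lt_div_iff₀ (by linarith)]
    linarith
  · obtain ⟨p, hp, hlim⟩ := hf.growth_of_le_two (by omega)
    obtain ⟨k, hk⟩ := exists_nat_ge p
    have hk2 : (2 : ℝ) < k := hp.trans_le hk
    refine ⟨2 * (k : ℝ), by linarith, ⟨hf.contDiff, hf.zero, hf.deriv_zero, ?_⟩, ?_⟩
    · rw [tendsto_zero_iff_abs_tendsto_zero] at hlim ⊢
      refine squeeze_zero' (Eventually.of_forall fun s => abs_nonneg _) ?_ hlim
      have h1 : ∀ᶠ s : ℝ in cocompact ℝ, 1 ≤ |s| := by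
        rw [← Metric.cobounded_eq_cocompact, ← comap_norm_atTop, eventually_comap]
        filter_upwards [eventually_ge_atTop 1] with b hb s hs
        rw [← hs] at hb
        exact hb
      filter_upwards [h1] with s hs
      have hs0 : 0 < |s| := by linarith
      simp only [Function.comp, abs_div, abs_of_pos (Real.rpow_pos_of_pos hs0 _)]
      gcongr
      linarith
    · have := sobolevExponent_of_le_two hN (by omega) k
      convert this using 1
      ring

end Growth

/-! ### Superposition operators on `H¹`. -/

noncomputable section Nemytskii

attribute [local irreducible] shift toL2 grad Sob Sob.fn wOp

variable {N : ℕ}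

theorem IsWeight.integrable_of_le {w g : RN N → ℝ} {c : ℝ} {v y : Sob N} (h : IsWeight w c)
    (hgm : AEStronglyMeasurable g volume)
    (hg : ∀ᵐ x, |g x| ≤ w x * |Sob.fn v x| * |Sob.fn y x|) : Integrable g volume := by
  refine (h.integrable v y).mono hgm ?_
  filter_upwards [hg] with x hx
  rw [Real.norm_eq_abs, Real.norm_eq_abs, abs_mul, abs_mul]
  have := le_abs_self (w x)
  exact hx.trans (by gcongr)

theorem IsWeight.abs_integral_le {w g : RN N → ℝ} {c : ℝ} {v y : Sob N} (h : IsWeight w c)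
    (hg : ∀ᵐ x, |g x| ≤ w x * |Sob.fn v x| * |Sob.fn y x|) : |∫ x, g x| ≤ c * ‖v‖ * ‖y‖ := by
  refine le_trans ?_ (h.integral_le v y)
  rw [← Real.norm_eq_abs]
  refine norm_integral_le_of_norm_le (h.integrable v y).abs ?_
  filter_upwards [hg] with x hx
  rw [Real.norm_eq_abs, abs_mul, abs_mul]
  have := le_abs_self (w x)
  exact hx.trans (by gcongr)

theorem integral_sub_sub {a b c : RN N → ℝ} (ha : Integrable a volume) (hb : Integrable b volume)
    (hc : Integrable c volume) :
    (∫ x, a x) - (∫ x, b x) - ∫ x, c x = ∫ x, (a x - b x - c x) := by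
  rw [← integral_sub ha hb]
  exact (integral_sub (ha.sub hb) hc).symm

theorem integral_sub_mul_mul {w w' a b : RN N → ℝ}
    (h : Integrable (fun x => w x * a x * b x) volume)
    (h' : Integrable (fun x => w' x * a x * b x) volume) :
    (∫ x, w x * a x * b x) - ∫ x, w' x * a x * b x = ∫ x, (w x - w' x) * a x * b x := by
  rw [← integral_sub h h']
  refine integral_congr_ae (Eventually.of_forall fun x => ?_)
  simp only
  ring

theorem IsWeight.norm_wOp_sub_le {w w' w₀ : RN N → ℝ} {c c' c₀ : ℝ} (h : IsWeight w c)
    (h' : IsWeight w' c') (h₀ : IsWeight w₀ c₀) (hc₀ : 0 ≤ c₀)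
    (hle : ∀ᵐ x, |w x - w' x| ≤ w₀ x) : ‖wOp w - wOp w'‖ ≤ c₀ := by
  refine ContinuousLinearMap.opNorm_le_bound _ hc₀ fun v =>
    norm_le_of_forall_inner_le (by positivity) fun y => ?_
  rw [sub_apply, inner_sub_left, h.inner_wOp, h'.inner_wOp, integral_sub_mul_mul (h.2 v y) (h'.2 v y)]
  refine h₀.abs_integral_le ?_
  filter_upwards [hle] with x hx
  rw [abs_mul, abs_mul]
  gcongr

/-- The standing assumptions on the nonlinearity: growth of order `r` of `f'`, and boundedness of
the forms with weight `|u|^r`. -/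
structure IsAdmissible (N : ℕ) (f : ℝ → ℝ) (r S : ℝ) : Prop extends HasGrowth f r where
  r_pos : 0 < r
  S_nonneg : 0 ≤ S
  isWeight : ∀ u : Sob N, IsWeight (fun x => |Sob.fn u x| ^ r) (S * ‖u‖ ^ r)

/-- The gradient `u ↦ f(u)` of the nonlinear part of the energy. -/
def nem (f : ℝ → ℝ) (u : Sob N) : Sob N := wOp (fun x => f (Sob.fn u x) / Sob.fn u x) u

/-- The derivative of `nem f`. -/
def nemDeriv (f : ℝ → ℝ) (u : Sob N) : Sob N →L[ℝ] Sob N := wOp (fun x => deriv f (Sob.fn u x))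

theorem nem_def (f : ℝ → ℝ) (u : Sob N) :
    nem f u = wOp (fun x => f (Sob.fn u x) / Sob.fn u x) u := rfl

theorem nemDeriv_def (f : ℝ → ℝ) (u : Sob N) :
    nemDeriv f u = wOp (fun x => deriv f (Sob.fn u x)) := rfl

namespace IsAdmissible

variable {f : ℝ → ℝ} {r S : ℝ}

theorem growthWeight (h : IsAdmissible N f r S) (u v : Sob N) {A B : ℝ} (hA : 0 ≤ A) (hB : 0 ≤ B) :
    IsWeight (fun x => A * (1 + |Sob.fn u x| ^ r) + B * |Sob.fn v x| ^ r)
      (A * (1 + S * ‖u‖ ^ r) + B * (S * ‖v‖ ^ r)) :=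
  (((isWeight_const zero_le_one).add (h.isWeight u)).const_mul hA).add
    ((h.isWeight v).const_mul hB)

theorem growthConst_nonneg (h : IsAdmissible N f r S) (u v : Sob N) {A B : ℝ} (hA : 0 ≤ A)
    (hB : 0 ≤ B) : 0 ≤ A * (1 + S * ‖u‖ ^ r) + B * (S * ‖v‖ ^ r) := by
  have := h.S_nonneg
  positivity

theorem exists_isWeight_deriv (h : IsAdmissible N f r S) :
    ∃ C, 0 ≤ C ∧ ∀ u : Sob N, IsWeight (fun x => deriv f (Sob.fn u x)) (1 + C * (S * ‖u‖ ^ r)) := by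
  obtain ⟨C, hC, hle⟩ := h.exists_abs_deriv_le_one_add h.r_pos
  refine ⟨C, hC, fun u => ?_⟩
  refine ((isWeight_const zero_le_one).add ((h.isWeight u).const_mul hC)).mono ?_ ?_
  · exact h.continuous_deriv.comp_aestronglyMeasurable (Sob.aestronglyMeasurable_fn u)
  · exact Eventually.of_forall fun x => hle _

theorem exists_isWeight_quot (h : IsAdmissible N f r S) :
    ∃ C, 0 ≤ C ∧ ∀ u : Sob N,
      IsWeight (fun x => f (Sob.fn u x) / Sob.fn u x) (1 + C * (S * ‖u‖ ^ r)) := by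
  obtain ⟨C, hC, hle⟩ := h.exists_abs_le h.r_pos
  refine ⟨C, hC, fun u => ?_⟩
  refine ((isWeight_const zero_le_one).add ((h.isWeight u).const_mul hC)).mono ?_ ?_
  · exact ((h.continuous.measurable.div measurable_id).comp_aemeasurable
      (Sob.aestronglyMeasurable_fn u).aemeasurable).aestronglyMeasurable
  · refine Eventually.of_forall fun x => ?_
    rw [abs_div]
    refine div_le_of_le_mul₀ (abs_nonneg _) ?_ (hle _)
    positivity

/-- Where the function vanishes the quotient is `0` by convention, and the right side is zero as
well because `f 0 = 0`. -/
theorem mul_fn_eq (h : IsAdmissible N f r S) (u y : Sob N) (x : RN N) :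
    f (Sob.fn u x) / Sob.fn u x * Sob.fn u x * Sob.fn y x = f (Sob.fn u x) * Sob.fn y x := by
  by_cases h0 : Sob.fn u x = 0
  · simp [h0, h.zero]
  · rw [div_mul_cancel₀ _ h0]

theorem integrable_mul (h : IsAdmissible N f r S) (u y : Sob N) :
    Integrable (fun x => f (Sob.fn u x) * Sob.fn y x) volume := by
  obtain ⟨C, hC, hw⟩ := h.exists_isWeight_quot (N := N)
  exact ((hw u).integrable u y).congr (Eventually.of_forall (h.mul_fn_eq u y))

theorem inner_nem (h : IsAdmissible N f r S) (u y : Sob N) :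
    inner ℝ (nem f u) y = ∫ x, f (Sob.fn u x) * Sob.fn y x := by
  obtain ⟨C, hC, hw⟩ := h.exists_isWeight_quot (N := N)
  rw [nem, (hw u).inner_wOp]
  exact integral_congr_ae (Eventually.of_forall (h.mul_fn_eq u y))

theorem inner_nemDeriv (h : IsAdmissible N f r S) (u v y : Sob N) :
    inner ℝ (nemDeriv f u v) y = ∫ x, deriv f (Sob.fn u x) * Sob.fn v x * Sob.fn y x := by
  obtain ⟨C, hC, hw⟩ := h.exists_isWeight_deriv (N := N)
  exact (hw u).inner_wOp v y

theorem integrable_deriv_mul (h : IsAdmissible N f r S) (u v y : Sob N) :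
    Integrable (fun x => deriv f (Sob.fn u x) * Sob.fn v x * Sob.fn y x) volume := by
  obtain ⟨C, hC, hw⟩ := h.exists_isWeight_deriv (N := N)
  exact (hw u).integrable v y

theorem nemDeriv_symm (h : IsAdmissible N f r S) (u v y : Sob N) :
    inner ℝ (nemDeriv f u v) y = inner ℝ v (nemDeriv f u y) := by
  obtain ⟨C, hC, hw⟩ := h.exists_isWeight_deriv (N := N)
  exact (hw u).wOp_symm v y

theorem exists_norm_nemDeriv_le (h : IsAdmissible N f r S) :
    ∃ C, 0 ≤ C ∧ ∀ u : Sob N, ‖nemDeriv f u‖ ≤ 1 + C * (S * ‖u‖ ^ r) := by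
  obtain ⟨C, hC, hw⟩ := h.exists_isWeight_deriv (N := N)
  have := h.S_nonneg
  exact ⟨C, hC, fun u => (hw u).norm_wOp_le (by positivity)⟩

attribute [local irreducible] nem nemDeriv

theorem exists_norm_nemDeriv_sub_le (h : IsAdmissible N f r S) {δ : ℝ} (hδ : 0 < δ) :
    ∃ C, 0 ≤ C ∧ ∀ u v : Sob N, ‖nemDeriv f (u + v) - nemDeriv f u‖ ≤
      δ * (1 + S * ‖u‖ ^ r) + C * (S * ‖v‖ ^ r) := by
  obtain ⟨D, hD, hw⟩ := h.exists_isWeight_deriv (N := N)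
  obtain ⟨C, hC, hle⟩ := h.exists_abs_deriv_sub_le h.r_pos hδ
  refine ⟨C, hC, fun u v => ?_⟩
  rw [nemDeriv_def, nemDeriv_def]
  refine (hw (u + v)).norm_wOp_sub_le (hw u) (h.growthWeight u v hδ.le hC)
    (h.growthConst_nonneg u v hδ.le hC) ?_
  filter_upwards [Sob.fn_add_ae u v] with x hx
  rw [hx]
  exact hle _ _

theorem exists_norm_nem_sub_sub_le (h : IsAdmissible N f r S) {δ : ℝ} (hδ : 0 < δ) :
    ∃ C, 0 ≤ C ∧ ∀ u v : Sob N, ‖nem f (u + v) - nem f u - nemDeriv f u v‖ ≤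
      (δ * (1 + S * ‖u‖ ^ r) + C * (S * ‖v‖ ^ r)) * ‖v‖ := by
  obtain ⟨C, hC, hle⟩ := h.exists_abs_sub_sub_le h.r_pos hδ
  refine ⟨C, hC, fun u v => ?_⟩
  have h0 := h.growthConst_nonneg u v hδ.le hC
  refine norm_le_of_forall_inner_le (by positivity) fun y => ?_
  rw [inner_sub_left, inner_sub_left, h.inner_nem, h.inner_nem, h.inner_nemDeriv,
    integral_sub_sub (h.integrable_mul _ _) (h.integrable_mul _ _) (h.integrable_deriv_mul _ _ _)]
  refine (h.growthWeight u v hδ.le hC).abs_integral_le ?_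
  filter_upwards [Sob.fn_add_ae u v] with x hx
  have e : f (Sob.fn (u + v) x) * Sob.fn y x - f (Sob.fn u x) * Sob.fn y x -
      deriv f (Sob.fn u x) * Sob.fn v x * Sob.fn y x =
      (f (Sob.fn u x + Sob.fn v x) - f (Sob.fn u x) - deriv f (Sob.fn u x) * Sob.fn v x) * Sob.fn y x := by
    rw [hx]; ring
  rw [e, abs_mul]
  exact mul_le_mul_of_nonneg_right (hle _ _) (abs_nonneg _)

theorem tendsto_norm_rpow {H : Type*} [NormedAddCommGroup H] (hr : 0 < r) :
    Tendsto (fun v : H => ‖v‖ ^ r) (𝓝 0) (𝓝 0) := by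
  have := ((Real.continuous_rpow_const hr.le).comp (continuous_norm (E := H))).tendsto 0
  simpa [Real.zero_rpow hr.ne', Function.comp_def] using this

/-- Smallness comes in two stages: `δ` is fixed first to control the part without `‖v‖ ^ r`, and
only then is `v` taken so small that the constant `C` depending on `δ` does no harm. -/
theorem hasFDerivAt_of_sub_le {H G : Type*} [NormedAddCommGroup H] [NormedSpace ℝ H]
    [NormedAddCommGroup G] [NormedSpace ℝ G] {F : H → G} {L : H →L[ℝ] G} {u : H} {a b : ℝ}
    (hr : 0 < r) (ha : 0 ≤ a)
    (hF : ∀ δ, 0 < δ → ∃ C, ∀ v, ‖F (u + v) - F u - L v‖ ≤ (δ * a + C * (b * ‖v‖ ^ r)) * ‖v‖) :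
    HasFDerivAt F L u := by
  rw [hasFDerivAt_iff_isLittleO_nhds_zero, Asymptotics.isLittleO_iff]
  intro c hc
  obtain ⟨C, hC⟩ := hF (c / (2 * (a + 1))) (by positivity)
  have h1 : Tendsto (fun v : H => C * (b * ‖v‖ ^ r)) (𝓝 0) (𝓝 0) := by
    simpa using ((tendsto_norm_rpow (H := H) hr).const_mul b).const_mul C
  filter_upwards [h1.eventually (gt_mem_nhds (half_pos hc))] with v hv
  refine (hC v).trans ?_
  gcongr
  have h2 : c / (2 * (a + 1)) * a ≤ c / 2 := by
    rw [div_mul_eq_mul_div, div_le_div_iff₀ (by positivity) (by norm_num)]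
    nlinarith
  linarith

theorem hasFDerivAt_nem (h : IsAdmissible N f r S) (u : Sob N) :
    HasFDerivAt (nem f) (nemDeriv f u) u := by
  have := h.S_nonneg
  refine hasFDerivAt_of_sub_le (a := 1 + S * ‖u‖ ^ r) (b := S) h.r_pos (by positivity) fun δ hδ => ?_
  obtain ⟨C, -, hC⟩ := h.exists_norm_nem_sub_sub_le (N := N) hδ
  exact ⟨C, hC u⟩

/-- Continuity is needed uniformly on bounded sets: the sums of translates vary with the
configuration, but their norms stay bounded. -/
theorem nemDeriv_uniform (h : IsAdmissible N f r S) (M δ : ℝ) (hδ : 0 < δ) :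
    ∃ η > 0, ∀ u v : Sob N, ‖u‖ ≤ M → ‖v‖ ≤ η → ‖nemDeriv f (u + v) - nemDeriv f u‖ ≤ δ := by
  have hS := h.S_nonneg
  set a := 1 + S * |M| ^ r with ha
  have ha0 : 0 < a := by positivity
  obtain ⟨C, hC, hle⟩ := h.exists_norm_nemDeriv_sub_le (N := N) (δ := δ / (2 * a)) (by positivity)
  have h1 : Tendsto (fun t : ℝ => C * (S * ‖t‖ ^ r)) (𝓝 0) (𝓝 0) := by
    simpa using ((tendsto_norm_rpow (H := ℝ) h.r_pos).const_mul S).const_mul C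
  obtain ⟨η, hη, hη'⟩ := Metric.eventually_nhds_iff.1 (h1.eventually (gt_mem_nhds (half_pos hδ)))
  refine ⟨η / 2, half_pos hη, fun u v hu hv => (hle u v).trans ?_⟩
  have e1 : C * (S * ‖v‖ ^ r) < δ / 2 := by
    have := hη' (y := ‖v‖) (by rw [dist_zero_right, norm_norm]; linarith)
    rwa [norm_norm] at this
  have e2 : δ / (2 * a) * (1 + S * ‖u‖ ^ r) ≤ δ / (2 * a) * a := by
    have e3 : ‖u‖ ^ r ≤ |M| ^ r :=
      Real.rpow_le_rpow (norm_nonneg _) (hu.trans (le_abs_self M)) h.r_pos.le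
    rw [ha]
    gcongr
  have e4 : δ / (2 * a) * a = δ / 2 := by field_simp
  linarith

theorem nem_uniform (h : IsAdmissible N f r S) (M δ : ℝ) (hδ : 0 < δ) :
    ∃ η > 0, ∀ u v : Sob N, ‖u‖ ≤ M → ‖v‖ ≤ η → ‖nem f (u + v) - nem f u‖ ≤ δ := by
  have hS := h.S_nonneg
  obtain ⟨C, hC, hle⟩ := h.exists_norm_nem_sub_sub_le (N := N) one_pos
  obtain ⟨D, hD, hle'⟩ := h.exists_norm_nemDeriv_le (N := N)
  set K := 1 * (1 + S * |M| ^ r) + C * (S * 1 ^ r) + (1 + D * (S * |M| ^ r)) with hK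
  have hK0 : 0 < K := by positivity
  refine ⟨min 1 (δ / K), by positivity, fun u v hu hv => ?_⟩
  have e3 : ‖u‖ ^ r ≤ |M| ^ r :=
    Real.rpow_le_rpow (norm_nonneg _) (hu.trans (le_abs_self M)) h.r_pos.le
  have e4 : ‖v‖ ^ r ≤ 1 ^ r :=
    Real.rpow_le_rpow (norm_nonneg _) (hv.trans (min_le_left _ _)) h.r_pos.le
  have e5 : ‖nem f (u + v) - nem f u‖ ≤
      ‖nem f (u + v) - nem f u - nemDeriv f u v‖ + ‖nemDeriv f u v‖ := by
    have := norm_add_le (nem f (u + v) - nem f u - nemDeriv f u v) (nemDeriv f u v)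
    rwa [sub_add_cancel] at this
  have e6 : ‖nemDeriv f u v‖ ≤ (1 + D * (S * ‖u‖ ^ r)) * ‖v‖ :=
    (nemDeriv f u).le_of_opNorm_le (hle' u) v
  calc ‖nem f (u + v) - nem f u‖
      ≤ (1 * (1 + S * ‖u‖ ^ r) + C * (S * ‖v‖ ^ r)) * ‖v‖ + (1 + D * (S * ‖u‖ ^ r)) * ‖v‖ :=
        e5.trans (add_le_add (hle u v) e6)
    _ = (1 * (1 + S * ‖u‖ ^ r) + C * (S * ‖v‖ ^ r) + (1 + D * (S * ‖u‖ ^ r))) * ‖v‖ := by ring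
    _ ≤ K * (δ / K) := by
        rw [hK]
        gcongr
        exact hv.trans (min_le_right _ _)
    _ = δ := by field_simp

end IsAdmissible

theorem IsSubcriticalNonlinearity.exists_isAdmissible (hN : 1 ≤ N) {f : ℝ → ℝ}
    (hf : IsSubcriticalNonlinearity N f) : ∃ r S : ℝ, IsAdmissible N f r S := by
  obtain ⟨r, hr, hg, hs⟩ := hf.exists_hasGrowth hN
  obtain ⟨S, hS, hw⟩ := hs.exists_isWeight hr
  exact ⟨r, S, hg, hr, hS.le, hw⟩

end Nemytskii

/-! ### The energy functional and its derivatives in operator form. -/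

noncomputable section Energy

variable {N : ℕ}

/-- The element of `H1 N` underlying an element of `Sob N`. -/
def Sob.toH1 (u : Sob N) : H1 N := u

/-- The weak gradient of an element of `H¹`. -/
def Sob.gr (v : Sob N) : RN N → RN N := grad N v

theorem Sob.memLp_gr (v : Sob N) : MemLp (Sob.gr v) 2 volume := H1.memLp_grad v

theorem integrable_inner_of_memLp {g g' : RN N → RN N} (h : MemLp g 2 volume)
    (h' : MemLp g' 2 volume) : Integrable (fun x => inner ℝ (g x) (g' x)) volume := by
  refine (h.norm.integrable_mul h'.norm).mono (h.1.inner h'.1) (Eventually.of_forall fun x => ?_)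
  rw [Pi.mul_apply, norm_mul, norm_norm, norm_norm]
  exact norm_inner_le_norm _ _

theorem Sob.integrable_inner_gr (u v : Sob N) :
    Integrable (fun x => inner ℝ (Sob.gr u x) (Sob.gr v x)) volume :=
  integrable_inner_of_memLp (Sob.memLp_gr u) (Sob.memLp_gr v)

theorem inner_Lp_eq_integral (a b : Lp ℝ 2 (volume : Measure (RN N))) :
    inner ℝ a b = ∫ x, a x * b x := by
  rw [L2.inner_def]
  refine integral_congr_ae (Eventually.of_forall fun x => ?_)
  exact mul_comm _ _

theorem H1.inner_eq_integral (u v : H1 N) : inner ℝ u v =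
    (∫ x, toL2 N u x * toL2 N v x) + ∫ x, inner ℝ (grad N u x) (grad N v x) :=
  (H1.inner_eq u v).trans (congrArg₂ (· + ·) (inner_Lp_eq_integral _ _) (L2.inner_def _ _))

theorem Sob.inner_eq (u v : Sob N) : inner ℝ u v =
    (∫ x, Sob.fn u x * Sob.fn v x) + ∫ x, inner ℝ (Sob.gr u x) (Sob.gr v x) :=
  H1.inner_eq_integral (N := N) u v

theorem Sob.integral_fn_mul (u v : Sob N) :
    ∫ x, Sob.fn u x * Sob.fn v x = l2inner u.toH1 v.toH1 :=
  (inner_Lp_eq_integral (toL2 N u.toH1) (toL2 N v.toH1)).symm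

theorem Phi_eq (V : RN N → ℝ) (f : ℝ → ℝ) (u : Sob N) : Phi V f u.toH1 =
    (1 / 2) * (∫ x, (inner ℝ (Sob.gr u x) (Sob.gr u x) + V x * Sob.fn u x * Sob.fn u x))
      - ∫ x, ∫ t in (0 : ℝ)..(Sob.fn u x), f t := by
  unfold Phi
  congr 2
  refine integral_congr_ae (Eventually.of_forall fun x => ?_)
  show ‖Sob.gr u x‖ ^ 2 + V x * Sob.fn u x ^ 2 = _
  simp only
  rw [real_inner_self_eq_norm_sq]
  ring

theorem hessianForm_eq_integral (V : RN N → ℝ) (f : ℝ → ℝ) (u : Sob N) (l : ℝ) (v w : Sob N) :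
    hessianForm V f u.toH1 l v.toH1 w.toH1 = ∫ x, (inner ℝ (Sob.gr v x) (Sob.gr w x) +
      (V x - l) * Sob.fn v x * Sob.fn w x - deriv f (Sob.fn u x) * Sob.fn v x * Sob.fn w x) := rfl

theorem formIndex_eq_iSup {H : Type*} [NormedAddCommGroup H] [InnerProductSpace ℝ H]
    (A : H →L[ℝ] H) (E : Submodule ℝ H) (q : H → H → ℝ) (hq : ∀ v w, q v w = inner ℝ (A v) w) :
    (⨆ Z : {Z : Submodule ℝ H // Z ≤ E ∧ ∀ v ∈ Z, v ≠ 0 → q v v < 0},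
      Cardinal.toENat (Module.rank ℝ Z.1)) = formIndex A E := by
  obtain rfl : q = fun v w => inner ℝ (A v) w := funext₂ hq
  rfl

/-- The tangent space as a submodule of `Sob N`. -/
def Sob.tangent (u : Sob N) : Submodule ℝ (Sob N) := tangentSpace u.toH1

theorem Sob.morseIndex_eq {V : RN N → ℝ} {f : ℝ → ℝ} {u : Sob N} {l : ℝ} {A : Sob N →L[ℝ] Sob N}
    (hA : ∀ v w : Sob N, hessianForm V f u.toH1 l v.toH1 w.toH1 = inner ℝ (A v) w) :
    morseIndex V f u.toH1 l = formIndex A (Sob.tangent u) :=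
  formIndex_eq_iSup (H := Sob N) A (Sob.tangent u) (fun v w => hessianForm V f u.toH1 l v.toH1 w.toH1) hA

theorem Sob.mem_tangent {u v : Sob N} : v ∈ Sob.tangent u ↔ l2inner u.toH1 v.toH1 = 0 := Iff.rfl

theorem Sob.isConstrainedCritical_iff {V : RN N → ℝ} {f : ℝ → ℝ} {α : ℝ} {u g : Sob N} {l : ℝ}
    (h : HasFDerivAt (E := Sob N) (fun u : Sob N => Phi V f u.toH1) (innerSL ℝ g) u) :
    IsConstrainedCritical V f α u.toH1 l ↔
      (∀ v : Sob N, l * l2inner u.toH1 v.toH1 = inner ℝ g v) ∧ l2inner u.toH1 u.toH1 = α := by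
  have hs : u.toH1 ∈ Sigma2 N α ↔ l2inner u.toH1 u.toH1 = α := by
    show ‖toL2 N u.toH1‖ ^ 2 = α ↔ inner ℝ (toL2 N u.toH1) (toL2 N u.toH1) = α
    rw [real_inner_self_eq_norm_sq]
  let L : Sob N →L[ℝ] ℝ := l • l2functional u.toH1
  have hL : ∀ v : Sob N, L v = l * l2inner u.toH1 v.toH1 := fun v => rfl
  constructor
  · rintro ⟨h1, h2⟩
    have h2' : HasFDerivAt (E := Sob N) (fun u : Sob N => Phi V f u.toH1) L u := h2
    have h3 := h2'.unique h
    exact ⟨fun v => by rw [← hL, h3]; rfl, hs.1 h1⟩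
  · rintro ⟨h1, h2⟩
    refine ⟨hs.2 h2, ?_⟩
    have h3 : innerSL ℝ g = L := ContinuousLinearMap.ext fun v => by
      rw [hL, h1]; rfl
    rw [h3] at h
    exact h

attribute [local irreducible] shift toL2 grad Sob Sob.fn Sob.gr Sob.tangent wOp nem nemDeriv

/-- The operator representing the `L²` scalar product. -/
def massOp (N : ℕ) : Sob N →L[ℝ] Sob N := wOp (fun _ => 1)

/-- The operator representing `(u, v) ↦ ∫ (∇u · ∇v + V u v)`. -/
def energyOp (V : RN N → ℝ) : Sob N →L[ℝ] Sob N :=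
  ContinuousLinearMap.id ℝ (Sob N) + wOp (fun x => V x - 1)

theorem inner_massOp (u v : Sob N) : inner ℝ (massOp N u) v = l2inner u.toH1 v.toH1 := by
  rw [massOp, (isWeight_const zero_le_one).inner_wOp, ← Sob.integral_fn_mul]
  simp only [one_mul]

theorem massOp_symm (u v : Sob N) : inner ℝ (massOp N u) v = inner ℝ u (massOp N v) :=
  (isWeight_const zero_le_one).wOp_symm u v

theorem IsPeriodicPotential.exists_isWeight {V : RN N → ℝ} (hV : IsPeriodicPotential V) :
    ∃ c, 0 ≤ c ∧ IsWeight (fun x => V x - 1) c := by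
  obtain ⟨c, hc⟩ : ∃ c : ℝ, ∀ᵐ x, |V x| ≤ c := by
    have h1 := hV.memLp.2
    rw [eLpNorm_exponent_top] at h1
    refine ⟨(eLpNormEssSup V volume).toReal, ?_⟩
    filter_upwards [ae_le_eLpNormEssSup (f := V) (μ := volume)] with x hx
    have h2 := ENNReal.toReal_mono h1.ne hx
    rwa [toReal_enorm, Real.norm_eq_abs] at h2
  have hc' : (0 : ℝ) ≤ |c| + 1 := by positivity
  refine ⟨|c| + 1, hc', (isWeight_const hc').mono
    (hV.memLp.1.sub aestronglyMeasurable_const) ?_⟩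
  filter_upwards [hc] with x hx
  have h3 := abs_sub (V x) 1
  rw [abs_one] at h3
  linarith [le_abs_self c]

theorem inner_energyOp {V : RN N → ℝ} (hV : IsPeriodicPotential V) (u v : Sob N) :
    inner ℝ (energyOp V u) v =
      inner ℝ u v + ∫ x, (V x - 1) * Sob.fn u x * Sob.fn v x := by
  obtain ⟨c, -, hw⟩ := hV.exists_isWeight
  rw [energyOp, add_apply, inner_add_left, hw.inner_wOp]
  rfl

theorem energyOp_symm {V : RN N → ℝ} (hV : IsPeriodicPotential V) (u v : Sob N) :
    inner ℝ (energyOp V u) v = inner ℝ u (energyOp V v) := by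
  obtain ⟨c, -, hw⟩ := hV.exists_isWeight
  rw [energyOp, add_apply, add_apply, inner_add_left, inner_add_right, hw.wOp_symm]
  rfl

/-- The `H¹` scalar product already contains one copy of the `L²` product; hence the potential
enters `energyOp` with weight `V - 1`. -/
theorem integral_form_eq {g a b V d : RN N → ℝ} {l : ℝ} (hg : Integrable g volume)
    (hab : Integrable (fun x => a x * b x) volume)
    (hV : Integrable (fun x => (V x - 1) * a x * b x) volume)
    (hd : Integrable (fun x => d x * a x * b x) volume) :
    ∫ x, (g x + (V x - l) * a x * b x - d x * a x * b x) =
      (((∫ x, a x * b x) + ∫ x, g x) + ∫ x, (V x - 1) * a x * b x) - l * (∫ x, a x * b x)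
        - ∫ x, d x * a x * b x := by
  have e : (fun x => g x + (V x - l) * a x * b x - d x * a x * b x) =
      fun x => ((a x * b x + g x) + (V x - 1) * a x * b x) - l * (a x * b x) - d x * a x * b x := by
    funext x
    ring
  have h1 : Integrable (fun x => a x * b x + g x) volume := hab.add hg
  have h2 : Integrable (fun x => (a x * b x + g x) + (V x - 1) * a x * b x) volume := h1.add hV
  have h3 : Integrable (fun x => l * (a x * b x)) volume := hab.const_mul l
  rw [e, ← integral_sub_sub h2 h3 hd, integral_add h1 hV, integral_add hab hg, integral_const_mul]

theorem Sob.integrable_fn_mul (u v : Sob N) :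
    Integrable (fun x => Sob.fn u x * Sob.fn v x) volume :=
  (Sob.memLp_fn u).integrable_mul (Sob.memLp_fn v)

theorem IsAdmissible.hessianForm_eq {f : ℝ → ℝ} {r S : ℝ} (h : IsAdmissible N f r S)
    {V : RN N → ℝ} (hV : IsPeriodicPotential V) (u : Sob N) (l : ℝ) (v w : Sob N) :
    hessianForm V f u.toH1 l v.toH1 w.toH1 =
      inner ℝ ((energyOp V - l • massOp N - nemDeriv f u) v) w := by
  obtain ⟨c, -, hw⟩ := hV.exists_isWeight
  rw [hessianForm_eq_integral, integral_form_eq (Sob.integrable_inner_gr v w)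
    (Sob.integrable_fn_mul v w) (hw.integrable v w) (h.integrable_deriv_mul u v w), sub_apply,
    sub_apply, smul_apply, inner_sub_left, inner_sub_left, real_inner_smul_left, inner_massOp,
    h.inner_nemDeriv, inner_energyOp hV, Sob.inner_eq, Sob.integral_fn_mul]

theorem Phi_eq_sub {V : RN N → ℝ} (hV : IsPeriodicPotential V) (f : ℝ → ℝ) :
    (fun u : Sob N => Phi V f u.toH1) = fun u => (1 / 2) * inner ℝ (energyOp V u) u -
      ∫ x, ∫ t in (0 : ℝ)..(Sob.fn u x), f t := by
  funext u
  obtain ⟨c, -, hw⟩ := hV.exists_isWeight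
  have h1 := integral_form_eq (g := fun x => inner ℝ (Sob.gr u x) (Sob.gr u x)) (a := Sob.fn u)
    (b := Sob.fn u) (V := V) (d := fun _ => 0) (l := 0) (Sob.integrable_inner_gr u u)
    (Sob.integrable_fn_mul u u) (hw.integrable u u) (by simp)
  simp only [sub_zero, zero_mul, integral_zero] at h1
  rw [Phi_eq, h1, inner_energyOp hV, Sob.inner_eq]

theorem hasFDerivAt_quadratic {H : Type*} [NormedAddCommGroup H] [InnerProductSpace ℝ H]
    (A : H →L[ℝ] H) (hA : ∀ v w, inner ℝ (A v) w = inner ℝ v (A w)) (u : H) :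
    HasFDerivAt (fun u => (1 / 2) * inner ℝ (A u) u) (innerSL ℝ (A u)) u := by
  have h0 : HasFDerivAt (fun u : H => A u) A u := A.hasFDerivAt
  have h1 := (h0.inner ℝ (hasFDerivAt_id (𝕜 := ℝ) u)).const_mul (1 / 2 : ℝ)
  refine h1.congr_fderiv ?_
  refine ContinuousLinearMap.ext fun (v : H) => ?_
  simp only [innerSL_apply_apply, smul_apply, ContinuousLinearMap.comp_apply,
    ContinuousLinearMap.prod_apply, fderivInnerCLM_apply, ContinuousLinearMap.id_apply, id_eq,
    smul_eq_mul]
  rw [hA v u, real_inner_comm v]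
  ring

namespace IsAdmissible

variable {f : ℝ → ℝ} {r S : ℝ}

theorem continuous_primitive (h : IsAdmissible N f r S) :
    Continuous fun s => ∫ t in (0 : ℝ)..s, f t :=
  continuous_iff_continuousAt.2 fun s => (h.hasDerivAt_primitive s).continuousAt

theorem integrable_primitive (h : IsAdmissible N f r S) (u : Sob N) :
    Integrable (fun x => ∫ t in (0 : ℝ)..(Sob.fn u x), f t) volume := by
  obtain ⟨C, hC, hle⟩ := h.exists_abs_primitive_sub_sub_le h.r_pos
  refine (h.growthWeight u u hC hC).integrable_of_le (v := u) (y := u)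
    (h.continuous_primitive.comp_aestronglyMeasurable (Sob.aestronglyMeasurable_fn u)) ?_
  refine Eventually.of_forall fun x => ?_
  have h1 := hle 0 (Sob.fn u x)
  rw [zero_add, h.zero, intervalIntegral.integral_same, zero_mul, sub_zero, sub_zero] at h1
  refine h1.trans ?_
  have h2 : |(0 : ℝ)| ^ r = 0 := by rw [abs_zero, Real.zero_rpow h.r_pos.ne']
  have h3 : 0 ≤ |Sob.fn u x| ^ r := by positivity
  rw [h2]
  gcongr

/-- The pointwise remainder is bounded by a growth weight times `|v|²`, so its integral is `O(‖v‖²)`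
near zero. -/
theorem hasFDerivAt_primitive (h : IsAdmissible N f r S) (u : Sob N) :
    HasFDerivAt (fun u : Sob N => ∫ x, ∫ t in (0 : ℝ)..(Sob.fn u x), f t)
      (innerSL ℝ (nem f u)) u := by
  obtain ⟨C, hC, hle⟩ := h.exists_abs_primitive_sub_sub_le h.r_pos
  rw [hasFDerivAt_iff_isLittleO_nhds_zero, Asymptotics.isLittleO_iff]
  intro c hc
  have h1 : Tendsto (fun v : Sob N => (C * (1 + S * ‖u‖ ^ r) + C * (S * ‖v‖ ^ r)) * ‖v‖)
      (𝓝 0) (𝓝 0) := by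
    have h2 := (((tendsto_norm_rpow (H := Sob N) h.r_pos).const_mul S).const_mul C).const_add
      (C * (1 + S * ‖u‖ ^ r))
    have h3 := h2.mul (tendsto_norm_zero (E := Sob N))
    simpa using h3
  filter_upwards [h1.eventually (gt_mem_nhds hc)] with v hv
  refine le_trans ?_ (mul_le_mul_of_nonneg_right hv.le (norm_nonneg v))
  rw [Real.norm_eq_abs, innerSL_apply_apply, h.inner_nem, integral_sub_sub
    (h.integrable_primitive _) (h.integrable_primitive _) (h.integrable_mul _ _)]
  refine (h.growthWeight u v hC hC).abs_integral_le ?_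
  filter_upwards [Sob.fn_add_ae u v] with x hx
  rw [hx]
  exact hle _ _

theorem hasFDerivAt_Phi (h : IsAdmissible N f r S) {V : RN N → ℝ} (hV : IsPeriodicPotential V)
    (u : Sob N) :
    HasFDerivAt (fun u : Sob N => Phi V f u.toH1) (innerSL ℝ (energyOp V u - nem f u)) u := by
  have h1 := (hasFDerivAt_quadratic (energyOp V) (energyOp_symm hV) u).fun_sub
    (h.hasFDerivAt_primitive u)
  rw [Phi_eq_sub hV, map_sub]
  exact h1

theorem isConstrainedCritical_iff (h : IsAdmissible N f r S) {V : RN N → ℝ}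
    (hV : IsPeriodicPotential V) {α : ℝ} {u : Sob N} {l : ℝ} :
    IsConstrainedCritical V f α u.toH1 l ↔
      energyOp V u - l • massOp N u - nem f u = 0 ∧ inner ℝ (massOp N u) u = α := by
  rw [Sob.isConstrainedCritical_iff (h.hasFDerivAt_Phi hV u), inner_massOp]
  refine and_congr_left fun _ => ⟨fun h1 => ?_, fun h1 v => ?_⟩
  · refine ext_inner_right ℝ fun v => ?_
    have h2 := h1 v
    rw [inner_sub_left] at h2
    rw [inner_sub_left, inner_sub_left, real_inner_smul_left, inner_massOp, h2, inner_zero_left]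
    ring
  · have h2 : energyOp V u - nem f u = l • massOp N u := by
      rw [← sub_eq_zero, ← h1]; abel
    rw [h2, real_inner_smul_left, inner_massOp]

theorem morseIndex_eq (h : IsAdmissible N f r S) {V : RN N → ℝ} (hV : IsPeriodicPotential V)
    (u : Sob N) (l : ℝ) : morseIndex V f u.toH1 l =
      formIndex (energyOp V - l • massOp N - nemDeriv f u) (Sob.tangent u) :=
  Sob.morseIndex_eq (h.hessianForm_eq hV u l)

end IsAdmissible

end Energy

/-! ### Lattice translations on `H¹`. -/

noncomputable section Translations

variable {N : ℕ}

/-- Translation by `b` on `Sob N`. -/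
def Sob.translate (b : RN N) : Sob N →ₗᵢ[ℝ] Sob N := H1.shiftIso b

theorem Sob.translate_zero (v : Sob N) : Sob.translate 0 v = v := H1.shift_zero v.toH1

theorem Sob.translate_add (b b' : RN N) (v : Sob N) :
    Sob.translate (b + b') v = Sob.translate b (Sob.translate b' v) := H1.shift_add b b' v.toH1

theorem Sob.fn_translate_ae (b : RN N) (v : Sob N) :
    Sob.fn (Sob.translate b v) =ᵐ[volume] fun x => Sob.fn v (x - b) := H1.shift_toL2_ae b v.toH1

theorem Sob.gr_translate_ae (b : RN N) (v : Sob N) :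
    Sob.gr (Sob.translate b v) =ᵐ[volume] fun x => Sob.gr v (x - b) := H1.shift_grad_ae b v.toH1

theorem Sob.exists_mul {ψ : RN N → ℝ} (hψ : ContDiff ℝ ∞ ψ) {C C' : ℝ} (hC : ∀ x, |ψ x| ≤ C)
    (hC' : ∀ x, ‖gradient ψ x‖ ≤ C') (u : Sob N) :
    ∃ v : Sob N, Sob.fn v =ᵐ[volume] (fun x => ψ x * Sob.fn u x) ∧
      Sob.gr v =ᵐ[volume] fun x => ψ x • Sob.gr u x + Sob.fn u x • gradient ψ x :=
  H1.exists_mul hψ hC hC' u.toH1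

/-- `u` vanishes, with its gradient, outside the ball of radius `R`. -/
def Sob.SuppIn (u : Sob N) (R : ℝ) : Prop :=
  ∀ᵐ x, R ≤ ‖x‖ → Sob.fn u x = 0 ∧ Sob.gr u x = 0

theorem Sob.exists_suppIn_near (u : Sob N) {δ : ℝ} (hδ : 0 < δ) :
    ∃ (φ : Sob N) (R : ℝ), 0 < R ∧ Sob.SuppIn φ R ∧ ‖φ - u‖ < δ := by
  obtain ⟨φ, hφ, hc, h⟩ := H1.exists_test_near u.toH1 hδ
  obtain ⟨R, hR⟩ := hc.isCompact.isBounded.subset_closedBall (0 : RN N)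
  refine ⟨H1.ofTest φ hφ hc, max R 0 + 1, by positivity, ?_, ?_⟩
  · filter_upwards [H1.toL2_ofTest hφ hc, H1.grad_ofTest hφ hc] with x h1 h2 hx
    have h3 : x ∉ tsupport φ := fun hmem => by
      have h4 := hR hmem
      rw [mem_closedBall_zero_iff] at h4
      linarith [le_max_left R 0]
    have h4 : gradient φ x = 0 := by
      rw [← norm_eq_zero, H1.norm_gradient, norm_eq_zero]
      exact image_eq_zero_of_notMem_tsupport fun hmem => h3 (tsupport_fderiv_subset ℝ hmem)
    exact ⟨h1.trans (image_eq_zero_of_notMem_tsupport h3), h2.trans h4⟩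
  · have h5 : ‖H1.ofTest φ hφ hc - u.toH1‖ < δ := by rwa [norm_sub_rev]
    exact h5

attribute [local irreducible] shift toL2 grad Sob Sob.fn Sob.gr Sob.tangent wOp nem nemDeriv
  Sob.translate

theorem Sob.translate_translate_neg (b : RN N) (v : Sob N) :
    Sob.translate b (Sob.translate (-b) v) = v := by
  rw [← Sob.translate_add, add_neg_cancel, Sob.translate_zero]

theorem Sob.inner_translate_left (b : RN N) (v w : Sob N) :
    inner ℝ (Sob.translate b v) w = inner ℝ v (Sob.translate (-b) w) := by
  rw [← (Sob.translate b).inner_map_map v, Sob.translate_translate_neg]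

theorem integral_eq_zero_of_disjoint {E : Type*} [NormedAddCommGroup E] [InnerProductSpace ℝ E]
    {g g' h h' : RN N → E} {b : RN N} {R : ℝ} (hb : 2 * R ≤ ‖b‖)
    (hg : ∀ᵐ x, R ≤ ‖x‖ → g x = 0) (hh : ∀ᵐ x, R ≤ ‖x‖ → h x = 0)
    (hg' : g' =ᵐ[volume] fun x => g (x - b)) (hh' : h' =ᵐ[volume] h) :
    ∫ x, inner ℝ (g' x) (h' x) = 0 := by
  refine integral_eq_zero_of_ae ?_
  filter_upwards [H1.ae_sub_right hg b, hh, hg', hh'] with x h1 h2 h3 h4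
  rw [h3, h4, Pi.zero_apply]
  rcases le_or_gt R ‖x‖ with h5 | h5
  · rw [h2 h5, inner_zero_right]
  · rw [h1 (by have := norm_sub_norm_le b x; rw [norm_sub_rev] at this; linarith), inner_zero_left]

theorem Sob.SuppIn.inner_translate {u v : Sob N} {R : ℝ} (hu : Sob.SuppIn u R)
    (hv : Sob.SuppIn v R) {b : RN N} (hb : 2 * R ≤ ‖b‖) : inner ℝ (Sob.translate b u) v = 0 := by
  have h1 := integral_eq_zero_of_disjoint hb (hu.mono fun x hx h => (hx h).1)
    (hv.mono fun x hx h => (hx h).1) (Sob.fn_translate_ae b u) (ae_eq_refl _)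
  have h2 := integral_eq_zero_of_disjoint hb (hu.mono fun x hx h => (hx h).2)
    (hv.mono fun x hx h => (hx h).2) (Sob.gr_translate_ae b u) (ae_eq_refl _)
  rw [Sob.inner_eq, h2, add_zero, ← h1]
  refine integral_congr_ae (Eventually.of_forall fun x => ?_)
  exact mul_comm _ _

theorem Sob.SuppIn.mono {u : Sob N} {R R' : ℝ} (hu : Sob.SuppIn u R) (h : R ≤ R') :
    Sob.SuppIn u R' :=
  Eventually.mono hu fun _ hx h' => hx (h.trans h')

/-- The filter of lattice points going to infinity. -/
def latticeInfty (N : ℕ) : Filter (Fin N → ℤ) := comap (fun k => ‖latticePoint k‖) atTop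

theorem eventually_latticeInfty (R : ℝ) : ∀ᶠ k in latticeInfty N, R ≤ ‖latticePoint k‖ :=
  tendsto_comap.eventually (eventually_ge_atTop R)

theorem latticePoint_add (k k' : Fin N → ℤ) :
    latticePoint (k + k') = latticePoint k + latticePoint k' := by
  ext i
  simp [latticePoint]

theorem latticePoint_zero : latticePoint (0 : Fin N → ℤ) = 0 := by
  ext i
  simp [latticePoint]

theorem latticePoint_neg (k : Fin N → ℤ) : latticePoint (-k) = -latticePoint k := by
  ext i
  simp [latticePoint]

theorem latticePoint_sub (k k' : Fin N → ℤ) :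
    latticePoint (k - k') = latticePoint k - latticePoint k' := by
  ext i
  simp [latticePoint]

/-- Multiples of the diagonal vector go to infinity; in dimension zero the lattice would be a single
point. -/
theorem latticeInfty_neBot (hN : 1 ≤ N) : (latticeInfty N).NeBot := by
  refine comap_neBot fun t ht => ?_
  obtain ⟨R, hR⟩ := mem_atTop_sets.1 ht
  obtain ⟨n, hn⟩ := exists_nat_ge R
  refine ⟨fun _ => (n : ℤ), hR _ (hn.trans ?_)⟩
  have := PiLp.norm_apply_le (latticePoint (N := N) fun _ => (n : ℤ)) ⟨0, hN⟩
  refine le_trans (le_of_eq ?_) this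
  simp [latticePoint]

/-- Isometries keep the approximation errors uniform in `b`, so it is enough that the pairings of
the approximants eventually vanish. -/
theorem tendsto_inner_of_approx {Γ H : Type*} [NormedAddCommGroup H] [InnerProductSpace ℝ H]
    {l : Filter Γ} (T : Γ → H →ₗᵢ[ℝ] H) {x y : H}
    (h : ∀ δ, 0 < δ → ∃ x' y', ‖x' - x‖ < δ ∧ ‖y' - y‖ < δ ∧
      ∀ᶠ b in l, inner ℝ (T b x') y' = 0) :
    Tendsto (fun b => inner ℝ (T b x) y) l (𝓝 0) := by
  rw [Metric.tendsto_nhds]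
  intro ε hε
  have h0 : 0 < ‖x‖ + ‖y‖ + 1 := by positivity
  obtain ⟨x', y', hx, hy, hb⟩ := h (min 1 (ε / (‖x‖ + ‖y‖ + 1))) (by positivity)
  filter_upwards [hb] with b hb
  rw [Real.dist_eq, sub_zero]
  have e : inner ℝ (T b x) y = -(inner ℝ (T b (x' - x)) y) - inner ℝ (T b x') (y' - y) := by
    rw [map_sub, inner_sub_left, inner_sub_right, hb]
    ring
  have e1 : |inner ℝ (T b (x' - x)) y| ≤ ‖x' - x‖ * ‖y‖ := by
    have := abs_real_inner_le_norm (T b (x' - x)) y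
    rwa [(T b).norm_map] at this
  have e2 : |inner ℝ (T b x') (y' - y)| ≤ ‖x'‖ * ‖y' - y‖ := by
    have := abs_real_inner_le_norm (T b x') (y' - y)
    rwa [(T b).norm_map] at this
  have e3 : ‖x'‖ ≤ ‖x‖ + 1 := by
    have := norm_add_le (x' - x) x
    rw [sub_add_cancel] at this
    linarith [hx.trans_le (min_le_left _ _)]
  have e4 := hx.trans_le (min_le_right _ _)
  have e5 := hy.trans_le (min_le_right _ _)
  rw [e]
  calc |-(inner ℝ (T b (x' - x)) y) - inner ℝ (T b x') (y' - y)|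
      ≤ ‖x' - x‖ * ‖y‖ + ‖x'‖ * ‖y' - y‖ := by
        have := abs_sub (-(inner ℝ (T b (x' - x)) y)) (inner ℝ (T b x') (y' - y))
        rw [abs_neg] at this
        linarith
    _ ≤ ‖x' - x‖ * ‖y‖ + (‖x‖ + 1) * ‖y' - y‖ := by gcongr
    _ < ε := by
        have h5 : (‖x‖ + 1) * ‖y' - y‖ < (‖x‖ + 1) * (ε / (‖x‖ + ‖y‖ + 1)) := by gcongr
        have h6 : ‖x' - x‖ * ‖y‖ ≤ (ε / (‖x‖ + ‖y‖ + 1)) * ‖y‖ := by gcongr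
        have h7 : (ε / (‖x‖ + ‖y‖ + 1)) * ‖y‖ + (‖x‖ + 1) * (ε / (‖x‖ + ‖y‖ + 1)) = ε := by
          field_simp
          ring
        linarith

/-- The action of the lattice `ℤ^N` on `H¹(ℝ^N)` by translations. -/
def latticeAction (N : ℕ) : ShiftAction (Fin N → ℤ) (Sob N) (latticeInfty N) where
  toIso k := Sob.translate (latticePoint k)
  map_zero v := by rw [latticePoint_zero, Sob.translate_zero]
  map_add b b' v := by rw [latticePoint_add, Sob.translate_add]
  tendsto_neg := by
    refine tendsto_comap_iff.2 ?_
    have : (fun k : Fin N → ℤ => ‖latticePoint k‖) ∘ (fun b => -b) =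
        fun k => ‖latticePoint k‖ := by
      funext k
      rw [Function.comp_apply, latticePoint_neg, norm_neg]
    rw [this]
    exact tendsto_comap
  mixing x y := by
    refine tendsto_inner_of_approx _ fun δ hδ => ?_
    obtain ⟨x', R, -, hx', hxd⟩ := Sob.exists_suppIn_near x hδ
    obtain ⟨y', R', -, hy', hyd⟩ := Sob.exists_suppIn_near y hδ
    refine ⟨x', y', hxd, hyd, ?_⟩
    filter_upwards [eventually_latticeInfty (2 * max R R')] with b hb
    exact (hx'.mono (le_max_left _ _)).inner_translate (hy'.mono (le_max_right _ _)) hb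

theorem latticeAction_op (k : Fin N → ℤ) (v : Sob N) :
    (latticeAction N).op k v = Sob.translate (latticePoint k) v := rfl

theorem IsWeight.wOp_translate {w w' : RN N → ℝ} {c c' : ℝ} (h : IsWeight w c)
    (h' : IsWeight w' c') {b : RN N} (hw : ∀ᵐ x, w' x = w (x - b)) (v : Sob N) :
    wOp w' (Sob.translate b v) = Sob.translate b (wOp w v) := by
  refine ext_inner_right ℝ fun y => ?_
  rw [Sob.inner_translate_left, h.inner_wOp, h'.inner_wOp,
    ← integral_sub_right_eq_self (fun x => w x * Sob.fn v x * Sob.fn (Sob.translate (-b) y) x) b]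
  refine integral_congr_ae ?_
  have hy := Sob.fn_translate_ae b (Sob.translate (-b) y)
  rw [Sob.translate_translate_neg] at hy
  filter_upwards [hw, Sob.fn_translate_ae b v, hy] with x h1 h2 h3
  rw [h1, h2, h3]

theorem massOp_translate (b : RN N) (v : Sob N) :
    massOp N (Sob.translate b v) = Sob.translate b (massOp N v) :=
  (isWeight_const zero_le_one).wOp_translate (isWeight_const zero_le_one)
    (Eventually.of_forall fun _ => rfl) v

/-- The almost-everywhere periods of `V` form an additive subgroup; it contains the coordinate
vectors and therefore all lattice points. -/
theorem IsPeriodicPotential.ae_sub_latticePoint {V : RN N → ℝ} (hV : IsPeriodicPotential V)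
    (k : Fin N → ℤ) : ∀ᵐ x, V x = V (x - latticePoint k) := by
  let G : AddSubgroup (RN N) :=
    { carrier := {b | ∀ᵐ x, V x = V (x - b)}
      zero_mem' := by
        show ∀ᵐ x, V x = V (x - 0)
        exact Eventually.of_forall fun x => by rw [sub_zero]
      add_mem' := fun {a b} ha hb => by
        have ha' : ∀ᵐ x, V x = V (x - a) := ha
        have hb' : ∀ᵐ x, V x = V (x - b) := hb
        show ∀ᵐ x, V x = V (x - (a + b))
        filter_upwards [ha', H1.ae_sub_right hb' a] with x h1 h2
        rw [h1, h2, sub_sub]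
      neg_mem' := fun {a} ha => by
        have ha' : ∀ᵐ x, V x = V (x - a) := ha
        show ∀ᵐ x, V x = V (x - -a)
        filter_upwards [H1.ae_sub_right ha' (-a)] with x h1
        rw [h1]
        congr 1
        abel }
  have hG : ∀ i, EuclideanSpace.single i (1 : ℝ) ∈ G := fun i => by
    show ∀ᵐ x, V x = V (x - EuclideanSpace.single i 1)
    filter_upwards [H1.ae_sub_right (hV.periodic i) (EuclideanSpace.single i 1)] with x h1
    rw [← h1, sub_add_cancel]
  have hk : latticePoint k = ∑ i, k i • EuclideanSpace.single i (1 : ℝ) := by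
    ext j
    simp [latticePoint, Finset.sum_apply, Pi.single_apply]
  have : latticePoint k ∈ G := by
    rw [hk]
    exact G.sum_mem fun i _ => G.zsmul_mem (hG i) _
  exact this

theorem energyOp_translate {V : RN N → ℝ} (hV : IsPeriodicPotential V) (k : Fin N → ℤ)
    (v : Sob N) : energyOp V (Sob.translate (latticePoint k) v) =
      Sob.translate (latticePoint k) (energyOp V v) := by
  obtain ⟨c, -, hw⟩ := hV.exists_isWeight
  have h1 := hw.wOp_translate hw (b := latticePoint k)
    ((hV.ae_sub_latticePoint k).mono fun x hx => by rw [← hx]) v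
  rw [energyOp, add_apply, add_apply, map_add, h1]
  rfl

end Translations

/-! ### Splitting of the superposition operators over distant bumps. -/

noncomputable section Locality

attribute [local irreducible] shift toL2 grad Sob Sob.fn Sob.gr Sob.tangent wOp nem nemDeriv
  Sob.translate

variable {N : ℕ}

/-- At most one summand is nonzero. Applied pointwise to translates with disjoint supports, this
gives exact additivity of `f` and `f'` over the bumps. -/
theorem map_sum_of_disjoint {ι : Type*} [Fintype ι] {g : ℝ → ℝ} (hg : g 0 = 0) {s : ι → ℝ}
    (hs : ∀ i j, i ≠ j → s i = 0 ∨ s j = 0) : g (∑ i, s i) = ∑ i, g (s i) := by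
  by_cases h : ∃ i, s i ≠ 0
  · obtain ⟨i, hi⟩ := h
    have h0 : ∀ j, j ≠ i → s j = 0 := fun j hj => (hs j i hj).resolve_right hi
    rw [Finset.sum_eq_single i (fun j _ hj => h0 j hj) (by simp),
      Finset.sum_eq_single i (fun j _ hj => by rw [h0 j hj, hg]) (by simp)]
  · push Not at h
    simp [h, hg]

theorem Sob.fn_sum_ae {ι : Type*} (s : Finset ι) (g : ι → Sob N) :
    Sob.fn (∑ i ∈ s, g i) =ᵐ[volume] fun x => ∑ i ∈ s, Sob.fn (g i) x := by
  classical
  induction s using Finset.induction_on with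
  | empty => simpa using Sob.fn_zero_ae
  | insert i s hi ih =>
    rw [Finset.sum_insert hi]
    filter_upwards [Sob.fn_add_ae (g i) (∑ i ∈ s, g i), ih] with x h1 h2
    rw [h1, h2, Finset.sum_insert hi]

theorem Sob.SuppIn.disjoint {ι : Type*} [Finite ι] {φ : Sob N} {R : ℝ} (hφ : Sob.SuppIn φ R)
    {p : ι → RN N} (hp : ∀ i j, i ≠ j → 2 * R ≤ ‖p i - p j‖) :
    ∀ᵐ x, ∀ i j, i ≠ j → Sob.fn (Sob.translate (p i) φ) x = 0 ∨
      Sob.fn (Sob.translate (p j) φ) x = 0 := by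
  have h1 : ∀ᵐ x, ∀ i, R ≤ ‖x - p i‖ → Sob.fn (Sob.translate (p i) φ) x = 0 := by
    refine ae_all_iff.2 fun i => ?_
    filter_upwards [H1.ae_sub_right hφ (p i), Sob.fn_translate_ae (p i) φ] with x h2 h3 h4
    rw [h3]
    exact (h2 h4).1
  filter_upwards [h1] with x hx i j hij
  by_contra hcon
  push Not at hcon
  have h2 : ‖x - p i‖ < R := not_le.1 fun h => hcon.1 (hx i h)
  have h3 : ‖x - p j‖ < R := not_le.1 fun h => hcon.2 (hx j h)
  have h4 : ‖p i - p j‖ ≤ ‖x - p j‖ + ‖x - p i‖ := by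
    have := norm_sub_le (x - p j) (x - p i)
    rwa [sub_sub_sub_cancel_left] at this
  linarith [hp i j hij]

namespace IsAdmissible

variable {f : ℝ → ℝ} {r S : ℝ}

theorem nem_translate (h : IsAdmissible N f r S) (b : RN N) (u : Sob N) :
    nem f (Sob.translate b u) = Sob.translate b (nem f u) := by
  obtain ⟨C, -, hw⟩ := h.exists_isWeight_quot (N := N)
  rw [nem_def, nem_def]
  refine (hw u).wOp_translate (hw _) ?_ u
  filter_upwards [Sob.fn_translate_ae b u] with x hx
  rw [hx]

theorem nemDeriv_translate (h : IsAdmissible N f r S) (b : RN N) (u v : Sob N) :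
    nemDeriv f (Sob.translate b u) (Sob.translate b v) = Sob.translate b (nemDeriv f u v) := by
  obtain ⟨C, -, hw⟩ := h.exists_isWeight_deriv (N := N)
  rw [nemDeriv_def, nemDeriv_def]
  refine (hw u).wOp_translate (hw _) ?_ v
  filter_upwards [Sob.fn_translate_ae b u] with x hx
  rw [hx]

theorem nem_sum_translate {ι : Type*} [Fintype ι] (h : IsAdmissible N f r S) {φ : Sob N} {R : ℝ}
    (hφ : Sob.SuppIn φ R) {p : ι → RN N} (hp : ∀ i j, i ≠ j → 2 * R ≤ ‖p i - p j‖) :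
    nem f (∑ i, Sob.translate (p i) φ) = ∑ i, Sob.translate (p i) (nem f φ) := by
  refine ext_inner_right ℝ fun y => ?_
  simp only [← h.nem_translate, sum_inner, h.inner_nem]
  rw [← integral_finsetSum _ fun i _ => h.integrable_mul _ y]
  refine integral_congr_ae ?_
  filter_upwards [hφ.disjoint hp, Sob.fn_sum_ae Finset.univ fun i => Sob.translate (p i) φ]
    with x h1 h2
  rw [h2, map_sum_of_disjoint h.zero h1, Finset.sum_mul]

theorem nemDeriv_sum_translate {ι : Type*} [Fintype ι] (h : IsAdmissible N f r S) {φ : Sob N}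
    {R : ℝ} (hφ : Sob.SuppIn φ R) {p : ι → RN N} (hp : ∀ i j, i ≠ j → 2 * R ≤ ‖p i - p j‖) :
    nemDeriv f (∑ i, Sob.translate (p i) φ) = ∑ i, nemDeriv f (Sob.translate (p i) φ) := by
  refine ContinuousLinearMap.ext fun v => ext_inner_right ℝ fun y => ?_
  rw [sum_apply, sum_inner]
  simp only [h.inner_nemDeriv]
  rw [← integral_finsetSum _ fun i _ => h.integrable_deriv_mul _ v y]
  refine integral_congr_ae ?_
  filter_upwards [hφ.disjoint hp, Sob.fn_sum_ae Finset.univ fun i => Sob.translate (p i) φ]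
    with x h1 h2
  rw [h2, map_sum_of_disjoint h.deriv_zero h1, Finset.sum_mul, Finset.sum_mul]

/-- At almost every point either `f'(φ)` or `v` vanishes, because `f'(0) = 0`. -/
theorem nemDeriv_eq_zero (h : IsAdmissible N f r S) {φ v : Sob N} {R : ℝ} (hφ : Sob.SuppIn φ R)
    (hv : ∀ᵐ x, ‖x‖ < R → Sob.fn v x = 0) : nemDeriv f φ v = 0 := by
  refine ext_inner_right ℝ fun y => ?_
  rw [h.inner_nemDeriv, inner_zero_left]
  refine integral_eq_zero_of_ae ?_
  filter_upwards [hφ, hv] with x h1 h2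
  rw [Pi.zero_apply]
  rcases le_or_gt R ‖x‖ with h3 | h3
  · rw [(h1 h3).1, h.deriv_zero, zero_mul, zero_mul]
  · rw [h2 h3, mul_zero, zero_mul]

theorem conj_nemDeriv (h : IsAdmissible N f r S) (k : Fin N → ℤ) (u : Sob N) :
    (latticeAction N).conj k (nemDeriv f u) = nemDeriv f (Sob.translate (latticePoint k) u) := by
  refine ContinuousLinearMap.ext fun v => ?_
  rw [ShiftAction.conj_apply, latticeAction_op, latticeAction_op, ← h.nemDeriv_translate,
    latticePoint_neg, Sob.translate_translate_neg]

/-- Translates of a fixed function along diverging lattice points stay small under `nemDeriv`. -/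
theorem tendsto_nemDeriv_translate (h : IsAdmissible N f r S) (u v : Sob N) :
    Tendsto (fun b => nemDeriv f u ((latticeAction N).op b v)) (latticeInfty N) (𝓝 0) := by
  rw [Metric.tendsto_nhds]
  intro ε hε
  obtain ⟨D, hD, hDle⟩ := h.exists_norm_nemDeriv_le (N := N)
  have hS := h.S_nonneg
  set M := 1 + D * (S * (‖u‖ + 1) ^ r) with hM
  have hM0 : 0 < M := by positivity
  obtain ⟨η, hη, hK⟩ := h.nemDeriv_uniform (N := N) (‖u‖ + 1) (ε / (2 * (‖v‖ + 1))) (by positivity)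
  obtain ⟨φ, R, -, hφ, hφu⟩ := Sob.exists_suppIn_near u (δ := min 1 η) (by positivity)
  obtain ⟨w, R', -, hw, hwv⟩ := Sob.exists_suppIn_near v (δ := ε / (2 * M)) (by positivity)
  have hφ1 : ‖φ‖ ≤ ‖u‖ + 1 := by
    have := norm_add_le (φ - u) u
    rw [sub_add_cancel] at this
    linarith [hφu.trans_le (min_le_left _ _)]
  have hKφ : ‖nemDeriv f φ‖ ≤ M := (hDle φ).trans (by
    have := Real.rpow_le_rpow (norm_nonneg _) hφ1 h.r_pos.le
    rw [hM]; gcongr)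
  have hdiff : ‖nemDeriv f u - nemDeriv f φ‖ ≤ ε / (2 * (‖v‖ + 1)) := by
    have := hK φ (u - φ) hφ1 (by rw [norm_sub_rev]; exact (hφu.trans_le (min_le_right _ _)).le)
    rwa [add_sub_cancel] at this
  filter_upwards [eventually_latticeInfty (2 * max R R')] with b hb
  rw [dist_zero_right, latticeAction_op]
  -- For compactly supported approximants the product vanishes exactly once the supports are apart;
  -- the approximation errors below are uniform in `b`.
  have hzero : nemDeriv f φ (Sob.translate (latticePoint b) w) = 0 := by
    refine h.nemDeriv_eq_zero (hφ.mono (le_max_left R R')) ?_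
    filter_upwards [H1.ae_sub_right (hw.mono (le_max_right R R')) (latticePoint b),
      Sob.fn_translate_ae (latticePoint b) w] with x h1 h2 h3
    rw [h2]
    refine (h1 ?_).1
    have := norm_sub_norm_le (latticePoint b) x
    rw [norm_sub_rev] at this
    linarith
  have e : nemDeriv f u (Sob.translate (latticePoint b) v) =
      (nemDeriv f u - nemDeriv f φ) (Sob.translate (latticePoint b) v) -
        nemDeriv f φ (Sob.translate (latticePoint b) (w - v)) := by
    rw [sub_apply, map_sub, map_sub, hzero]
    abel
  have e1 := (nemDeriv f u - nemDeriv f φ).le_of_opNorm_le hdiff (Sob.translate (latticePoint b) v)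
  have e2 := (nemDeriv f φ).le_of_opNorm_le hKφ (Sob.translate (latticePoint b) (w - v))
  rw [LinearIsometry.norm_map] at e1 e2
  have e3 : ε / (2 * (‖v‖ + 1)) * ‖v‖ ≤ ε / 2 := by
    rw [div_mul_eq_mul_div, div_le_div_iff₀ (by positivity) (by norm_num)]
    nlinarith
  have e4 : M * ‖w - v‖ < M * (ε / (2 * M)) := by gcongr
  have e5 : M * (ε / (2 * M)) = ε / 2 := by field_simp
  rw [e]
  have e6 := norm_sub_le ((nemDeriv f u - nemDeriv f φ) (Sob.translate (latticePoint b) v))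
    (nemDeriv f φ (Sob.translate (latticePoint b) (w - v)))
  linarith

end IsAdmissible

theorem ShiftAction.bump_sub {Γ H ι : Type*} [AddCommGroup Γ] [NormedAddCommGroup H]
    [InnerProductSpace ℝ H] {l : Filter Γ} [Fintype ι] (T : ShiftAction Γ H l) (a : ι → Γ)
    (v w : H) : T.bump a (v - w) = T.bump a v - T.bump a w := by
  simp only [ShiftAction.bump, map_sub, Finset.sum_sub_distrib]

/-- The splitting is exact on a dense set; uniform continuity of `G` on bounded sets and the bound
on `Λ` transfer it to `u` up to a small error. The target `F` is left general to serve both the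
vector-valued `nem` and the operator-valued `nemDeriv`. -/
theorem tendsto_split {Γ H ι F α : Type*} [AddCommGroup Γ] [NormedAddCommGroup H]
    [InnerProductSpace ℝ H] {l : Filter Γ} [Fintype ι] [NormedAddCommGroup F]
    (T : ShiftAction Γ H l) {G : H → F} {Λ : (ι → Γ) → F → F}
    (hsub : ∀ a y y', Λ a (y - y') = Λ a y - Λ a y')
    (hΛ : ∀ a y, ‖Λ a y‖ ≤ Fintype.card ι * ‖y‖)
    (hG : ∀ M δ : ℝ, 0 < δ → ∃ η > 0, ∀ u v, ‖u‖ ≤ M → ‖v‖ ≤ η → ‖G (u + v) - G u‖ ≤ δ)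
    {u : H} {m : Filter α} {a : α → ι → Γ}
    (hdense : ∀ δ, 0 < δ → ∃ φ, ‖φ - u‖ < δ ∧ ∀ᶠ x in m, G (T.bump (a x) φ) = Λ (a x) (G φ)) :
    Tendsto (fun x => G (T.bump (a x) u) - Λ (a x) (G u)) m (𝓝 0) := by
  rw [Metric.tendsto_nhds]
  intro ε hε
  set n : ℝ := (Fintype.card ι : ℝ) with hn
  have hn0 : 0 ≤ n := Nat.cast_nonneg _
  -- The radius is large enough for `φ` and for the sum of its translates; the tolerance accounts
  -- for one direct error and `n` translated ones.
  obtain ⟨η, hη, hu⟩ := hG ((n + 1) * (‖u‖ + 1)) (ε / (2 * (n + 1))) (by positivity)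
  obtain ⟨φ, hφ, hev⟩ := hdense (min 1 (η / (n + 1))) (by positivity)
  have hφ1 : ‖φ‖ ≤ ‖u‖ + 1 := by
    have := norm_add_le (φ - u) u
    rw [sub_add_cancel] at this
    linarith [hφ.trans_le (min_le_left _ _)]
  have hφη : ‖u - φ‖ ≤ η / (n + 1) := by
    rw [norm_sub_rev]
    exact (hφ.trans_le (min_le_right _ _)).le
  filter_upwards [hev] with x hx
  rw [dist_zero_right]
  have e1 : ‖G (T.bump (a x) u) - G (T.bump (a x) φ)‖ ≤ ε / (2 * (n + 1)) := by
    have := hu (T.bump (a x) φ) (T.bump (a x) (u - φ)) ?_ ?_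
    · rwa [T.bump_sub, add_sub_cancel] at this
    · refine (T.norm_bump_le _ _).trans ?_
      exact mul_le_mul (by linarith) hφ1 (norm_nonneg _) (by positivity)
    · refine (T.norm_bump_le _ _).trans ?_
      calc n * ‖u - φ‖ ≤ (n + 1) * (η / (n + 1)) :=
            mul_le_mul (by linarith) hφη (norm_nonneg _) (by positivity)
        _ = η := by field_simp
  have e2 : ‖G u - G φ‖ ≤ ε / (2 * (n + 1)) := by
    have := hu φ (u - φ) ?_ ?_
    · rwa [add_sub_cancel] at this
    · nlinarith [norm_nonneg u]
    · refine hφη.trans (div_le_self hη.le (by linarith))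
  have e3 : G (T.bump (a x) u) - Λ (a x) (G u) =
      (G (T.bump (a x) u) - G (T.bump (a x) φ)) - Λ (a x) (G u - G φ) := by
    rw [hsub, hx]
    abel
  have e4 := (hΛ (a x) (G u - G φ)).trans (mul_le_mul_of_nonneg_left e2 hn0)
  rw [e3]
  have e5 := norm_sub_le (G (T.bump (a x) u) - G (T.bump (a x) φ)) (Λ (a x) (G u - G φ))
  have e6 : ε / (2 * (n + 1)) + n * (ε / (2 * (n + 1))) = ε / 2 := by field_simp; ring
  linarith

theorem eventually_separated {ι α : Type*} [Finite ι] {m : Filter α} {a : α → ι → Fin N → ℤ}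
    (ha : ∀ i j, i ≠ j → Tendsto (fun x => a x i - a x j) m (latticeInfty N)) (R : ℝ) :
    ∀ᶠ x in m, ∀ i j, i ≠ j → R ≤ ‖latticePoint (a x i) - latticePoint (a x j)‖ := by
  refine eventually_all.2 fun i => eventually_all.2 fun j => ?_
  by_cases hij : i = j
  · exact Eventually.of_forall fun x h => absurd hij h
  · filter_upwards [(ha i j hij).eventually (eventually_latticeInfty R)] with x hx _
    rwa [latticePoint_sub] at hx

namespace IsAdmissible

variable {f : ℝ → ℝ} {r S : ℝ}

theorem tendsto_nem_bump {ι α : Type*} [Fintype ι] (h : IsAdmissible N f r S) (u : Sob N)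
    {m : Filter α} {a : α → ι → Fin N → ℤ}
    (ha : ∀ i j, i ≠ j → Tendsto (fun x => a x i - a x j) m (latticeInfty N)) :
    Tendsto (fun x => nem f ((latticeAction N).bump (a x) u) -
      (latticeAction N).bump (a x) (nem f u)) m (𝓝 0) := by
  refine tendsto_split (latticeAction N) (G := nem f) (fun a => (latticeAction N).bump_sub a)
    (fun a => (latticeAction N).norm_bump_le a) h.nem_uniform fun δ hδ => ?_
  obtain ⟨φ, R, -, hφ, hφu⟩ := Sob.exists_suppIn_near u hδ
  refine ⟨φ, hφu, ?_⟩
  filter_upwards [eventually_separated ha (2 * R)] with x hx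
  exact h.nem_sum_translate hφ hx

theorem tendsto_nemDeriv_bump {ι α : Type*} [Fintype ι] (h : IsAdmissible N f r S) (u : Sob N)
    {m : Filter α} {a : α → ι → Fin N → ℤ}
    (ha : ∀ i j, i ≠ j → Tendsto (fun x => a x i - a x j) m (latticeInfty N)) :
    Tendsto (fun x => nemDeriv f ((latticeAction N).bump (a x) u) -
      ∑ i, (latticeAction N).conj (a x i) (nemDeriv f u)) m (𝓝 0) := by
  refine tendsto_split (latticeAction N) (G := nemDeriv f)
    (Λ := fun a A => ∑ i, (latticeAction N).conj (a i) A) (fun a A A' => ?_) (fun a A => ?_)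
    h.nemDeriv_uniform fun δ hδ => ?_
  · rw [← Finset.sum_sub_distrib]
    refine Finset.sum_congr rfl fun i _ => ContinuousLinearMap.ext fun v => ?_
    simp only [ShiftAction.conj_apply, sub_apply, map_sub]
  · refine (norm_sum_le _ _).trans ?_
    refine (Finset.sum_le_sum fun i _ => (latticeAction N).norm_conj_le (a i) A).trans ?_
    rw [Finset.sum_const, nsmul_eq_mul, Finset.card_univ]
  · obtain ⟨φ, R, -, hφ, hφu⟩ := Sob.exists_suppIn_near u hδ
    refine ⟨φ, hφu, ?_⟩
    filter_upwards [eventually_separated ha (2 * R)] with x hx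
    simp only [h.conj_nemDeriv]
    exact h.nemDeriv_sum_translate hφ hx

end IsAdmissible

end Locality

/-! ### Norm decay of the interactions between distant bumps. -/

noncomputable section Decay

attribute [local irreducible] shift toL2 grad Sob Sob.fn Sob.gr Sob.tangent wOp nem nemDeriv
  Sob.translate

variable {N : ℕ}

theorem inner_energyOp_sub_mass {V : RN N → ℝ} (hV : IsPeriodicPotential V) (l : ℝ) (v w : Sob N) :
    Integrable (fun x => inner ℝ (Sob.gr v x) (Sob.gr w x) +
        (V x - l) * Sob.fn v x * Sob.fn w x) volume ∧
      inner ℝ ((energyOp V - l • massOp N) v) w =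
        ∫ x, (inner ℝ (Sob.gr v x) (Sob.gr w x) + (V x - l) * Sob.fn v x * Sob.fn w x) := by
  obtain ⟨c, -, hw⟩ := hV.exists_isWeight
  have h0 := integral_form_eq (g := fun x => inner ℝ (Sob.gr v x) (Sob.gr w x)) (a := Sob.fn v)
    (b := Sob.fn w) (V := V) (d := fun _ => 0) (l := l) (Sob.integrable_inner_gr v w)
    (Sob.integrable_fn_mul v w) (hw.integrable v w) (by simp)
  simp only [sub_zero, zero_mul, integral_zero] at h0
  refine ⟨?_, ?_⟩
  · have h1 : Integrable (fun x => (V x - 1) * Sob.fn v x * Sob.fn w x +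
        (1 - l) * (Sob.fn v x * Sob.fn w x)) volume :=
      (hw.integrable v w).add ((Sob.integrable_fn_mul v w).const_mul (1 - l))
    refine ((Sob.integrable_inner_gr v w).add h1).congr (Eventually.of_forall fun x => ?_)
    simp only [Pi.add_apply]
    ring
  · rw [h0, sub_apply, smul_apply, inner_sub_left, real_inner_smul_left, inner_massOp,
      inner_energyOp hV, Sob.inner_eq, Sob.integral_fn_mul]

/-- With `g = ∇y`, `p = ∇ψ`, `t = ψ` this is the localization identity `|∇(ψ y)|² = ∇y · ∇(ψ² y) +
y² |∇ψ|²`; the potential term is the same on both sides. -/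
theorem inner_smul_add_le {E : Type*} [NormedAddCommGroup E] [InnerProductSpace ℝ E] (g p : E)
    (t y d K : ℝ) (hp : ‖p‖ ≤ K) :
    inner ℝ (t • g + y • p) (t • g + y • p) + d * (t * y) * (t * y) ≤
      (inner ℝ g (t • (t • g + y • p) + (t * y) • p) + d * y * (t * (t * y))) + K ^ 2 * (y * y) := by
  simp only [inner_add_left, inner_add_right, real_inner_smul_left, real_inner_smul_right]
  rw [real_inner_comm g p, real_inner_self_eq_norm_sq p]
  have h1 : ‖p‖ ^ 2 ≤ K ^ 2 := by gcongr
  nlinarith [mul_le_mul_of_nonneg_right h1 (mul_self_nonneg y)]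

/-- Localization: a solution of `B y = g` with `g` orthogonal to functions vanishing near the
origin is small, in the sense of the energy of `ψ y`, away from the origin. -/
theorem inner_cutoff_le {V : RN N → ℝ} (hV : IsPeriodicPotential V) (l : ℝ) {ψ : RN N → ℝ}
    {K : ℝ} (hψK : ∀ x, ‖gradient ψ x‖ ≤ K) {y v w : Sob N}
    (hv : Sob.fn v =ᵐ[volume] fun x => ψ x * Sob.fn y x)
    (hv' : Sob.gr v =ᵐ[volume] fun x => ψ x • Sob.gr y x + Sob.fn y x • gradient ψ x)
    (hw : Sob.fn w =ᵐ[volume] fun x => ψ x * Sob.fn v x)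
    (hw' : Sob.gr w =ᵐ[volume] fun x => ψ x • Sob.gr v x + Sob.fn v x • gradient ψ x) :
    inner ℝ ((energyOp V - l • massOp N) v) v ≤
      inner ℝ ((energyOp V - l • massOp N) y) w + K ^ 2 * ‖y‖ ^ 2 := by
  obtain ⟨i1, e1⟩ := inner_energyOp_sub_mass hV l v v
  obtain ⟨i2, e2⟩ := inner_energyOp_sub_mass hV l y w
  have i3 := (Sob.integrable_fn_mul y y).const_mul (K ^ 2)
  have h1 : (∫ x, (inner ℝ (Sob.gr v x) (Sob.gr v x) + (V x - l) * Sob.fn v x * Sob.fn v x)) ≤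
      (∫ x, (inner ℝ (Sob.gr y x) (Sob.gr w x) + (V x - l) * Sob.fn y x * Sob.fn w x)) +
        ∫ x, K ^ 2 * (Sob.fn y x * Sob.fn y x) := by
    rw [← integral_add i2 i3]
    refine integral_mono_ae i1 (i2.add i3) ?_
    filter_upwards [hv, hv', hw, hw'] with x h1 h2 h3 h4
    rw [h3, h4, h1, h2]
    exact inner_smul_add_le _ _ _ _ _ _ (hψK x)
  rw [e1, e2]
  refine h1.trans ?_
  have h2 : ∫ x, Sob.fn y x * Sob.fn y x ≤ ‖y‖ ^ 2 := by
    rw [← real_inner_self_eq_norm_sq, Sob.inner_eq y y]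
    have : 0 ≤ ∫ x, inner ℝ (Sob.gr y x) (Sob.gr y x) :=
      integral_nonneg fun x => real_inner_self_nonneg
    linarith
  rw [integral_const_mul]
  gcongr

namespace IsAdmissible

variable {f : ℝ → ℝ} {r S : ℝ}

/-- The right-hand side only sees functions on the support of `φ`, so the part `v = (1 - χ) y` of
`y` away from the origin has energy at most `(C / R)² ‖y‖²`. After translation by `b` the part `χ y`
misses the support of `φ`, and only `v` contributes. Coercivity is written with `c ^ 2` so that the
bound for `‖v‖` is linear in `1 / c`. -/
theorem norm_nemDeriv_translate_le (h : IsAdmissible N f r S) {V : RN N → ℝ}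
    (hV : IsPeriodicPotential V) (l : ℝ) {c : ℝ} (hc : 0 < c)
    (hcoer : ∀ v, c ^ 2 * ‖v‖ ^ 2 ≤ inner ℝ ((energyOp V - l • massOp N) v) v) {C : ℝ} (hC : 0 < C)
    (hcut : ∀ R : ℝ, 0 < R → ∀ x, ‖gradient (cutoff N R) x‖ ≤ C / R) {φ g y : Sob N} {ρ R : ℝ}
    (hρ : 0 < ρ) (hφ : Sob.SuppIn φ ρ) (hR : ρ ≤ R)
    (hy : (energyOp V - l • massOp N) y = nemDeriv f φ g) {b : RN N} (hb : 2 * R + ρ ≤ ‖b‖) :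
    ‖nemDeriv f φ (Sob.translate b y)‖ ≤ ‖nemDeriv f φ‖ * (C / (R * c) * ‖y‖) := by
  have hR0 : 0 < R := hρ.trans_le hR
  have hψ : ContDiff ℝ ∞ fun x => 1 - cutoff N R x := contDiff_const.sub (contDiff_cutoff R)
  have hψ1 : ∀ x, |1 - cutoff N R x| ≤ 1 := fun x => by
    have h1 := cutoff_nonneg R x
    have h2 := cutoff_le_one R x
    rw [abs_of_nonneg (by linarith)]
    linarith
  have hψK : ∀ x, ‖gradient (fun x => 1 - cutoff N R x) x‖ ≤ C / R := fun x => by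
    have h1 := hcut R hR0 x
    rw [H1.norm_gradient] at h1 ⊢
    rwa [fderiv_const_sub, norm_neg]
  obtain ⟨v, hv, hv'⟩ := Sob.exists_mul hψ hψ1 hψK y
  obtain ⟨w, hw, hw'⟩ := Sob.exists_mul hψ hψ1 hψK v
  have h1 := inner_cutoff_le hV l hψK hv hv' hw hw'
  have h2 : inner ℝ ((energyOp V - l • massOp N) y) w = 0 := by
    rw [hy, h.nemDeriv_symm, h.nemDeriv_eq_zero hφ, inner_zero_right]
    filter_upwards [hw] with x hx hxρ
    rw [hx, cutoff_eq_one hR0 (by linarith)]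
    ring
  rw [h2, zero_add] at h1
  have h3 : ‖v‖ ≤ C / (R * c) * ‖y‖ := by
    have h4 : (c * ‖v‖) ^ 2 ≤ (C / R * ‖y‖) ^ 2 := by
      rw [mul_pow, mul_pow]
      exact (hcoer v).trans h1
    have h5 := (pow_le_pow_iff_left₀ (by positivity) (by positivity) two_ne_zero).1 h4
    have h6 : C / (R * c) * ‖y‖ = C / R * ‖y‖ / c := by field_simp
    rw [h6, le_div_iff₀ hc]
    linarith
  have h4 : nemDeriv f φ (Sob.translate b y) = nemDeriv f φ (Sob.translate b v) := by
    rw [← sub_eq_zero, ← map_sub, ← map_sub]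
    refine h.nemDeriv_eq_zero hφ ?_
    filter_upwards [Sob.fn_translate_ae b (y - v), H1.ae_sub_right (Sob.fn_sub_ae y v) b,
      H1.ae_sub_right hv b] with x e1 e2 e3 e4
    rw [e1, e2, e3, cutoff_eq_zero hR0]
    · ring
    · have := norm_sub_norm_le b x
      rw [norm_sub_rev] at this
      linarith
  rw [h4]
  refine ((nemDeriv f φ).le_opNorm _).trans ?_
  rw [LinearIsometry.norm_map]
  gcongr

theorem norm_le_of_coercive {H : Type*} [NormedAddCommGroup H] [InnerProductSpace ℝ H]
    {B Binv : H →L[ℝ] H} (hinv : ∀ v, B (Binv v) = v) {c : ℝ} (hc : 0 < c)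
    (hcoer : ∀ v, c * ‖v‖ ^ 2 ≤ inner ℝ (B v) v) : ‖Binv‖ ≤ c⁻¹ := by
  refine ContinuousLinearMap.opNorm_le_bound _ (by positivity) fun v => ?_
  have h1 := hcoer (Binv v)
  rw [hinv] at h1
  have h2 := h1.trans (real_inner_le_norm v (Binv v))
  rw [inv_mul_eq_div, le_div_iff₀ hc]
  rcases (norm_nonneg (Binv v)).eq_or_lt' with h0 | h0
  · rw [h0]; simp
  · nlinarith

theorem norm_comp_perturb_le {H : Type*} [NormedAddCommGroup H] [InnerProductSpace ℝ H]
    {K K' U Q : H →L[ℝ] H} {M q η : ℝ} (hK : ‖K‖ ≤ M) (hK' : ‖K'‖ ≤ M) (hU : ‖U‖ ≤ 1)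
    (hQ : ‖Q‖ ≤ q) (hd : ‖K - K'‖ ≤ η) :
    ‖K ∘L U ∘L Q ∘L K‖ ≤ ‖K' ∘L U ∘L Q ∘L K'‖ + 2 * (η * (1 * (q * M))) := by
  have hM0 : 0 ≤ M := (norm_nonneg _).trans hK
  have hq0 : 0 ≤ q := (norm_nonneg _).trans hQ
  have hη0 : 0 ≤ η := (norm_nonneg _).trans hd
  have e : K ∘L U ∘L Q ∘L K = K' ∘L U ∘L Q ∘L K' + (K - K') ∘L U ∘L Q ∘L K +
      K' ∘L U ∘L Q ∘L (K - K') := by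
    refine ContinuousLinearMap.ext fun v => ?_
    simp only [add_apply, sub_apply, ContinuousLinearMap.comp_apply, map_sub]
    abel
  have hn : ∀ A C : H →L[ℝ] H, ‖A ∘L U ∘L Q ∘L C‖ ≤ ‖A‖ * (‖U‖ * (‖Q‖ * ‖C‖)) := fun A C => by
    refine (ContinuousLinearMap.opNorm_comp_le _ _).trans ?_
    gcongr
    refine (ContinuousLinearMap.opNorm_comp_le _ _).trans ?_
    gcongr
    exact ContinuousLinearMap.opNorm_comp_le _ _
  have h1 : ‖(K - K') ∘L U ∘L Q ∘L K‖ ≤ η * (1 * (q * M)) := (hn _ _).trans (by gcongr)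
  have h2 : ‖K' ∘L U ∘L Q ∘L (K - K')‖ ≤ M * (1 * (q * η)) := (hn _ _).trans (by gcongr)
  rw [e]
  refine (norm_add_le _ _).trans ?_
  have h3 := norm_add_le (K' ∘L U ∘L Q ∘L K') ((K - K') ∘L U ∘L Q ∘L K)
  nlinarith

/-- Interactions between distant translates decay in operator norm. -/
theorem tendsto_norm_nemDeriv_comp (h : IsAdmissible N f r S) {V : RN N → ℝ}
    (hV : IsPeriodicPotential V) (l : ℝ) (u : Sob N) (Binv : Sob N →L[ℝ] Sob N)
    (hinv : ∀ v, (energyOp V - l • massOp N) (Binv v) = v) {c : ℝ} (hc : 0 < c)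
    (hcoer : ∀ v, c * ‖v‖ ^ 2 ≤ inner ℝ ((energyOp V - l • massOp N) v) v) :
    Tendsto (fun b => ‖nemDeriv f u ∘L (latticeAction N).op b ∘L Binv ∘L nemDeriv f u‖)
      (latticeInfty N) (𝓝 0) := by
  rw [Metric.tendsto_nhds]
  intro ε hε
  obtain ⟨C, hC, hcut⟩ := exists_gradient_cutoff_le N
  obtain ⟨D, hD, hDle⟩ := h.exists_norm_nemDeriv_le (N := N)
  have hS := h.S_nonneg
  have hBinv := norm_le_of_coercive hinv hc hcoer
  set M := 1 + D * (S * (‖u‖ + 1) ^ r) with hM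
  have hM0 : 0 < M := by positivity
  obtain ⟨η, hη, hK⟩ := h.nemDeriv_uniform (N := N) (‖u‖ + 1) (ε / (4 * (1 * (c⁻¹ * M))))
    (by positivity)
  obtain ⟨φ, ρ, hρ, hφ, hφu⟩ := Sob.exists_suppIn_near u (δ := min 1 η) (by positivity)
  have hbound : ∀ v : Sob N, ‖v‖ ≤ ‖u‖ + 1 → ‖nemDeriv f v‖ ≤ M := fun v hv =>
    (hDle v).trans (by
      have := Real.rpow_le_rpow (norm_nonneg _) hv h.r_pos.le
      rw [hM]; gcongr)
  have hφ1 : ‖φ‖ ≤ ‖u‖ + 1 := by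
    have := norm_add_le (φ - u) u
    rw [sub_add_cancel] at this
    linarith [hφu.trans_le (min_le_left _ _)]
  have hKφ := hbound φ hφ1
  have hKu := hbound u (by linarith)
  have hdiff : ‖nemDeriv f u - nemDeriv f φ‖ ≤ ε / (4 * (1 * (c⁻¹ * M))) := by
    have := hK φ (u - φ) hφ1 (by rw [norm_sub_rev]; exact (hφu.trans_le (min_le_right _ _)).le)
    rwa [add_sub_cancel] at this
  have hs : 0 < √c := Real.sqrt_pos.2 hc
  set Q := M * (C / √c * (c⁻¹ * M)) with hQ
  have hQ0 : 0 < Q := by positivity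
  -- This radius makes the interaction of the approximants at most `ε / 4`; replacing `u` by `φ` in
  -- both factors costs another `ε / 2`.
  set R := max ρ (4 * Q / ε) with hR
  have hR0 : 0 < R := hρ.trans_le (le_max_left _ _)
  filter_upwards [eventually_latticeInfty (2 * R + ρ)] with b hb
  have hU : ‖(latticeAction N).op b‖ ≤ 1 :=
    ContinuousLinearMap.opNorm_le_bound _ zero_le_one fun v => by
      rw [(latticeAction N).norm_op, one_mul]
  have h1 := norm_comp_perturb_le hKu hKφ hU hBinv hdiff
  have h2 : ‖nemDeriv f φ ∘L (latticeAction N).op b ∘L Binv ∘L nemDeriv f φ‖ ≤ ε / 4 := by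
    refine ContinuousLinearMap.opNorm_le_bound _ (by positivity) fun g => ?_
    simp only [ContinuousLinearMap.comp_apply, latticeAction_op]
    refine (h.norm_nemDeriv_translate_le hV l hs (by rwa [Real.sq_sqrt hc.le]) hC hcut hρ hφ
      (le_max_left _ _) (hinv (nemDeriv f φ g)) hb).trans ?_
    have h3 : ‖Binv (nemDeriv f φ g)‖ ≤ c⁻¹ * (M * ‖g‖) :=
      (Binv.le_of_opNorm_le hBinv _).trans (by
        gcongr
        exact (nemDeriv f φ).le_of_opNorm_le hKφ g)
    have h4 : Q / R ≤ ε / 4 := by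
      rw [div_le_iff₀ hR0]
      have h5 : 4 * Q / ε ≤ R := le_max_right _ _
      rw [div_le_iff₀ hε] at h5
      linarith
    calc ‖nemDeriv f φ‖ * (C / (R * √c) * ‖Binv (nemDeriv f φ g)‖)
        ≤ M * (C / (R * √c) * (c⁻¹ * (M * ‖g‖))) := by gcongr
      _ = Q / R * ‖g‖ := by rw [hQ]; field_simp
      _ ≤ ε / 4 * ‖g‖ := by gcongr
  have h3 : 2 * (ε / (4 * (1 * (c⁻¹ * M))) * (1 * (c⁻¹ * M))) = ε / 2 := by field_simp; norm_num
  rw [dist_zero_right, norm_norm]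
  linarith

end IsAdmissible

end Decay

/-! ### From the free to the constrained linearization; the monotonicity condition. -/

noncomputable section Constrained

section Abstract

variable {H : Type*} [NormedAddCommGroup H] [InnerProductSpace ℝ H]

theorem inner_nonneg_of_formIndex_eq_zero {A : H →L[ℝ] H} (h : formIndex A ⊤ = 0) (v : H) :
    0 ≤ inner ℝ (A v) v := by
  by_contra! hv
  have hv0 : v ≠ 0 := by
    rintro rfl
    simp at hv
  have h1 : ((1 : ℕ) : ℕ∞) ≤ formIndex A ⊤ := by
    refine le_formIndex_iff.2 ⟨Submodule.span ℝ {v}, le_top, ?_, inferInstance,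
      finrank_span_singleton hv0⟩
    intro w hw hw0
    obtain ⟨c, rfl⟩ := Submodule.mem_span_singleton.1 hw
    have hc : c ≠ 0 := by
      rintro rfl
      simp at hw0
    rw [map_smul, real_inner_smul_left, real_inner_smul_right, ← mul_assoc]
    exact mul_neg_of_pos_of_neg (mul_self_pos.2 hc) hv
  rw [h] at h1
  simp at h1

theorem exists_bounded_below_of_bijective [CompleteSpace H] {A : H →L[ℝ] H}
    (hA : Function.Bijective A) : ∃ c : ℝ, 0 < c ∧ ∀ v, c * ‖v‖ ≤ ‖A v‖ := by
  let E := ContinuousLinearEquiv.ofBijective A (LinearMap.ker_eq_bot.2 hA.1)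
    (LinearMap.range_eq_top.2 hA.2)
  have hE : ∀ v, E v = A v := fun v => rfl
  refine ⟨(‖(E.symm : H →L[ℝ] H)‖ + 1)⁻¹, by positivity, fun v => ?_⟩
  have h1 := (E.symm : H →L[ℝ] H).le_opNorm (A v)
  have h2 : (E.symm : H →L[ℝ] H) (A v) = v := by
    rw [← hE]
    exact E.symm_apply_apply v
  rw [h2] at h1
  rw [inv_mul_le_iff₀ (by positivity)]
  nlinarith [norm_nonneg (A v)]

/-- Compression of an invertible symmetric operator `A` to the hyperplane `g^⊥`, `g = A z`, is
invertible if `⟪g, z⟫ ≠ 0`. -/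
theorem exists_equiv_of_hyperplane [CompleteSpace H] {A : H →L[ℝ] H} {E : H ≃L[ℝ] H}
    (hE : (E : H →L[ℝ] H) = A) {z g : H} (hz : A z = g) (hgz : inner ℝ g z ≠ 0)
    {Y : Submodule ℝ H} (hY : ∀ v, v ∈ Y ↔ inner ℝ g v = 0) :
    ∃ A' : Y ≃L[ℝ] Y, ∀ v w : Y, inner ℝ (A' v) w = inner ℝ (A v) (w : H) := by
  have hEA : ∀ v, E v = A v := fun v => by rw [← hE]; rfl
  have hclosed : IsClosed (Y : Set H) := by
    have : (Y : Set H) = {v | inner ℝ g v = 0} := Set.ext hY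
    rw [this]
    exact isClosed_eq (by fun_prop) continuous_const
  have : CompleteSpace Y := hclosed.completeSpace_coe
  have hg : g ≠ 0 := by
    rintro rfl
    simp at hgz
  let b : Y →ₗ[ℝ] Y →ₗ[ℝ] ℝ := LinearMap.mk₂ ℝ (fun v w : Y => inner ℝ (A v) (w : H))
    (fun v v' w => by rw [Submodule.coe_add, map_add, inner_add_left])
    (fun c v w => by rw [Submodule.coe_smul, map_smul, real_inner_smul_left, smul_eq_mul])
    (fun v w w' => by rw [Submodule.coe_add, inner_add_right])
    (fun c v w => by rw [Submodule.coe_smul, real_inner_smul_right, smul_eq_mul])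
  obtain ⟨A', hA'⟩ := exists_op_of_bilinear b (c := ‖A‖) fun v w =>
    (abs_real_inner_le_norm _ _).trans (by
      have := A.le_opNorm v
      have h2 : ‖(w : H)‖ = ‖w‖ := rfl
      have h3 : ‖(v : H)‖ = ‖v‖ := rfl
      rw [h3] at this
      rw [h2]
      gcongr)
  have hA'' : ∀ v w : Y, inner ℝ (A' v) w = inner ℝ (A v) (w : H) := hA'
  have hinj : Function.Injective A' := by
    refine (injective_iff_map_eq_zero A').2 fun v hv => ?_
    have h1 : ∀ w, inner ℝ g w = 0 → inner ℝ (A v) w = 0 := fun w hw => by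
      have := hA'' v ⟨w, (hY w).2 hw⟩
      rw [hv, inner_zero_left] at this
      exact this.symm
    -- If the compression kills `v`, then `A v` is orthogonal to `g^⊥`, so `A v = c g` and `v = c
    -- z`; the constraint `⟪g, v⟫ = 0` then forces `c = 0`.
    set c := inner ℝ g (A v) / ‖g‖ ^ 2 with hc
    have hg2 : ‖g‖ ^ 2 ≠ 0 := by positivity
    have h2 : inner ℝ g (A v - c • g) = 0 := by
      rw [inner_sub_right, real_inner_smul_right, real_inner_self_eq_norm_sq, hc]
      field_simp
      ring
    have h3 : A v - c • g = 0 := by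
      have h4 : inner ℝ (A v - c • g) (A v - c • g) = (0 : ℝ) := by
        rw [inner_sub_left, real_inner_smul_left, h2, h1 _ h2]
        ring
      exact inner_self_eq_zero.1 h4
    have h4 : (v : H) = c • z := by
      apply E.injective
      rw [hEA, hEA, map_smul, hz, ← sub_eq_zero, h3]
    have h5 := (hY v).1 v.2
    rw [h4, real_inner_smul_right] at h5
    have h6 : c = 0 := (mul_eq_zero.1 h5).resolve_right hgz
    rw [h6, zero_smul] at h4
    exact Subtype.ext h4
  have hsurj : Function.Surjective A' := by
    intro y
    -- Correcting `A⁻¹ y` by a multiple of `z` restores the constraint and changes the image only by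
    -- a multiple of `g`, which is invisible on `Y`.
    set c := inner ℝ g (E.symm y) / inner ℝ g z with hc
    have h1 : E.symm y - c • z ∈ Y := by
      rw [hY, inner_sub_right, real_inner_smul_right, hc]
      field_simp
      ring
    refine ⟨⟨_, h1⟩, ext_inner_right ℝ fun w => ?_⟩
    have h2 : A (E.symm y) = y := by rw [← hEA, E.apply_symm_apply]
    rw [hA'']
    show inner ℝ (A (E.symm y - c • z)) (w : H) = inner ℝ (y : H) (w : H)
    rw [map_sub, map_smul, hz, h2, inner_sub_left, real_inner_smul_left, (hY w).1 w.2]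
    ring
  exact ⟨ContinuousLinearEquiv.ofBijective A' (LinearMap.ker_eq_bot.2 hinj)
    (LinearMap.range_eq_top.2 hsurj), hA''⟩

end Abstract

/-- Monotonicity gives a nonnegative derivative of `f(s) / |s|` away from zero; multiplied by `|s|³`
it becomes `f'(s) s² - f(s) s ≥ 0`. -/
theorem IsMonotoneNonlinearity.mul_le {f : ℝ → ℝ} (hf : IsMonotoneNonlinearity f)
    (hd : Differentiable ℝ f) (s : ℝ) : f s * s ≤ deriv f s * s * s := by
  by_cases hs : s = 0
  · simp [hs]
  have h1 : HasDerivAt (fun s => f s / |s|)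
      ((deriv f s * |s| - f s * (SignType.sign s : ℝ)) / |s| ^ 2) s :=
    (hd s).hasDerivAt.fun_div (hasDerivAt_abs hs) (abs_ne_zero.2 hs)
  have h2 := hf.monotoneOn.derivWithin_nonneg (x := s)
  rw [derivWithin_of_isOpen isOpen_compl_singleton hs, h1.deriv] at h2
  have hs2 : 0 < |s| ^ 2 := by positivity
  have h3 := mul_nonneg h2 hs2.le
  rw [div_mul_cancel₀ _ hs2.ne'] at h3
  have h4 := mul_nonneg h3 (abs_nonneg s)
  have h5 : (SignType.sign s : ℝ) * |s| = s := sign_mul_abs s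
  have h6 : |s| * |s| = s * s := abs_mul_abs_self s
  have e : (deriv f s * |s| - f s * (SignType.sign s : ℝ)) * |s| = deriv f s * s * s - f s * s := by
    linear_combination deriv f s * h6 - f s * h5
  linarith

end Constrained

/-! ### Assembly of the theorem. -/

noncomputable section Multibump

variable {N : ℕ}

theorem toH1_bump {n : ℕ} (a : Fin n → Fin N → ℤ) (u : Sob N) :
    ((latticeAction N).bump a u).toH1 = bumpSum a u.toH1 := rfl

theorem Sob.norm_toH1_sub (u v : Sob N) : ‖u.toH1 - v.toH1‖ = ‖u - v‖ := rfl

theorem Sob.isLinearizedSolution_iff {V : RN N → ℝ} {f : ℝ → ℝ} {u : Sob N} {l : ℝ}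
    {A : Sob N →L[ℝ] Sob N} (hA : ∀ v w : Sob N,
      hessianForm V f u.toH1 l v.toH1 w.toH1 = inner ℝ (A v) w)
    {g : StrongDual ℝ (H1 N)} {g' z : Sob N} (hg : ∀ w : Sob N, g w.toH1 = inner ℝ g' w) :
    IsLinearizedSolution V f u.toH1 l g z.toH1 ↔ A z = g' := by
  constructor
  · intro h
    refine ext_inner_right ℝ fun w => ?_
    rw [← hA, ← hg]
    exact h w.toH1
  · intro h w
    have h1 := hA z w
    rw [h] at h1
    exact h1.trans (hg w).symm

/-- Riesz representatives as functionals on `H1 N`. -/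
theorem Sob.exists_dual (g : Sob N) : ∃ g' : StrongDual ℝ (H1 N), ∀ w : Sob N,
    g' w.toH1 = inner ℝ g w := ⟨innerSL ℝ g.toH1, fun _ => rfl⟩

theorem Sob.bijective_of_isFullyNondegenerate {V : RN N → ℝ} {f : ℝ → ℝ} {u : Sob N} {l : ℝ}
    {A : Sob N →L[ℝ] Sob N} (hA : ∀ v w : Sob N,
      hessianForm V f u.toH1 l v.toH1 w.toH1 = inner ℝ (A v) w)
    (h : IsFullyNondegenerate V f u.toH1 l) : Function.Bijective A := by
  refine Function.bijective_iff_existsUnique A |>.2 fun g => ?_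
  obtain ⟨g', hg'⟩ := Sob.exists_dual g
  obtain ⟨z, hz, hu⟩ := h.existsUnique g'
  exact ⟨z, (Sob.isLinearizedSolution_iff (z := z) hA hg').1 hz,
    fun y hy => hu y ((Sob.isLinearizedSolution_iff hA hg').2 hy)⟩

theorem Sob.isNondegenerate_of_equiv {V : RN N → ℝ} {f : ℝ → ℝ} {u : Sob N} {l : ℝ}
    {A : Sob N →L[ℝ] Sob N} (hA : ∀ v w : Sob N,
      hessianForm V f u.toH1 l v.toH1 w.toH1 = inner ℝ (A v) w)
    (h : ∃ A' : Sob.tangent u ≃L[ℝ] Sob.tangent u,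
      ∀ v w : Sob.tangent u, inner ℝ (A' v) w = inner ℝ (A v) (w : Sob N)) :
    IsNondegenerate V f u.toH1 l := by
  obtain ⟨A', hA'⟩ := h
  exact ⟨A', fun v w => (hA' v w).trans (hA (v.1 : H1 N) (w.1 : H1 N)).symm⟩

attribute [local irreducible] shift toL2 grad Sob Sob.fn Sob.gr Sob.tangent wOp nem nemDeriv
  Sob.translate

theorem minDist_le {n : ℕ} (a : Fin n → Fin N → ℤ) {i j : Fin n} (hij : i ≠ j) :
    minDist a ≤ ‖latticePoint (a i - a j)‖ := by
  rw [latticePoint_sub]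
  exact ciInf_le (Set.finite_range _).bddBelow
    (⟨(i, j), hij⟩ : {p : Fin n × Fin n // p.1 ≠ p.2})

/-- Configurations are filtered by `minDist`, so that an eventual statement along this filter
amounts to the existence of a separation threshold `R`. -/
theorem tendsto_sub_of_minDist {n : ℕ} {i j : Fin n} (hij : i ≠ j) :
    Tendsto (fun a : Fin n → Fin N → ℤ => a i - a j) (comap minDist atTop) (latticeInfty N) :=
  tendsto_comap_iff.2 (tendsto_atTop_mono (fun a => minDist_le a hij) tendsto_comap)

theorem ENat.eq_sub_one_of_add_one_eq {x : ℕ∞} {k : ℕ} (h : (k : ℕ∞) = x + 1) :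
    x = ((k - 1 : ℕ) : ℕ∞) := by
  induction x using ENat.recTopCoe with
  | top => simp at h
  | coe x =>
    have h' : k = x + 1 := by exact_mod_cast h
    rw [h']
    simp

namespace IsAdmissible

variable {f : ℝ → ℝ} {r S : ℝ}

theorem linearization_symm (h : IsAdmissible N f r S) {V : RN N → ℝ} (hV : IsPeriodicPotential V)
    (u : Sob N) (l : ℝ) (v w : Sob N) :
    inner ℝ ((energyOp V - l • massOp N - nemDeriv f u) v) w =
      inner ℝ v ((energyOp V - l • massOp N - nemDeriv f u) w) := by
  simp only [sub_apply, smul_apply, inner_sub_left, inner_sub_right, real_inner_smul_left,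
    real_inner_smul_right, energyOp_symm hV, massOp_symm, h.nemDeriv_symm]

/-- Under the monotonicity condition a nontrivial solution with invertible linearization has
positive free Morse index. -/
theorem formIndex_ne_zero (h : IsAdmissible N f r S) {V : RN N → ℝ} (hV : IsPeriodicPotential V)
    (hf : IsMonotoneNonlinearity f) {u : Sob N} {l c : ℝ} (hc : 0 < c)
    (hb : ∀ v, c * ‖v‖ ≤ ‖(energyOp V - l • massOp N - nemDeriv f u) v‖)
    (hu : energyOp V u - l • massOp N u - nem f u = 0) (hu0 : u ≠ 0) :
    formIndex (energyOp V - l • massOp N - nemDeriv f u) ⊤ ≠ 0 := by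
  intro h0
  -- At a solution the linearization `L` maps `u` to `f(u) - f'(u) u`, whose pairing with `u` is
  -- nonpositive by monotonicity. Index zero would make the form nonnegative, hence `‖L u‖² ≤ ‖L‖ ⟪L
  -- u, u⟫ ≤ 0`, against the lower bound for `L`.
  have h1 : inner ℝ ((energyOp V - l • massOp N - nemDeriv f u) u) u ≤ 0 := by
    have e : (energyOp V - l • massOp N - nemDeriv f u) u = nem f u - nemDeriv f u u := by
      rw [sub_apply, sub_apply, smul_apply, sub_eq_zero.1 hu]
    rw [e, inner_sub_left, h.inner_nem, h.inner_nemDeriv, sub_nonpos]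
    exact integral_mono (h.integrable_mul u u) (h.integrable_deriv_mul u u u) fun x =>
      hf.mul_le (h.contDiff.differentiable (by norm_num)) _
  have h2 := norm_sq_le_of_inner_nonneg (h.linearization_symm hV u l)
    (inner_nonneg_of_formIndex_eq_zero h0) u
  have h3 := hb u
  have h4 : 0 < c * ‖u‖ := mul_pos hc (norm_pos_iff.2 hu0)
  have h5 := mul_nonpos_of_nonneg_of_nonpos
    (norm_nonneg (energyOp V - l • massOp N - nemDeriv f u)) h1
  nlinarith

theorem mem_tangent_iff {u v : Sob N} : v ∈ Sob.tangent u ↔ inner ℝ (massOp N u) v = 0 := by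
  rw [Sob.mem_tangent, inner_massOp]

/-- Because `L z = J u`, the tangent space is the `L`-orthogonal complement of `z`, and likewise at
`ua` with `za`. The constrained indices are read off from the free ones, where passing from `u` to
`ua` multiplies by `n`, and from the sign of the pairing, which is the same at both. -/
theorem exists_multibump (h : IsAdmissible N f r S) (hN : 1 ≤ N) {V : RN N → ℝ}
    (hV : IsPeriodicPotential V) {α : ℝ} (hα : 0 < α) {n : ℕ} (hn : 2 ≤ n) {u z : Sob N} {l : ℝ}
    (hcrit : IsConstrainedCritical V f (α / n) u.toH1 l)
    (hnondeg : IsFullyNondegenerate V f u.toH1 l) {m : ℕ} (hm : morseIndex V f u.toH1 l = m)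
    (hz : IsLinearizedSolution V f u.toH1 l (l2functional u.toH1) z.toH1) :
    ∃ ε₀ : ℝ, 0 < ε₀ ∧ ∀ ε : ℝ, 0 < ε → ε ≤ ε₀ → ∃ R : ℝ, 0 < R ∧
      ∀ a : Fin n → Fin N → ℤ, R ≤ minDist a →
        ∃ (ua : Sob N) (la : ℝ),
          IsMultibump V f α u.toH1 l a ε ua.toH1 la ∧
          (∀ (w : Sob N) (μ : ℝ), IsMultibump V f α u.toH1 l a ε w.toH1 μ → w = ua ∧ μ = la) ∧
          IsNondegenerate V f ua.toH1 la ∧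
          (l2inner u.toH1 z.toH1 < 0 →
            morseIndex V f ua.toH1 la = ((n * (m + 1) - 1 : ℕ) : ℕ∞)) ∧
          (0 < l2inner u.toH1 z.toH1 → morseIndex V f ua.toH1 la = ((n * m : ℕ) : ℕ∞)) ∧
          (IsMonotoneNonlinearity f → 0 < morseIndex V f ua.toH1 la) := by
  have hn0 : (0 : ℝ) < n := by positivity
  have := latticeInfty_neBot hN
  have : Nonempty (Fin n) := ⟨⟨0, by omega⟩⟩
  set L : Sob N →L[ℝ] Sob N := energyOp V - l • massOp N - nemDeriv f u with hL
  have hLsym : ∀ v w, inner ℝ (L v) w = inner ℝ v (L w) := h.linearization_symm hV u l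
  obtain ⟨hsol, hmass⟩ := (h.isConstrainedCritical_iff hV).1 hcrit
  obtain ⟨c₀, hc₀, hb⟩ := exists_bounded_below_of_bijective
    (Sob.bijective_of_isFullyNondegenerate (h.hessianForm_eq hV u l) hnondeg)
  have hzL : L z = massOp N u := (Sob.isLinearizedSolution_iff (h.hessianForm_eq hV u l)
    fun w => (inner_massOp u w).symm).1 hz
  have hσ : inner ℝ (massOp N u) z ≠ 0 := by
    rw [inner_massOp]
    exact hnondeg.l2inner_ne_zero z.toH1 hz
  have hu0 : u ≠ 0 := by
    rintro rfl
    rw [inner_zero_right] at hmass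
    have : 0 < α / n := by positivity
    linarith
  have htan : ∀ v, v ∈ Sob.tangent u ↔ inner ℝ (L z) v = 0 := fun v => by
    rw [hzL, mem_tangent_iff]
  rw [h.morseIndex_eq hV] at hm
  have hneg : inner ℝ (massOp N u) z < 0 → formIndex L ⊤ = ((m + 1 : ℕ) : ℕ∞) := fun hs => by
    rw [formIndex_top_of_neg hLsym htan (by rwa [hzL]), hm]
    push_cast
    rfl
  have hpos : 0 < inner ℝ (massOp N u) z → formIndex L ⊤ = (m : ℕ∞) := fun hs => by
    rw [formIndex_top_of_pos hLsym htan (by rwa [hzL]), hm]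
  obtain ⟨k, hk⟩ : ∃ k : ℕ, formIndex L ⊤ = k := by
    rcases hσ.lt_or_gt with hs | hs
    · exact ⟨_, hneg hs⟩
    · exact ⟨_, hpos hs⟩
  obtain ⟨ε₀, hε₀, hmain⟩ := _root_.exists_multibump (latticeAction N) (energyOp_symm hV)
    massOp_symm h.nemDeriv_symm (fun b v => energyOp_translate hV b v)
    (fun b v => massOp_translate _ v) h.hasFDerivAt_nem h.nemDeriv_uniform hsol hmass
    (h.tendsto_nemDeriv_translate u) hk hc₀ hb hzL hσ
    (fun Binv hinv c hc hcoer => h.tendsto_norm_nemDeriv_comp hV l u Binv hinv hc hcoer)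
    (m := comap minDist atTop) (a := fun a : Fin n → Fin N → ℤ => a)
    (fun i j hij => tendsto_sub_of_minDist hij)
    (h.tendsto_nem_bump u fun i j hij => tendsto_sub_of_minDist hij)
    (h.tendsto_nemDeriv_bump u fun i j hij => tendsto_sub_of_minDist hij)
  refine ⟨ε₀, hε₀, fun ε hε hle => ?_⟩
  obtain ⟨R, hR⟩ := eventually_atTop.1 (eventually_comap.1 (hmain ε hε hle))
  refine ⟨max R 1, by positivity, fun a ha => ?_⟩
  obtain ⟨ua, μ, ⟨h1, h2, h3, h4⟩, huniq, hidx, ⟨E, hE⟩, za, hza, hsign⟩ :=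
    hR (minDist a) ((le_max_left _ _).trans ha) a rfl
  rw [Fintype.card_fin] at h2 huniq hidx
  have hαn : (n : ℝ) * (α / n) = α := by field_simp
  rw [hαn] at h2 huniq
  set A : Sob N →L[ℝ] Sob N := energyOp V - μ • massOp N - nemDeriv f ua with hAdef
  have hAsym : ∀ v w, inner ℝ (A v) w = inner ℝ v (A w) := h.linearization_symm hV ua μ
  have htan' : ∀ v, v ∈ Sob.tangent ua ↔ inner ℝ (A za) v = 0 := fun v => by
    rw [hza, mem_tangent_iff]
  have hza0 : inner ℝ (massOp N ua) za ≠ 0 := by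
    intro h0
    rw [h0, mul_zero] at hsign
    exact hsign.false
  have hidxneg : inner ℝ (massOp N u) z < 0 →
      morseIndex V f ua.toH1 μ = ((n * (m + 1) - 1 : ℕ) : ℕ∞) := fun hs => by
    have hk' : k = m + 1 := by
      have := hk.symm.trans (hneg hs)
      exact_mod_cast this
    have h5 : inner ℝ (A za) za < 0 := by
      rw [hza]
      exact (neg_iff_neg_of_mul_pos hsign).1 hs
    rw [formIndex_top_of_neg hAsym htan' h5, hk'] at hidx
    rw [h.morseIndex_eq hV]
    exact ENat.eq_sub_one_of_add_one_eq hidx.symm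
  have hidxpos : 0 < inner ℝ (massOp N u) z →
      morseIndex V f ua.toH1 μ = ((n * m : ℕ) : ℕ∞) := fun hs => by
    have hk' : k = m := by
      have := hk.symm.trans (hpos hs)
      exact_mod_cast this
    have h5 : 0 < inner ℝ (A za) za := by
      rw [hza]
      exact (pos_iff_pos_of_mul_pos hsign).1 hs
    rw [formIndex_top_of_pos hAsym htan' h5, hk'] at hidx
    rw [h.morseIndex_eq hV]
    exact hidx
  refine ⟨ua, μ, ⟨(h.isConstrainedCritical_iff hV).2 ⟨h1, h2⟩, ?_, h4⟩, fun w ν hw => ?_,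
    ?_, ?_, ?_, fun hf => ?_⟩
  · rw [← toH1_bump, Sob.norm_toH1_sub]
    exact h3
  · obtain ⟨hw1, hw2⟩ := (h.isConstrainedCritical_iff hV).1 hw.critical
    have hw3 := hw.norm_sub_le
    rw [← toH1_bump, Sob.norm_toH1_sub] at hw3
    exact huniq w ν hw1 hw2 hw3 hw.abs_sub_le
  · refine Sob.isNondegenerate_of_equiv (h.hessianForm_eq hV ua μ) ?_
    exact exists_equiv_of_hyperplane hE hza hza0 fun v => mem_tangent_iff
  · rw [← inner_massOp]
    exact hidxneg
  · rw [← inner_massOp]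
    exact hidxpos
  -- In the negative case `n ≥ 2` alone makes `n (m + 1) - 1` positive. In the positive case `m` is
  -- the free index of `u`, which (H4) makes nonzero.
  · have hk0 := h.formIndex_ne_zero hV hf hc₀ hb hsol hu0
    rcases hσ.lt_or_gt with hs | hs
    · rw [hidxneg hs, Nat.cast_pos]
      have : 2 * 1 ≤ n * (m + 1) := Nat.mul_le_mul hn (by omega)
      omega
    · rw [hidxpos hs, Nat.cast_pos]
      have hm0 : m ≠ 0 := by
        rintro rfl
        exact hk0 (by rw [← hL, hpos hs]; rfl)
      positivity

end IsAdmissible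

end Multibump

/-- Finiteness of the Morse index is expressed by the natural number `m`, and `zbar` stands for the
solution with right-hand side `ubar`, unique by full nondegeneracy. The truncated subtraction is
harmless since `n (m + 1) ≥ 2`. -/
theorem mainTheorem2 (N : ℕ) (hN : 1 ≤ N) (V : RN N → ℝ) (hV : IsPeriodicPotential V)
    (f : ℝ → ℝ) (hf : IsSubcriticalNonlinearity N f)
    (α : ℝ) (hα : 0 < α) (n : ℕ) (hn : 2 ≤ n)
    (ubar : H1 N) (lbar : ℝ) (hcrit : IsConstrainedCritical V f (α / n) ubar lbar)
    (hnondeg : IsFullyNondegenerate V f ubar lbar)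
    (m : ℕ) (hm : morseIndex V f ubar lbar = m)
    (zbar : H1 N) (hz : IsLinearizedSolution V f ubar lbar (l2functional ubar) zbar) :
    ∃ ε₀ : ℝ, 0 < ε₀ ∧ ∀ ε : ℝ, 0 < ε → ε ≤ ε₀ → ∃ R : ℝ, 0 < R ∧
      ∀ a : Fin n → Fin N → ℤ, R ≤ minDist a →
        ∃ (ua : H1 N) (la : ℝ),
          IsMultibump V f α ubar lbar a ε ua la ∧
          (∀ (w : H1 N) (μ : ℝ), IsMultibump V f α ubar lbar a ε w μ → w = ua ∧ μ = la) ∧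
          IsNondegenerate V f ua la ∧
          (l2inner ubar zbar < 0 →
            morseIndex V f ua la = ((n * (m + 1) - 1 : ℕ) : ℕ∞)) ∧
          (0 < l2inner ubar zbar → morseIndex V f ua la = ((n * m : ℕ) : ℕ∞)) ∧
          (IsMonotoneNonlinearity f → 0 < morseIndex V f ua la) := by
  obtain ⟨r, S, h⟩ := hf.exists_isAdmissible hN
  exact h.exists_multibump (u := ubar) (z := zbar) hN hV hα hn hcrit hnondeg hm hz
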